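/- For a group $G$ let $S(G)$ be the group of permutations of the set $G$, let $\rho(G)\le S(G)$ be the image of the right regular representation ($\rho(y)$ is the map $x\mapsto xy$), let $\mathrm{Hol}(G)$ be the normalizer of $\rho(G)$ in $S(G)$, let $\mathrm{NHol}(G)$ be the normalizer of $\mathrm{Hol}(G)$ in $S(G)$, and put $T(G)=\mathrm{NHol}(G)/\mathrm{Hol}(G)$. Write $[x,y]=x^{-1}y^{-1}xy$, and write $\mathbb{F}_p^\times$ for the multiplicative group of the field with $p$ elements. Let $p$ be a prime. For $n\in\{3,4\}$ and a word $w$ in $x_1,\dots,x_n$, let $$G_n(w)=\big\langle x_1,\dots,x_n : [[x_i,x_j],x_k]=1\ (1\le i,j,k\le n),\ x_i^p=1\ (2\le i\le n),\ x_1^p=w\big\rangle .$$ (a) If $p\ge 5$ and $G=G_3([x_1,x_2])$, then $|G|=p^6$ and $T(G)\simeq\mathbb{F}_p^\times$. (b) If $p\ge 3$ and $G=G_3([x_2,x_3])$, then $|G|=p^6$ and $T(G)\simeq\mathbb{F}_p^\times$. (c) If $p\ge 5$ and $G=G_4([x_1,x_2])$, then $|G|=p^{10}$ and $T(G)\simeq\mathbb{F}_p^\times$.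 (d) If $p\ge 3$ and $G=G_4([x_3,x_4])$, then $|G|=p^{10}$ and $T(G)\simeq\mathbb{F}_p^\times$. (e) If $p\ge 5$ and $G=G_4([x_1,x_2][x_3,x_4])$, then $|G|=p^{10}$ and $T(G)\simeq\mathbb{F}_p^\times\times\mathbb{F}_p^\times$. In each case $G$ has nilpotency class two and is special, that is, its commutator subgroup, its center and its Frattini subgroup coincide. Moreover, the order $p-1$ of $T(G)$ in (a)–(d) is the smallest possible: for $p\ge 3$, every finite $p$-group $H$ of nilpotency class two satisfies $|T(H)|\ge p-1$. -/

import Mathlib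

/-- The image of the right regular representation of `G` in the group of permutations of `G`:
all the maps `x ↦ x * y`. -/
def rightRegular (G : Type*) [Group G] : Subgroup (Equiv.Perm G) :=
  (MulAction.toPermHom Gᵐᵒᵖ G).range

/-- The holomorph `Hol(G)`: the normalizer of the right regular representation. -/
def Hol (G : Type*) [Group G] : Subgroup (Equiv.Perm G) :=
  Subgroup.normalizer (rightRegular G : Set (Equiv.Perm G))

/-- The multiple holomorph `NHol(G)`: the normalizer of the holomorph. -/
def NHol (G : Type*) [Group G] : Subgroup (Equiv.Perm G) :=
  Subgroup.normalizer (Hol G : Set (Equiv.Perm G))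

instance holNormal (G : Type*) [Group G] : ((Hol G).subgroupOf (NHol G)).Normal :=
  Subgroup.normal_in_normalizer

/-- The quotient group `T(G) = NHol(G) / Hol(G)`. -/
abbrev TGroup (G : Type*) [Group G] : Type _ :=
  NHol G ⧸ (Hol G).subgroupOf (NHol G)

/-- The commutator `[x, y] = x⁻¹ y⁻¹ x y`. -/
def pComm {G : Type*} [Group G] (x y : G) : G := x⁻¹ * y⁻¹ * x * y

/-- The relators of the group on generators `x 0, …, x (n - 1)` in which all the
`[[x i, x j], x k]` are trivial, `x i ^ p = 1` for `i ≠ 0`, and `x 0 ^ p = w`. -/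
def relators (n p : ℕ) [NeZero n] (w : FreeGroup (Fin n)) : Set (FreeGroup (Fin n)) :=
  {r | ∃ i j k : Fin n,
    r = pComm (pComm (FreeGroup.of i) (FreeGroup.of j)) (FreeGroup.of k)} ∪
  {r | ∃ i : Fin n, i ≠ 0 ∧ r = FreeGroup.of i ^ p} ∪
  {FreeGroup.of 0 ^ p * w⁻¹}

/-- Case (a): `3` generators and `x₁ ^ p = [x₁, x₂]` (indices are shifted down by one). -/
abbrev GroupA (p : ℕ) : Type :=
  PresentedGroup (relators 3 p (pComm (FreeGroup.of 0) (FreeGroup.of 1)))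

/-- Case (b): `3` generators and `x₁ ^ p = [x₂, x₃]`. -/
abbrev GroupB (p : ℕ) : Type :=
  PresentedGroup (relators 3 p (pComm (FreeGroup.of 1) (FreeGroup.of 2)))

/-- Case (c): `4` generators and `x₁ ^ p = [x₁, x₂]`. -/
abbrev GroupC (p : ℕ) : Type :=
  PresentedGroup (relators 4 p (pComm (FreeGroup.of 0) (FreeGroup.of 1)))

/-- Case (d): `4` generators and `x₁ ^ p = [x₃, x₄]`. -/
abbrev GroupD (p : ℕ) : Type :=
  PresentedGroup (relators 4 p (pComm (FreeGroup.of 2) (FreeGroup.of 3)))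

/-- Case (e): `4` generators and `x₁ ^ p = [x₁, x₂] [x₃, x₄]`. -/
abbrev GroupE (p : ℕ) : Type :=
  PresentedGroup (relators 4 p
    (pComm (FreeGroup.of 0) (FreeGroup.of 1) * pComm (FreeGroup.of 2) (FreeGroup.of 3)))

/-- `G` has nilpotency class two and is special: `G' = Z(G) = Frat(G)`. -/
def IsSpecialOfClassTwo (G : Type*) [Group G] : Prop :=
  Group.nilpotencyClass G = 2 ∧
    commutator G = Subgroup.center G ∧ Subgroup.center G = frattini G

/-! ### The holomorph, the multiple holomorph and transported operations. -/

section Holomorph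

/-! Let `π` lie in `NHol G` and fix `1`. Transporting the product of `G` back along `π` gives the
operation `x ∘ y = γ y x * y`, where `γ : G → Aut G` is a homomorphism with `γ (a y) = a γ(y) a⁻¹`
for every automorphism `a` (`exists_gamma_of_mem_NHol`). Conversely, for finite `G`, such a
description puts `π` in `NHol G` (`mem_NHol_of_gamma`), and `γ` determines `π` modulo `Hol G`. So
`T(G)` is found by classifying the `γ` that arise from some `π`.

Each of the five groups is identified with a `Model`: a central extension of `V = F_p^n` by the skew
matrices `Λ²V`, in which commutators are exterior products and the `p`-th power map is `v ↦ v 0 •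
w₀`. The power map is produced by the Witt cocycle. An order bound from the relations makes the
surjection from the presented group bijective. Automorphisms of the model act on `V` by the matrices
`A` with first row `(A 0 0, 0, …, 0)` and `A w₀ Aᵀ = A 0 0 • w₀`, and every such matrix occurs.

The core of the computation is to show that `γ` acts trivially on `V` (`Rigid`, checked by hand for
each `w₀`). Then `γ y x = x * δ(x, y)` with `δ : V × V → Λ²V` bilinear and equivariant under these
matrices (`exists_bilinear_of_gamma`). The commutator of the transported operation is `u ∧ v + δ(u,
v) - δ(v, u)`; its values must span `Λ²V` (`nondegenerate_of_gamma`). When `w₀` is decomposable, `δ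
= m • ∧`, and the invariant `1 + 2m ≠ 0` runs over `F_p^×`. When `w₀` is the symplectic bivector,
contraction with the symplectic form followed by multiplication with `w₀` gives a second independent
solution, hence a second factor `F_p^×`. Each solution is realized by an explicit permutation built
from a diagonal matrix.

The lower bound for a general group of class two comes from power maps with exponents prime to `p`:
they lie in `NHol`, and exponents differing modulo `p` give different classes. -/

theorem perm_apply_inv {α : Type*} (π : Equiv.Perm α) (x : α) : π (π⁻¹ x) = x :=
  π.apply_symm_apply x

theorem perm_inv_apply {α : Type*} (π : Equiv.Perm α) (x : α) : π⁻¹ (π x) = x :=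
  π.symm_apply_apply x

variable {G : Type*} [Group G]

theorem mem_rightRegular_iff {π : Equiv.Perm G} :
    π ∈ rightRegular G ↔ ∃ y, ∀ x, π x = x * y := by
  constructor
  · rintro ⟨y, rfl⟩
    exact ⟨y.unop, fun x => rfl⟩
  · rintro ⟨y, hy⟩
    exact ⟨MulOpposite.op y, Equiv.ext fun x => (hy x).symm⟩

/-- The holomorph consists of the affine permutations. -/
theorem mem_Hol_iff {π : Equiv.Perm G} :
    π ∈ Hol G ↔ ∀ x y, π (x * y) = π x * (π 1)⁻¹ * π y := by
  rw [Hol, Subgroup.mem_normalizer_iff]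
  constructor
  · intro h x y
    have h1 : MulAction.toPermHom Gᵐᵒᵖ G (MulOpposite.op y) ∈ rightRegular G := ⟨_, rfl⟩
    obtain ⟨z, hz⟩ := mem_rightRegular_iff.1 ((h _).1 h1)
    have h2 : ∀ x, π (x * y) = π x * z := fun x => by
      simpa using hz (π x)
    have h3 := h2 1
    rw [one_mul] at h3
    rw [h2 x, h3]
    group
  · intro h σ
    constructor
    · intro hσ
      obtain ⟨y, hy⟩ := mem_rightRegular_iff.1 hσ
      refine mem_rightRegular_iff.2 ⟨(π 1)⁻¹ * π y, fun x => ?_⟩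
      simp only [Equiv.Perm.mul_apply, hy]
      rw [h, perm_apply_inv, mul_assoc]
    · intro hσ
      obtain ⟨y, hy⟩ := mem_rightRegular_iff.1 hσ
      refine mem_rightRegular_iff.2 ⟨π⁻¹ (π 1 * y), fun x => ?_⟩
      have h1 := hy (π x)
      simp only [Equiv.Perm.mul_apply, perm_inv_apply] at h1
      apply π.injective
      rw [h1, h, perm_apply_inv]
      group

theorem mulAut_mem_Hol (a : MulAut G) : (a.toEquiv : Equiv.Perm G) ∈ Hol G := by
  rw [mem_Hol_iff]
  intro x y
  simp

theorem mulRight_mem_Hol (y : G) : (Equiv.mulRight y : Equiv.Perm G) ∈ Hol G := by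
  rw [mem_Hol_iff]
  intro x z
  simp [mul_assoc]

theorem exists_mulAut_of_mem_Hol {π : Equiv.Perm G} (h : π ∈ Hol G) :
    ∃ a : MulAut G, ∀ x, π x = a x * π 1 := by
  rw [mem_Hol_iff] at h
  refine ⟨⟨π.trans (Equiv.mulRight (π 1)⁻¹), fun x y => ?_⟩, fun x => ?_⟩
  · simp [h, mul_assoc]
  · change π x = π x * (π 1)⁻¹ * π 1
    group

theorem exists_mulAut_of_mem_Hol_of_map_one {π : Equiv.Perm G} (h : π ∈ Hol G) (h1 : π 1 = 1) :
    ∃ a : MulAut G, a.toEquiv = π := by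
  obtain ⟨a, ha⟩ := exists_mulAut_of_mem_Hol h
  exact ⟨a, Equiv.ext fun x => by simp [ha x, h1]⟩

theorem Hol_le_NHol : Hol G ≤ NHol G := Subgroup.le_normalizer

/-- A permutation `π` for which the transported operation is `(x, y) ↦ γ y x * y`,
with `γ y` automorphisms depending on `y` equivariantly, lies in the multiple holomorph. -/
theorem mem_NHol_of_gamma [Finite G] {π : Equiv.Perm G} (γ : G → MulAut G)
    (hγ : ∀ x y, π (γ y x * y) = π x * π y)
    (heq : ∀ (a : MulAut G) (x y : G), γ (a y) (a x) = a (γ y x)) : π ∈ NHol G := by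
  -- Conjugation by `π` preserves the set of automorphisms: equivariance of `γ` makes `π a π⁻¹`
  -- multiplicative, and finiteness reduces normalizing to one inclusion.
  let S : Set (Equiv.Perm G) := Set.range fun a : MulAut G => a.toEquiv
  have hS : π ∈ Subgroup.normalizer S := by
    refine Subgroup.mem_normalizer_fintype ?_
    rintro _ ⟨a, rfl⟩
    refine ⟨⟨π * a.toEquiv * π⁻¹, fun x y => ?_⟩, rfl⟩
    obtain ⟨x, rfl⟩ := π.surjective x
    obtain ⟨y, rfl⟩ := π.surjective y
    change π (a (π⁻¹ (π x * π y))) = π (a (π⁻¹ (π x))) * π (a (π⁻¹ (π y)))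
    rw [← hγ x y]
    simp only [perm_inv_apply]
    rw [map_mul, ← heq, hγ]
  have hi : π⁻¹ ∈ NHol G := by
    refine Subgroup.mem_normalizer_fintype ?_
    intro σ hσ
    obtain ⟨a, ha⟩ := exists_mulAut_of_mem_Hol hσ
    obtain ⟨y, hy⟩ := π.surjective (σ 1)
    have h2 : σ = Equiv.mulRight (σ 1) * a.toEquiv := Equiv.ext fun x => ha x
    have h3 : π⁻¹ * σ * π⁻¹⁻¹ =
        (π⁻¹ * Equiv.mulRight (σ 1) * π) * (π⁻¹ * a.toEquiv * π⁻¹⁻¹) := by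
      rw [h2]
      simp [mul_assoc]
    -- Pulled back along `π`, a right translation becomes right translation for the operation given
    -- by `γ`: an automorphism followed by an ordinary translation.
    have h4 : π⁻¹ * Equiv.mulRight (σ 1) * π = Equiv.mulRight y * (γ y).toEquiv := by
      ext x
      change π⁻¹ (π x * σ 1) = γ y x * y
      rw [Equiv.Perm.inv_eq_iff_eq, hγ, hy]
    obtain ⟨b, hb⟩ : π⁻¹ * a.toEquiv * π⁻¹⁻¹ ∈ S :=
      (Subgroup.mem_set_normalizer_iff.1
        ((Subgroup.normalizer S).inv_mem hS) a.toEquiv).1 ⟨a, rfl⟩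
    rw [SetLike.mem_coe, h3, h4, ← hb]
    exact mul_mem (mul_mem (mulRight_mem_Hol y) (mulAut_mem_Hol _)) (mulAut_mem_Hol b)
  simpa using inv_mem hi

/-- For `π` in the multiple holomorph fixing `1`, the transported operation is
`(x, y) ↦ γ y x * y` for an equivariant homomorphism `γ` to the automorphism group. -/
theorem exists_gamma_of_mem_NHol {π : Equiv.Perm G} (hπ : π ∈ NHol G) (h1 : π 1 = 1) :
    ∃ γ : G →* MulAut G, (∀ x y, π (γ y x * y) = π x * π y) ∧
      ∀ (a : MulAut G) (y : G), γ (a y) = a * γ y * a⁻¹ := by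
  have hconj : ∀ σ ∈ Hol G, π * σ * π⁻¹ ∈ Hol G := fun σ hσ =>
    (Subgroup.mem_normalizer_iff.1 hπ σ).1 hσ
  have hconj' : ∀ σ ∈ Hol G, π⁻¹ * σ * π ∈ Hol G := fun σ hσ =>
    (Subgroup.mem_normalizer_iff''.1 hπ σ).1 hσ
  have hex : ∀ y, ∃ a : MulAut G, ∀ x, π (a x * y) = π x * π y := by
    intro y
    obtain ⟨a, ha⟩ := exists_mulAut_of_mem_Hol (hconj' _ (mulRight_mem_Hol (π y)))
    refine ⟨a, fun x => ?_⟩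
    have h2 := ha x
    simp only [Equiv.Perm.mul_apply, Equiv.coe_mulRight, h1, one_mul,
      perm_inv_apply] at h2
    have h3 : π (π⁻¹ (π x * π y)) = π (a x * y) := congrArg π h2
    rw [perm_apply_inv] at h3
    exact h3.symm
  choose γ hγ using hex
  have heq : ∀ (a : MulAut G) (y : G), γ (a y) = a * γ y * a⁻¹ := by
    intro a y
    have h2 : (π * a.toEquiv * π⁻¹) 1 = 1 := by
      have : π⁻¹ 1 = 1 := by rw [Equiv.Perm.inv_eq_iff_eq, h1]
      rw [Equiv.Perm.mul_apply, Equiv.Perm.mul_apply, this]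
      change π (a 1) = 1
      rw [map_one, h1]
    obtain ⟨b, hb⟩ := exists_mulAut_of_mem_Hol_of_map_one (hconj _ (mulAut_mem_Hol a)) h2
    have hb' : ∀ x, π (a x) = b (π x) := fun x => by
      have h3 : b (π x) = (π * a.toEquiv * π⁻¹) (π x) :=
        congrArg (fun e : Equiv.Perm G => e (π x)) hb
      rw [h3]
      simp
    have h3 : γ (a y) * a = a * γ y := by
      ext x
      have h4 : π (γ (a y) (a x) * a y) = π (a (γ y x) * a y) := by
        rw [hγ, hb', hb', ← map_mul, ← hγ, ← hb', map_mul]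
      exact mul_right_cancel (π.injective h4)
    rw [← h3, mul_assoc, mul_inv_cancel, mul_one]
  have hmul : ∀ y z, γ (y * z) = γ y * γ z := by
    intro y z
    obtain ⟨y, rfl⟩ := (γ z).surjective y
    -- This is associativity of the transported operation. Equivariance under the automorphism `γ z`
    -- then turns it into multiplicativity of `γ`.
    have h2 : γ (γ z y * z) = γ z * γ y := by
      ext x
      have h4 : π (γ (γ z y * z) x * (γ z y * z)) = π (γ z (γ y x) * (γ z y * z)) := by
        rw [hγ, hγ, ← mul_assoc (γ z (γ y x)), ← map_mul (γ z), hγ z (γ y x * y), hγ, mul_assoc]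
      exact mul_right_cancel (π.injective h4)
    rw [h2, heq]
    group
  exact ⟨MonoidHom.mk' γ hmul, fun x y => hγ y x, heq⟩

/-- Permutations fixing `1` and defining the same transported operation differ by an
automorphism. -/
theorem mul_inv_mem_Hol_of_gamma {π σ : Equiv.Perm G} (γ : G → G → G)
    (hπ : ∀ x y, π (γ y x * y) = π x * π y) (hσ : ∀ x y, σ (γ y x * y) = σ x * σ y) :
    π * σ⁻¹ ∈ Hol G := by
  have h1 : ∀ x y, (π * σ⁻¹) (x * y) = (π * σ⁻¹) x * (π * σ⁻¹) y := by
    intro x y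
    obtain ⟨x, rfl⟩ := σ.surjective x
    obtain ⟨y, rfl⟩ := σ.surjective y
    rw [← hσ]
    simp [hπ]
  exact mulAut_mem_Hol (⟨π * σ⁻¹, h1⟩ : MulAut G)

/-- A description of `T(G)` by representatives. -/
theorem nonempty_TGroup_mulEquiv {Q : Type*} [Group Q] (F : Q → Equiv.Perm G)
    (hmul : ∀ a b, F (a * b) = F a * F b) (hF : ∀ q, F q ∈ NHol G)
    (hinj : ∀ q, F q ∈ Hol G → q = 1)
    (hsurj : ∀ π ∈ NHol G, π 1 = 1 → ∃ q, π * (F q)⁻¹ ∈ Hol G) :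
    Nonempty (TGroup G ≃* Q) := by
  let f : Q →* NHol G := MonoidHom.mk' (fun q => ⟨F q, hF q⟩) fun a b => Subtype.ext (hmul a b)
  let g : Q →* TGroup G := (QuotientGroup.mk' _).comp f
  refine ⟨(MulEquiv.ofBijective g ⟨?_, ?_⟩).symm⟩
  · rw [injective_iff_map_eq_one]
    intro q hq
    exact hinj q (Subgroup.mem_subgroupOf.1 ((QuotientGroup.eq_one_iff _).1 hq))
  · intro t
    obtain ⟨⟨π, hπ⟩, rfl⟩ := QuotientGroup.mk_surjective t
    have h1 : Equiv.mulRight (π 1)⁻¹ * π ∈ NHol G := mul_mem (Hol_le_NHol (mulRight_mem_Hol _)) hπ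
    obtain ⟨q, hq⟩ := hsurj _ h1 (by simp)
    refine ⟨q, ?_⟩
    have h2 : π * (F q)⁻¹ ∈ Hol G := by
      have h3 : π * (F q)⁻¹ =
          Equiv.mulRight (π 1) * (Equiv.mulRight (π 1)⁻¹ * π * (F q)⁻¹) := by
        ext x
        simp
      rw [h3]
      exact mul_mem (mulRight_mem_Hol (π 1)) hq
    change (QuotientGroup.mk (f q) : TGroup G) = QuotientGroup.mk _
    rw [QuotientGroup.eq, ← (holNormal G).mem_comm_iff]
    exact Subgroup.mem_subgroupOf.2 h2

end Holomorph

/-! ### Invariance under isomorphism. -/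

section Transport

variable {G H : Type*} [Group G] [Group H]

theorem map_permCongr_Hol (e : G ≃* H) :
    (Hol G).map e.toEquiv.permCongrHom.toMonoidHom = Hol H := by
  ext π
  rw [Subgroup.mem_map_equiv, mem_Hol_iff, mem_Hol_iff]
  constructor
  · intro h x y
    have := h (e.symm x) (e.symm y)
    simpa [Equiv.permCongrHom, Equiv.permCongr_symm, Equiv.permCongr_apply] using congrArg e this
  · intro h x y
    apply e.injective
    simpa [Equiv.permCongrHom, Equiv.permCongr_symm, Equiv.permCongr_apply] using h (e x) (e y)

theorem map_permCongr_NHol (e : G ≃* H) :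
    (NHol G).map e.toEquiv.permCongrHom.toMonoidHom = NHol H := by
  rw [NHol, NHol, Subgroup.map_equiv_normalizer_eq, map_permCongr_Hol]

/-- Isomorphic groups have isomorphic groups `T`. -/
theorem nonempty_TGroup_congr (e : G ≃* H) : Nonempty (TGroup G ≃* TGroup H) := by
  let f : NHol G ≃* NHol H :=
    (e.toEquiv.permCongrHom.subgroupMap (NHol G)).trans
      (MulEquiv.subgroupCongr (map_permCongr_NHol e))
  refine ⟨QuotientGroup.congr _ _ f ?_⟩
  change Subgroup.map f.toMonoidHom _ = _
  ext ⟨π, hπ⟩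
  rw [Subgroup.mem_map_equiv, Subgroup.mem_subgroupOf, Subgroup.mem_subgroupOf]
  obtain ⟨⟨σ, hσ⟩, hf⟩ := f.surjective ⟨π, hπ⟩
  rw [← hf, MulEquiv.symm_apply_apply]
  have h1 : ((f ⟨σ, hσ⟩ : NHol H) : Equiv.Perm H) = e.toEquiv.permCongrHom σ := rfl
  rw [h1, ← map_permCongr_Hol e, Subgroup.mem_map_equiv, MulEquiv.symm_apply_apply]

theorem IsSpecialOfClassTwo.congr (e : G ≃* H) (h : IsSpecialOfClassTwo H) :
    IsSpecialOfClassTwo G := by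
  obtain ⟨h1, h2, h3⟩ := h
  have hn : Group.IsNilpotent H := by
    by_contra hn
    rw [Group.nilpotencyClass_of_not_nilpotent hn] at h1
    omega
  have hG : Group.IsNilpotent G :=
    Group.nilpotent_of_surjective e.symm.toMonoidHom e.symm.surjective
  have hcom : commutator G = (commutator H).comap e.toMonoidHom := by
    have : (commutator H).comap e.toMonoidHom = (commutator H).map e.symm.toMonoidHom :=
      Subgroup.comap_equiv_eq_map_symm e _
    rw [this, commutator_def, commutator_def, Subgroup.map_commutator,
      Subgroup.map_top_of_surjective _ e.symm.surjective]
  have hcen : Subgroup.center G = (Subgroup.center H).comap e.toMonoidHom := by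
    ext x
    simp only [Subgroup.mem_comap, Subgroup.mem_center_iff]
    refine ⟨fun hx y => ?_, fun hx y => e.injective ?_⟩
    · obtain ⟨y, rfl⟩ := e.surjective y
      simpa using congrArg e (hx y)
    · simpa using hx (e y)
  have hfr : frattini G = (frattini H).comap e.toMonoidHom :=
    (e.comapSubgroup.map_radical).symm
  refine ⟨?_, by rw [hcom, hcen, h2], by rw [hcen, hfr, h3]⟩
  rw [← h1]
  exact le_antisymm (Group.nilpotencyClass_le_of_surjective e.symm.toMonoidHom e.symm.surjective)
    (Group.nilpotencyClass_le_of_surjective e.toMonoidHom e.surjective)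

end Transport

/-! ### Commutator calculus in class two, and the lower bound from power maps. -/

theorem mul_eq_mul_pComm {G : Type*} [Group G] (x y : G) : x * y = y * x * pComm x y := by
  simp only [pComm]
  group

theorem map_pComm {G H F : Type*} [Group G] [Group H] [FunLike F G H] [MonoidHomClass F G H]
    (f : F) (x y : G) : f (pComm x y) = pComm (f x) (f y) := by
  simp [pComm]

/-- All commutators are central. -/
def CentralCommutators (G : Type*) [Group G] : Prop :=
  ∀ x y z : G, pComm x y * z = z * pComm x y

namespace CentralCommutators

variable {G : Type*} [Group G] (hc : CentralCommutators G)
include hc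

theorem pComm_mul_left (x y z : G) : pComm (x * y) z = pComm x z * pComm y z := by
  have h1 : x * y * z = z * (x * y) * (pComm x z * pComm y z) := by
    calc x * y * z = x * (z * y * pComm y z) := by rw [mul_assoc, mul_eq_mul_pComm y z]
      _ = (x * z) * y * pComm y z := by group
      _ = z * x * (pComm x z * y) * pComm y z := by rw [mul_eq_mul_pComm x z]; group
      _ = z * (x * y) * (pComm x z * pComm y z) := by rw [hc]; group
  rw [mul_eq_mul_pComm (x * y) z] at h1
  exact mul_left_cancel h1

theorem pComm_mul_right (x y z : G) : pComm x (y * z) = pComm x y * pComm x z := by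
  have hinv : ∀ a b : G, pComm a b = (pComm b a)⁻¹ := fun a b => by simp only [pComm]; group
  rw [hinv x (y * z), hc.pComm_mul_left, mul_inv_rev, ← hinv, ← hinv, hc]

theorem pComm_pow_left (x y : G) (k : ℕ) : pComm (x ^ k) y = pComm x y ^ k := by
  induction k with
  | zero => simp [pComm]
  | succ k ih => rw [pow_succ, hc.pComm_mul_left, ih, pow_succ]

theorem pComm_pow_right (x y : G) (k : ℕ) : pComm x (y ^ k) = pComm x y ^ k := by
  induction k with
  | zero => simp [pComm]
  | succ k ih => rw [pow_succ, hc.pComm_mul_right, ih, pow_succ]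

theorem commute_pComm (x y z : G) : Commute (pComm x y) z := hc x y z

/-- The power map with odd exponent `2 * m + 1` transports the operation to
`(x, y) ↦ (y ^ m)⁻¹ * x * y ^ m * y`. -/
theorem pow_two_mul_add_one (x y : G) (m : ℕ) :
    ((y ^ m)⁻¹ * x * y ^ m * y) ^ (2 * m + 1) = x ^ (2 * m + 1) * y ^ (2 * m + 1) := by
  -- Hall's power formula in class two.
  have h1 : ∀ k : ℕ, (x * y) ^ k * pComm x y ^ (k * (k - 1) / 2) = x ^ k * y ^ k := by
    intro k
    induction k with
    | zero => simp
    | succ k ih =>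
      have h2 : (k + 1) * (k + 1 - 1) / 2 = k * (k - 1) / 2 + k := by
        rcases k with _ | k
        · rfl
        · have : (k + 1 + 1) * (k + 1 + 1 - 1) = (k + 1) * (k + 1 - 1) + 2 * (k + 1) := by
            simp only [Nat.add_sub_cancel]
            ring
          rw [this, Nat.add_mul_div_left _ _ (by norm_num)]
      have hz : ∀ j : ℕ, Commute (pComm x y ^ j) (x * y) := fun j =>
        (hc.commute_pComm x y _).pow_left j
      have hy : Commute (pComm x y ^ k) y := (hc.commute_pComm x y _).pow_left k
      have h3 : y ^ k * (x * pComm x y ^ k) = x * y ^ k := by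
        rw [← hc.pComm_pow_right, mul_eq_mul_pComm x (y ^ k), mul_assoc]
      calc (x * y) ^ (k + 1) * pComm x y ^ ((k + 1) * (k + 1 - 1) / 2)
          = (x * y) ^ k * ((x * y) * pComm x y ^ (k * (k - 1) / 2)) * pComm x y ^ k := by
            rw [h2, pow_succ, pow_add]; group
        _ = (x * y) ^ k * pComm x y ^ (k * (k - 1) / 2) * (x * y) * pComm x y ^ k := by
            rw [← (hz _).eq]; group
        _ = x ^ k * (y ^ k * (x * pComm x y ^ k)) * y := by
            rw [ih, mul_assoc _ (x * y), mul_assoc x y, ← hy.eq]; group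
        _ = x ^ (k + 1) * y ^ (k + 1) := by
            rw [h3, pow_succ x, pow_succ' y, ← (Commute.refl y).pow_left k |>.eq]; group
  -- Conjugating `x` by `y ^ m` contributes `[x, y] ^ m`. With `k = 2 * m + 1` one has `m * k = k *
  -- (k - 1) / 2`, which is the correction in the power formula.
  have h2 : (y ^ m)⁻¹ * x * y ^ m * y = x * y * pComm x y ^ m := by
    have h3 : x * y ^ m = y ^ m * x * pComm x y ^ m := by
      rw [mul_eq_mul_pComm x, hc.pComm_pow_right]
    have hy : Commute (pComm x y ^ m) y := (hc.commute_pComm x y _).pow_left m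
    rw [mul_assoc _ x, h3, mul_assoc _ _ y, mul_assoc x y, ← hy.eq]
    group
  rw [h2, ((hc.commute_pComm x y (x * y)).pow_left m).symm.mul_pow, ← h1, ← pow_mul]
  congr 2
  rw [Nat.add_sub_cancel, show (2 * m + 1) * (2 * m) = 2 * (m * (2 * m + 1)) by ring]
  exact (Nat.mul_div_cancel_left _ (by norm_num)).symm

end CentralCommutators

open commutatorElement in
theorem CentralCommutators.of_commutator_le {G : Type*} [Group G]
    (h : commutator G ≤ Subgroup.center G) : CentralCommutators G := by
  intro x y z
  have h1 : pComm x y ∈ commutator G := by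
    have : pComm x y = ⁅x⁻¹, y⁻¹⁆ := by simp [pComm, commutatorElement_def]
    rw [this]
    exact Subgroup.commutator_mem_commutator (Subgroup.mem_top _) (Subgroup.mem_top _)
  exact ((Subgroup.mem_center_iff.1 (h h1)) z).symm

theorem commutator_le_center_of_nilpotencyClass {G : Type*} [Group G]
    (h : Group.nilpotencyClass G = 2) : commutator G ≤ Subgroup.center G := by
  have hn : Group.IsNilpotent G := by
    by_contra hn
    rw [Group.nilpotencyClass_of_not_nilpotent hn] at h
    omega
  have hu : Subgroup.upperCentralSeries G 2 = ⊤ := by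
    rw [← h]
    exact Subgroup.upperCentralSeries_nilpotencyClass
  rw [commutator_def, Subgroup.commutator_le]
  intro x _ y _
  have hx : x ∈ Subgroup.upperCentralSeries G (1 + 1) := by rw [hu]; trivial
  rw [Subgroup.mem_upperCentralSeries_succ_iff] at hx
  have := hx y
  rwa [Subgroup.upperCentralSeries_one] at this

/-- For an odd prime `p`, a finite `p`-group of class two has at least `p - 1` elements in `T`,
represented by power maps. -/
theorem sub_one_le_card_TGroup {p : ℕ} (hp : p.Prime) (hp3 : 3 ≤ p) {H : Type*} [Group H] [Finite H]
    (hH : IsPGroup p H) (h2 : Group.nilpotencyClass H = 2) : p - 1 ≤ Nat.card (TGroup H) := by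
  have hcc := commutator_le_center_of_nilpotencyClass h2
  have hc := CentralCommutators.of_commutator_le hcc
  have : Fact p.Prime := ⟨hp⟩
  obtain ⟨n, hn⟩ := IsPGroup.iff_card.1 hH
  obtain ⟨x, y, hxy⟩ : ∃ x y : H, pComm x y ≠ 1 := by
    by_contra! hcomm
    have hcomm' : ∀ x y : H, x * y = y * x := fun x y => by
      rw [mul_eq_mul_pComm, hcomm, mul_one]
    let _ : CommGroup H := { mul_comm := hcomm' }
    have : Group.nilpotencyClass H ≤ 1 := CommGroup.nilpotencyClass_le_one
    omega
  -- Since `p` is odd, one of `u.val` and `u.val + p` is odd.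
  have hodd : ∀ u : (ZMod p)ˣ, ∃ m : ℕ, ((2 * m + 1 : ℕ) : ZMod p) = u := by
    intro u
    rcases Nat.even_or_odd' (u : ZMod p).val with ⟨k, hk | hk⟩
    · obtain ⟨j, hj⟩ := hp.odd_of_ne_two (by omega)
      refine ⟨k + j, ?_⟩
      rw [show 2 * (k + j) + 1 = (u : ZMod p).val + p by omega, Nat.cast_add, ZMod.natCast_self,
        add_zero, ZMod.natCast_zmod_val]
    · refine ⟨k, ?_⟩
      rw [← hk, ZMod.natCast_zmod_val]
  choose m hm using hodd
  have hcop : ∀ u, (Nat.card H).Coprime (2 * m u + 1) := by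
    intro u
    rw [hn]
    apply Nat.Coprime.pow_left
    rw [hp.coprime_iff_not_dvd, ← ZMod.natCast_eq_zero_iff, hm]
    exact u.ne_zero
  let F : (ZMod p)ˣ → Equiv.Perm H := fun u => powCoprime (hcop u)
  have hF : ∀ u z, F u z = z ^ (2 * m u + 1) := fun u z => rfl
  have hFN : ∀ u, F u ∈ NHol H := by
    intro u
    refine mem_NHol_of_gamma (fun y => MulAut.conj (y ^ m u)⁻¹) (fun x y => ?_)
      fun a x y => ?_
    · rw [hF, hF, hF, ← hc.pow_two_mul_add_one]
      rw [MulAut.conj_apply, inv_inv]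
    · rw [MulAut.conj_apply, MulAut.conj_apply]
      simp only [map_mul, map_inv, map_pow]
  let g : (ZMod p)ˣ → TGroup H := fun u => QuotientGroup.mk ⟨F u, hFN u⟩
  have hg : Function.Injective g := by
    intro u v huv
    have h1 : (F u)⁻¹ * F v ∈ Hol H := Subgroup.mem_subgroupOf.1 (QuotientGroup.eq.1 huv)
    have h0 : ((F u)⁻¹ * F v) 1 = 1 := by
      rw [Equiv.Perm.mul_apply, Equiv.Perm.inv_eq_iff_eq]
      simp [hF]
    obtain ⟨a, ha⟩ := exists_mulAut_of_mem_Hol_of_map_one h1 h0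
    have ha' : ∀ z, a z ^ (2 * m u + 1) = z ^ (2 * m v + 1) := fun z => by
      have h3 : a z = ((F u)⁻¹ * F v) z := congrArg (fun e : Equiv.Perm H => e z) ha
      rw [← hF, ← hF, h3, Equiv.Perm.mul_apply, perm_apply_inv]
    set c := pComm x y with hcdef
    -- Write `r`, `s` for the two exponents, so `a z ^ r = z ^ s`. Bilinearity of the commutator
    -- gives `a c ^ (r * r) = c ^ (s * s)`, while `a c ^ r = c ^ s` gives `a c ^ (r * r) = c ^ (s *
    -- r)`. As `p` divides the order of `c`, it follows that `r` and `s` agree modulo `p`.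
    have h4 : (a c ^ (2 * m u + 1)) ^ (2 * m u + 1) = (c ^ (2 * m v + 1)) ^ (2 * m v + 1) := by
      rw [hcdef, map_pComm, ← hc.pComm_pow_left, ← hc.pComm_pow_right, ha', ha',
        hc.pComm_pow_left, hc.pComm_pow_right]
    rw [ha', ← pow_mul, ← pow_mul, pow_eq_pow_iff_modEq] at h4
    have hpc : p ∣ orderOf c := by
      obtain ⟨k, hk⟩ := IsPGroup.iff_orderOf.1 hH c
      rw [hk]
      refine dvd_pow_self p ?_
      rintro rfl
      rw [pow_zero, orderOf_eq_one_iff] at hk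
      exact hxy hk
    have h5 := (ZMod.natCast_eq_natCast_iff _ _ _).2 (h4.of_dvd hpc)
    rw [Nat.cast_mul, Nat.cast_mul, hm, hm] at h5
    exact Units.ext (mul_left_cancel₀ v.ne_zero h5)
  calc p - 1 = Nat.card (ZMod p)ˣ := by
        rw [Nat.card_eq_fintype_card, ZMod.card_units]
    _ ≤ Nat.card (TGroup H) := Nat.card_le_card_of_injective g hg

/-! ### The Witt cocycle. -/

section WittSum

/-- The polynomial `(a ^ p + b ^ p - (a + b) ^ p) / p` modulo `p`. -/
def wittSum (p : ℕ) (a b : ZMod p) : ZMod p :=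
  -∑ k ∈ Finset.Ico 1 p, ((p.choose k / p : ℕ) : ZMod p) * (a ^ k * b ^ (p - k))

/-- The inner binomial coefficients are divisible by `p`, so the quotient is an integral polynomial
and can be evaluated on residues. Identities for `wittSum` are thus proved over `ℤ` after
multiplication by `p`, then reduced. -/
theorem exists_int_wittSum (p : ℕ) [hp : Fact p.Prime] (a b : ℤ) :
    ∃ c : ℤ, (p : ℤ) * c = a ^ p + b ^ p - (a + b) ^ p ∧ (c : ZMod p) = wittSum p a b := by
  refine ⟨-∑ k ∈ Finset.Ico 1 p, ((p.choose k / p : ℕ) : ℤ) * (a ^ k * b ^ (p - k)), ?_, ?_⟩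
  · have h1 : (a + b) ^ p = a ^ p + b ^ p +
        ∑ k ∈ Finset.Ico 1 p, (p.choose k : ℤ) * (a ^ k * b ^ (p - k)) := by
      rw [add_pow, Finset.range_eq_Ico, Finset.sum_eq_sum_Ico_succ_bot (by omega),
        Finset.sum_Ico_succ_top (by have := hp.out.one_lt; omega)]
      simp
      rw [Finset.sum_congr rfl fun k _ => mul_comm (a ^ k * b ^ (p - k)) (p.choose k : ℤ)]
      ring
    rw [h1, mul_neg, Finset.mul_sum]
    have h2 : ∀ k ∈ Finset.Ico 1 p, (p : ℤ) * (((p.choose k / p : ℕ) : ℤ) * (a ^ k * b ^ (p - k)))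
        = (p.choose k : ℤ) * (a ^ k * b ^ (p - k)) := by
      intro k hk
      rw [Finset.mem_Ico] at hk
      have h3 : p * (p.choose k / p) = p.choose k :=
        Nat.mul_div_cancel' (hp.out.dvd_choose_self (by omega) hk.2)
      rw [← mul_assoc, ← Nat.cast_mul, h3]
    rw [Finset.sum_congr rfl h2]
    ring
  · simp only [wittSum, Int.cast_neg, Int.cast_sum, Int.cast_mul, Int.cast_pow, Int.cast_natCast]

variable {p : ℕ} [hp : Fact p.Prime]

theorem wittSum_comm (a b : ZMod p) : wittSum p a b = wittSum p b a := by
  obtain ⟨a, rfl⟩ := ZMod.intCast_surjective a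
  obtain ⟨b, rfl⟩ := ZMod.intCast_surjective b
  obtain ⟨c, hc, hc'⟩ := exists_int_wittSum p a b
  obtain ⟨d, hd, hd'⟩ := exists_int_wittSum p b a
  have hp0 : (p : ℤ) ≠ 0 := Nat.cast_ne_zero.2 hp.out.ne_zero
  rw [← hc', ← hd', show c = d from mul_left_cancel₀ hp0 (by rw [hc, hd, add_comm b a]; ring)]

theorem wittSum_cocycle (a b c : ZMod p) :
    wittSum p a b + wittSum p (a + b) c = wittSum p b c + wittSum p a (b + c) := by
  obtain ⟨a, rfl⟩ := ZMod.intCast_surjective a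
  obtain ⟨b, rfl⟩ := ZMod.intCast_surjective b
  obtain ⟨c, rfl⟩ := ZMod.intCast_surjective c
  obtain ⟨x, hx, hx'⟩ := exists_int_wittSum p a b
  obtain ⟨y, hy, hy'⟩ := exists_int_wittSum p (a + b) c
  obtain ⟨z, hz, hz'⟩ := exists_int_wittSum p b c
  obtain ⟨t, ht, ht'⟩ := exists_int_wittSum p a (b + c)
  have hp0 : (p : ℤ) ≠ 0 := Nat.cast_ne_zero.2 hp.out.ne_zero
  have h : x + y = z + t := by
    apply mul_left_cancel₀ hp0
    rw [mul_add, mul_add, hx, hy, hz, ht]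
    ring
  rw [← Int.cast_add, ← Int.cast_add, ← hx', ← hy', ← hz', ← ht', ← Int.cast_add, ← Int.cast_add, h]

/-- The polynomial is homogeneous of degree `p`, and `t ^ p = t` in `ZMod p`. This degree-one
homogeneity is what lets matrices act on the model. -/
theorem wittSum_mul (t a b : ZMod p) : wittSum p (t * a) (t * b) = t * wittSum p a b := by
  rw [wittSum, wittSum, mul_neg, Finset.mul_sum]
  congr 1
  refine Finset.sum_congr rfl fun k hk => ?_
  rw [Finset.mem_Ico] at hk
  have h1 : t ^ k * t ^ (p - k) = t := by
    rw [← pow_add, Nat.add_sub_cancel' hk.2.le, ZMod.pow_card]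
  rw [mul_pow, mul_pow]
  linear_combination (((p.choose k / p : ℕ) : ZMod p) * a ^ k * b ^ (p - k)) * h1

theorem wittSum_zero_left (b : ZMod p) : wittSum p 0 b = 0 := by
  rw [wittSum, Finset.sum_eq_zero, neg_zero]
  intro k hk
  rw [Finset.mem_Ico] at hk
  rw [zero_pow (by omega), zero_mul, mul_zero]

theorem wittSum_zero_right (a : ZMod p) : wittSum p a 0 = 0 := by
  rw [wittSum_comm, wittSum_zero_left]

/-- After scaling to `a = 1`, the integers `j ^ p + 1 - (j + 1) ^ p` telescope: `p` times the sum is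
`p - p ^ p`, so the sum is `1 - p ^ (p - 1)`, which is `1` modulo `p`. In the model this sum is the
`p`-th power. -/
theorem sum_wittSum (a : ZMod p) : ∑ j ∈ Finset.range p, wittSum p (j * a) a = a := by
  have h1 : ∀ j : ℕ, wittSum p (j * a) a = a * wittSum p j 1 := fun j => by
    rw [← wittSum_mul, mul_comm, mul_one]
  simp only [h1]
  rw [← Finset.mul_sum]
  choose c hc hc' using fun j : ℕ => exists_int_wittSum p j 1
  have h2 : ∀ k : ℕ, (p : ℤ) * ∑ j ∈ Finset.range k, c j = k - (k : ℤ) ^ p := by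
    intro k
    induction k with
    | zero => simp [hp.out.ne_zero]
    | succ k ih =>
      rw [Finset.sum_range_succ, mul_add, ih, hc]
      push_cast
      ring
  have h3 : ∑ j ∈ Finset.range p, c j = 1 - (p : ℤ) ^ (p - 1) := by
    have hp0 : (p : ℤ) ≠ 0 := Nat.cast_ne_zero.2 hp.out.ne_zero
    apply mul_left_cancel₀ hp0
    rw [h2, mul_sub, mul_one, ← pow_succ', Nat.sub_add_cancel hp.out.one_le]
  have h4 : ∑ j ∈ Finset.range p, wittSum p j 1 = 1 := by
    have h5 : ∀ j : ℕ, wittSum p j 1 = (c j : ZMod p) := fun j => by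
      rw [hc', Int.cast_natCast, Int.cast_one]
    have h6 : p - 1 ≠ 0 := by have := hp.out.one_lt; omega
    simp only [h5]
    rw [← Int.cast_sum, h3]
    simp [h6]
  rw [h4, mul_one]

end WittSum

/-! ### Skew-symmetric matrices as the exterior square. -/

section Skew

variable (p n : ℕ)

/-- The skew-symmetric matrices. -/
def skew : Submodule (ZMod p) (Matrix (Fin n) (Fin n) (ZMod p)) where
  carrier := {X | X.transpose = -X}
  add_mem' {X Y} hX hY := by
    simp only [Set.mem_ofPred_eq] at *
    rw [Matrix.transpose_add, hX, hY, neg_add]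
  zero_mem' := by simp
  smul_mem' c X hX := by
    simp only [Set.mem_ofPred_eq] at *
    rw [Matrix.transpose_smul, hX, smul_neg]

variable {p n}

theorem skew_apply (X : skew p n) (i j : Fin n) : X.1 j i = -X.1 i j :=
  congrFun (congrFun X.2 i) j

/-- The exterior product of two vectors, as a skew-symmetric matrix. -/
def wedge : (Fin n → ZMod p) →ₗ[ZMod p] (Fin n → ZMod p) →ₗ[ZMod p] skew p n :=
  LinearMap.mk₂ (ZMod p)
    (fun u v => ⟨Matrix.vecMulVec u v - Matrix.vecMulVec v u, by
      change Matrix.transpose _ = -_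
      rw [Matrix.transpose_sub, Matrix.transpose_vecMulVec, Matrix.transpose_vecMulVec, neg_sub]⟩)
    (fun u u' v => Subtype.ext <| by
      ext i j; simp [Matrix.vecMulVec_apply]; ring)
    (fun c u v => Subtype.ext <| by
      ext i j; simp [Matrix.vecMulVec_apply]; ring)
    (fun u v v' => Subtype.ext <| by
      ext i j; simp [Matrix.vecMulVec_apply]; ring)
    (fun c u v => Subtype.ext <| by
      ext i j; simp [Matrix.vecMulVec_apply]; ring)

theorem wedge_apply (u v : Fin n → ZMod p) (i j : Fin n) :
    (wedge u v).1 i j = u i * v j - v i * u j := rfl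

theorem wedge_self (u : Fin n → ZMod p) : wedge u u = 0 := by
  ext i j
  simp [wedge_apply]

theorem wedge_swap (u v : Fin n → ZMod p) : wedge u v = -wedge v u := by
  ext i j
  simp [wedge_apply]

/-- The action `X ↦ A X Aᵀ` on skew-symmetric matrices. -/
def congruence (A : Matrix (Fin n) (Fin n) (ZMod p)) : skew p n →ₗ[ZMod p] skew p n where
  toFun X := ⟨A * X.1 * A.transpose, by
    change Matrix.transpose _ = -_
    have hX : X.1.transpose = -X.1 := X.2
    rw [Matrix.transpose_mul, Matrix.transpose_mul, hX, Matrix.transpose_transpose, Matrix.neg_mul,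
      Matrix.mul_neg, Matrix.mul_assoc]⟩
  map_add' X Y := Subtype.ext <| by simp [Matrix.mul_add, Matrix.add_mul]
  map_smul' c X := Subtype.ext <| by simp

theorem coe_congruence (A : Matrix (Fin n) (Fin n) (ZMod p)) (X : skew p n) :
    (congruence A X).1 = A * X.1 * A.transpose := rfl

theorem congruence_mul (A B : Matrix (Fin n) (Fin n) (ZMod p)) (X : skew p n) :
    congruence (A * B) X = congruence A (congruence B X) :=
  Subtype.ext <| by simp [coe_congruence, Matrix.transpose_mul, Matrix.mul_assoc]

theorem congruence_one (X : skew p n) : congruence 1 X = X :=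
  Subtype.ext <| by simp [coe_congruence]

theorem congruence_wedge (A : Matrix (Fin n) (Fin n) (ZMod p)) (u v : Fin n → ZMod p) :
    congruence A (wedge u v) = wedge (A.mulVec u) (A.mulVec v) :=
  Subtype.ext <| by
    change A * (Matrix.vecMulVec u v - Matrix.vecMulVec v u) * A.transpose =
      Matrix.vecMulVec _ _ - Matrix.vecMulVec _ _
    rw [Matrix.mul_sub, Matrix.sub_mul, Matrix.mul_vecMulVec, Matrix.mul_vecMulVec,
      Matrix.vecMulVec_mul, Matrix.vecMulVec_mul, Matrix.vecMul_transpose,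
      Matrix.vecMul_transpose]

theorem two_ne_zero_zmod [Fact p.Prime] (hp3 : 3 ≤ p) : (2 : ZMod p) ≠ 0 := by
  have h : ((2 : ℕ) : ZMod p) ≠ 0 := by
    rw [Ne, ZMod.natCast_eq_zero_iff]
    exact fun h => by have := Nat.le_of_dvd (by norm_num) h; omega
  exact_mod_cast h

/-- Summing over all ordered pairs counts each basis bivector twice, hence the factor `2⁻¹`. -/
theorem skew_eq_sum [Fact p.Prime] (hp3 : 3 ≤ p) (X : skew p n) :
    X = ∑ i, ∑ j, (2⁻¹ * X.1 i j) • wedge (Pi.single i 1) (Pi.single j 1) := by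
  ext k l
  have h2 := two_ne_zero_zmod hp3
  simp only [Submodule.coe_sum, Submodule.coe_smul, Matrix.sum_apply, Matrix.smul_apply,
    wedge_apply, smul_eq_mul, mul_sub, Finset.sum_sub_distrib, Pi.single_apply]
  simp only [mul_ite, mul_one, mul_zero]
  simp [skew_apply X k l]
  field_simp
  ring

/-- Over the prime field an additive subgroup is a subspace. -/
theorem skew_addSubgroup_eq_top [Fact p.Prime] (hp3 : 3 ≤ p) (S : AddSubgroup (skew p n))
    (h : ∀ i j, wedge (Pi.single i 1) (Pi.single j 1) ∈ S) : S = ⊤ := by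
  rw [eq_top_iff]
  intro X _
  rw [skew_eq_sum hp3 X]
  exact sum_mem fun i _ => sum_mem fun j _ => ZMod.smul_mem (h i j) _

theorem card_skew [Fact p.Prime] (hp3 : 3 ≤ p) :
    Nat.card (skew p n) = p ^ (Fintype.card {q : Fin n × Fin n // q.1 < q.2}) := by
  have h2 := two_ne_zero_zmod hp3
  let f : skew p n → ({q : Fin n × Fin n // q.1 < q.2} → ZMod p) := fun X q => X.1 q.1.1 q.1.2
  have hf : Function.Bijective f := by
    constructor
    · intro X Y hXY
      have h1 : ∀ i j, i < j → X.1 i j = Y.1 i j := fun i j hij => congrFun hXY ⟨(i, j), hij⟩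
      ext i j
      rcases lt_trichotomy i j with hij | rfl | hij
      · exact h1 i j hij
      · have h3 : ∀ Z : skew p n, Z.1 i i = 0 := fun Z => by
          have h4 : (2 : ZMod p) * Z.1 i i = 0 := by linear_combination skew_apply Z i i
          exact (mul_eq_zero.1 h4).resolve_left h2
        rw [h3, h3]
      · rw [skew_apply X j i, skew_apply Y j i, h1 j i hij]
    · intro g
      refine ⟨⟨Matrix.of fun i j => if h : i < j then g ⟨(i, j), h⟩ else
        if h : j < i then -g ⟨(j, i), h⟩ else 0, ?_⟩, ?_⟩
      · change Matrix.transpose _ = -_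
        ext i j
        simp only [Matrix.transpose_apply, Matrix.of_apply, Matrix.neg_apply]
        rcases lt_trichotomy i j with hij | rfl | hij
        · simp [hij, hij.not_gt]
        · simp
        · simp [hij, hij.not_gt]
      · ext ⟨⟨i, j⟩, hij⟩
        have hij' : i < j := hij
        simp [f, hij']
  rw [Nat.card_eq_of_bijective f hf, Nat.card_eq_fintype_card, Fintype.card_fun, ZMod.card]

instance [Fact p.Prime] : Finite (skew p n) := inferInstance

end Skew

/-! ### The model group and its special structure. -/

section Model

variable {p n : ℕ}

/-- Pairs of a vector and a skew-symmetric matrix, with the group law of the special group in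
which commutators are exterior products and the `p`-th power map is `v ↦ v 0 • w₀`. -/
@[ext]
structure Model (w₀ : skew p n) where
  v : Fin n → ZMod p
  w : skew p n

namespace Model

variable [hp : Fact p.Prime] [NeZero n] {w₀ : skew p n}

instance : Mul (Model w₀) where
  mul x y := ⟨x.v + y.v, x.w + y.w + (2⁻¹ : ZMod p) • wedge x.v y.v +
    wittSum p (x.v 0) (y.v 0) • w₀⟩

instance : One (Model w₀) where
  one := ⟨0, 0⟩

instance : Inv (Model w₀) where
  inv x := ⟨-x.v, -x.w - wittSum p (-x.v 0) (x.v 0) • w₀⟩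

theorem mul_v (x y : Model w₀) : (x * y).v = x.v + y.v := rfl

theorem mul_w (x y : Model w₀) : (x * y).w = x.w + y.w + (2⁻¹ : ZMod p) • wedge x.v y.v +
    wittSum p (x.v 0) (y.v 0) • w₀ := rfl

omit [NeZero n] in
theorem one_v : (1 : Model w₀).v = 0 := rfl

omit [NeZero n] in
theorem one_w : (1 : Model w₀).w = 0 := rfl

theorem inv_v (x : Model w₀) : (x⁻¹).v = -x.v := rfl

theorem inv_w (x : Model w₀) : (x⁻¹).w = -x.w - wittSum p (-x.v 0) (x.v 0) • w₀ := rfl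

/-- Both correction terms are 2-cocycles: `wedge` because it is bilinear, the Witt term by
`wittSum_cocycle`. -/
instance : Group (Model w₀) :=
  Group.ofLeftAxioms
    (fun x y z => by
      refine Model.ext ?_ ?_
      · simp only [mul_v, add_assoc]
      · simp only [mul_v, mul_w, map_add, LinearMap.add_apply, Pi.add_apply]
        have h := wittSum_cocycle (x.v 0) (y.v 0) (z.v 0)
        rw [show wittSum p (x.v 0 + y.v 0) (z.v 0) = wittSum p (y.v 0) (z.v 0) +
          wittSum p (x.v 0) (y.v 0 + z.v 0) - wittSum p (x.v 0) (y.v 0) by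
            linear_combination h]
        module)
    (fun x => by
      refine Model.ext ?_ ?_
      · simp only [mul_v, one_v, zero_add]
      · simp only [mul_w, one_v, one_w, map_zero, LinearMap.zero_apply, Pi.zero_apply,
          wittSum_zero_left]
        module)
    (fun x => by
      refine Model.ext ?_ ?_
      · simp only [mul_v, inv_v, one_v, neg_add_cancel]
      · simp only [mul_w, inv_w, inv_v, one_w, map_neg, LinearMap.neg_apply, Pi.neg_apply,
          wedge_self]
        module)

/-- The Witt term is symmetric and cancels; the two halves of the alternating term add up to one
exterior product. -/
theorem pComm_eq (hp3 : 3 ≤ p) (x y : Model w₀) : pComm x y = ⟨0, wedge x.v y.v⟩ := by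
  have h : x * y = y * x * ⟨0, wedge x.v y.v⟩ := by
    refine Model.ext ?_ ?_
    · simp only [mul_v, add_zero, add_comm]
    · simp only [mul_v, mul_w, map_zero, Pi.zero_apply, wittSum_zero_right, wedge_swap y.v x.v,
        wittSum_comm (y.v 0)]
      have h2 : (2⁻¹ : ZMod p) • wedge x.v y.v + (2⁻¹ : ZMod p) • wedge x.v y.v
          = wedge x.v y.v := by
        rw [← add_smul, ← two_mul, mul_inv_cancel₀ (two_ne_zero_zmod hp3), one_smul]
      nth_rewrite 3 [← h2]
      module
  rw [mul_eq_mul_pComm] at h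
  exact mul_left_cancel h

theorem pow_eq (x : Model w₀) (k : ℕ) : x ^ k = ⟨(k : ZMod p) • x.v, (k : ZMod p) • x.w +
    (∑ j ∈ Finset.range k, wittSum p (j * x.v 0) (x.v 0)) • w₀⟩ := by
  induction k with
  | zero =>
    rw [pow_zero]
    refine Model.ext ?_ ?_ <;> simp [one_v, one_w]
  | succ k ih =>
    rw [pow_succ, ih]
    refine Model.ext ?_ ?_
    · simp only [mul_v, Nat.cast_succ]
      module
    · simp only [mul_w, Nat.cast_succ, Finset.sum_range_succ, map_smul, LinearMap.smul_apply,
        wedge_self, Pi.smul_apply, smul_eq_mul]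
      module

/-- The alternating term vanishes on multiples of one vector, so only the Witt terms survive, and
they sum to `x.v 0`. -/
theorem pow_p (x : Model w₀) : x ^ p = ⟨0, x.v 0 • w₀⟩ := by
  rw [pow_eq, sum_wittSum]
  simp

/-- The projection to the vector component. -/
def proj (w₀ : skew p n) : Model w₀ →* Multiplicative (Fin n → ZMod p) where
  toFun x := Multiplicative.ofAdd x.v
  map_one' := rfl
  map_mul' _ _ := rfl

/-- The inclusion of the skew-symmetric matrices. -/
def incl (w₀ : skew p n) : Multiplicative (skew p n) →* Model w₀ where
  toFun X := ⟨0, X.toAdd⟩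
  map_one' := rfl
  map_mul' X Y := by
    refine Model.ext ?_ ?_
    · simp only [mul_v, add_zero]
    · simp only [mul_w, map_zero, Pi.zero_apply, wittSum_zero_right, toAdd_mul]
      module

theorem mk_mul_mk_zero (v : Fin n → ZMod p) (X Y : skew p n) :
    (⟨v, X⟩ * ⟨0, Y⟩ : Model w₀) = ⟨v, X + Y⟩ := by
  refine Model.ext ?_ ?_
  · simp only [mul_v, add_zero]
  · simp only [mul_w, map_zero, Pi.zero_apply, wittSum_zero_right]
    module

theorem mk_zero_mul_mk (v : Fin n → ZMod p) (X Y : skew p n) :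
    (⟨0, Y⟩ * ⟨v, X⟩ : Model w₀) = ⟨v, X + Y⟩ := by
  refine Model.ext ?_ ?_
  · simp only [mul_v, zero_add]
  · simp only [mul_w, map_zero, Pi.zero_apply, wittSum_zero_left, LinearMap.zero_apply]
    module

/-- The underlying type as a product. -/
def equivProd (w₀ : skew p n) : Model w₀ ≃ (Fin n → ZMod p) × skew p n where
  toFun x := (x.v, x.w)
  invFun x := ⟨x.1, x.2⟩
  left_inv _ := rfl
  right_inv _ := rfl

instance : Finite (Model w₀) := Finite.of_equiv _ (equivProd w₀).symm

omit [NeZero n] in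
theorem card_eq (hp3 : 3 ≤ p) : Nat.card (Model w₀) =
    p ^ (n + Fintype.card {q : Fin n × Fin n // q.1 < q.2}) := by
  rw [Nat.card_congr (equivProd w₀), Nat.card_prod, card_skew hp3, Nat.card_fun, Nat.card_zmod,
    Nat.card_eq_fintype_card, Fintype.card_fin, pow_add]

theorem centralCommutators (hp3 : 3 ≤ p) : CentralCommutators (Model w₀) := by
  intro x y z
  obtain ⟨v, X⟩ := z
  rw [pComm_eq hp3, mk_mul_mk_zero, mk_zero_mul_mk]

omit [NeZero n] in
theorem eq_zero_of_wedge_eq_zero (hn : 2 ≤ n) {v : Fin n → ZMod p}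
    (h : ∀ u, wedge v u = 0) : v = 0 := by
  ext i
  have : Nontrivial (Fin n) := Fin.nontrivial_iff_two_le.2 hn
  obtain ⟨j, hj⟩ := exists_ne i
  have h1 : (wedge v (Pi.single j 1)).1 i j = 0 := by rw [h]; rfl
  simpa [wedge_apply, hj.symm] using h1

/-- Commuting with everything means `v ∧ u = 0` for all `u`, which for `n ≥ 2` forces `v = 0`. -/
theorem mem_center_iff (hp3 : 3 ≤ p) (hn : 2 ≤ n) (x : Model w₀) :
    x ∈ Subgroup.center (Model w₀) ↔ x.v = 0 := by
  constructor
  · intro hx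
    refine eq_zero_of_wedge_eq_zero hn fun u => ?_
    have h1 := mul_eq_mul_pComm x ⟨u, 0⟩
    rw [← Subgroup.mem_center_iff.1 hx ⟨u, 0⟩, pComm_eq hp3] at h1
    exact congrArg Model.w (left_eq_mul.1 h1)
  · intro hx
    obtain ⟨v, X⟩ := x
    obtain rfl : v = 0 := hx
    rw [Subgroup.mem_center_iff]
    rintro ⟨u, Y⟩
    rw [mk_mul_mk_zero, mk_zero_mul_mk]

/-- A subgroup containing the commutators of the standard generators contains the kernel of the
projection. -/
theorem mk_zero_mem (hp3 : 3 ≤ p) (S : Subgroup (Model w₀))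
    (h : ∀ i j, (⟨0, wedge (Pi.single i 1) (Pi.single j 1)⟩ : Model w₀) ∈ S) (X : skew p n) :
    ⟨0, X⟩ ∈ S := by
  let T : AddSubgroup (skew p n) := Subgroup.toAddSubgroup' (S.comap (incl w₀))
  have hT : T = ⊤ := skew_addSubgroup_eq_top hp3 T h
  have : X ∈ T := by rw [hT]; trivial
  exact this

open commutatorElement in
theorem mem_commutator_iff (hp3 : 3 ≤ p) (x : Model w₀) :
    x ∈ commutator (Model w₀) ↔ x.v = 0 := by
  constructor
  · intro hx
    have h1 : proj w₀ x = 1 := by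
      have : commutator (Model w₀) ≤ (proj w₀).ker := Abelianization.commutator_subset_ker _
      exact this hx
    exact h1
  · intro hx
    obtain ⟨v, X⟩ := x
    obtain rfl : v = 0 := hx
    refine mk_zero_mem hp3 _ (fun i j => ?_) X
    have h1 : (⟨0, wedge (Pi.single i 1) (Pi.single j 1)⟩ : Model w₀) =
        ⁅(⟨Pi.single i 1, 0⟩ : Model w₀)⁻¹, (⟨Pi.single j 1, 0⟩ : Model w₀)⁻¹⁆ := by
      rw [commutatorElement_def, inv_inv, inv_inv]
      exact (pComm_eq hp3 (⟨Pi.single i 1, 0⟩ : Model w₀) ⟨Pi.single j 1, 0⟩).symm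
    rw [h1]
    exact Subgroup.commutator_mem_commutator (Subgroup.mem_top _) (Subgroup.mem_top _)

open commutatorElement in
-- Each coordinate of `v` defines a maximal subgroup of index `p`, so the Frattini subgroup has `v =
-- 0`. Conversely, a maximal subgroup `K` contains every commutator: a central commutator outside
-- `K` would generate the group together with `K`, and central factors do not change commutators.
theorem mem_frattini_iff (hp3 : 3 ≤ p) (x : Model w₀) :
    x ∈ frattini (Model w₀) ↔ x.v = 0 := by
  constructor
  · intro hx
    ext i
    let f : Model w₀ →* Multiplicative (ZMod p) :=
      (AddMonoidHom.toMultiplicative (Pi.evalAddMonoidHom (fun _ : Fin n => ZMod p) i)).comp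
        (proj w₀)
    have hf : Function.Surjective f := fun c =>
      ⟨⟨Pi.single i c.toAdd, 0⟩, by
        change Multiplicative.ofAdd ((Pi.single i c.toAdd : Fin n → ZMod p) i) = c
        rw [Pi.single_eq_same]; rfl⟩
    have hbot : IsCoatom (⊥ : Subgroup (Multiplicative (ZMod p))) := by
      refine ⟨?_, fun K hK => ?_⟩
      · intro h
        have : (Multiplicative.ofAdd (1 : ZMod p)) ∈ (⊥ : Subgroup (Multiplicative (ZMod p))) := by
          rw [h]; trivial
        exact one_ne_zero (α := ZMod p) (congrArg Multiplicative.toAdd (Subgroup.mem_bot.1 this))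
      · have : Fact (Nat.card (Multiplicative (ZMod p))).Prime := ⟨by
          rw [Nat.card_congr Multiplicative.toAdd, Nat.card_zmod]; exact hp.out⟩
        exact (Subgroup.eq_bot_or_eq_top_of_prime_card K).resolve_left hK.ne'
    have h1 := frattini_le_coatom (Subgroup.isCoatom_comap_of_surjective hf hbot) hx
    exact h1
  · intro hx
    have hx' := (mem_commutator_iff hp3 x).2 hx
    rw [frattini, Order.radical]
    simp only [Subgroup.mem_iInf]
    intro K hK
    by_contra hxK
    have hcc : ∀ a b : Model w₀, ⁅a, b⁆ ∈ K := by
      intro a b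
      by_contra hab
      have hc : ∀ z, Commute ⁅a, b⁆ z := fun z => by
        have := centralCommutators hp3 a⁻¹ b⁻¹ z
        simpa [pComm, commutatorElement_def, Commute, SemiconjBy] using this
      have htop : K ⊔ Subgroup.zpowers ⁅a, b⁆ = ⊤ := by
        refine hK.2 _ (lt_of_le_of_ne le_sup_left fun h => hab ?_)
        rw [h]
        exact Subgroup.mem_sup_right (Subgroup.mem_zpowers _)
      have hnorm : (Subgroup.zpowers ⁅a, b⁆).Normal := ⟨by
        rintro _ ⟨k, rfl⟩ g
        refine ⟨k, ?_⟩
        change _ = g * ⁅a, b⁆ ^ k * g⁻¹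
        rw [← ((hc g).zpow_left k).eq, mul_inv_cancel_right]⟩
      have hdec : ∀ g, ∃ k ∈ K, ∃ j : ℤ, g = k * ⁅a, b⁆ ^ j := fun g => by
        have hg : g ∈ K ⊔ Subgroup.zpowers ⁅a, b⁆ := by rw [htop]; trivial
        obtain ⟨k, hk, _, ⟨j, rfl⟩, h⟩ := Subgroup.mem_sup_of_normal_right.1 hg
        exact ⟨k, hk, j, h.symm⟩
      obtain ⟨k, hk, i, ha⟩ := hdec a
      obtain ⟨l, hl, j, hb⟩ := hdec b
      have hi : ∀ z, Commute (⁅a, b⁆ ^ i) z := fun z => (hc z).zpow_left i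
      have hj : ∀ z, Commute (⁅a, b⁆ ^ j) z := fun z => (hc z).zpow_left j
      -- `a` and `b` differ from `k` and `l` in `K` by powers of a central element.
      have h2 : ⁅a, b⁆ = ⁅k, l⁆ := by
        generalize hs : ⁅a, b⁆ ^ i = s at *
        generalize ht : ⁅a, b⁆ ^ j = t at *
        have h3 : a * b = ⁅k, l⁆ * (b * a) := by
          rw [ha, hb, commutatorElement_def]
          calc k * s * (l * t) = k * (s * l) * t := by group
            _ = k * l * (s * t) := by rw [(hi l).eq]; group
            _ = k * l * (t * s) := by rw [(hi t).eq]
            _ = k * l * k⁻¹ * l⁻¹ * (l * (k * t) * s) := by group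
            _ = k * l * k⁻¹ * l⁻¹ * (l * t * (k * s)) := by rw [← (hj k).eq]; group
        rw [commutatorElement_def a b, h3]
        group
      exact hab (h2 ▸ by
        rw [commutatorElement_def]
        exact mul_mem (mul_mem (mul_mem hk hl) (inv_mem hk)) (inv_mem hl))
    have hle : commutator (Model w₀) ≤ K := by
      rw [commutator_def, Subgroup.commutator_le]
      exact fun a _ b _ => hcc a b
    exact hxK (hle hx')

theorem isSpecialOfClassTwo (hp3 : 3 ≤ p) (hn : 2 ≤ n) : IsSpecialOfClassTwo (Model w₀) := by
  have h1 : commutator (Model w₀) = Subgroup.center (Model w₀) := by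
    ext x
    rw [mem_commutator_iff hp3, mem_center_iff hp3 hn]
  refine ⟨?_, h1, ?_⟩
  · have hker : (proj w₀).ker ≤ Subgroup.center (Model w₀) := fun x hx =>
      (mem_center_iff hp3 hn x).2 hx
    have hnil : Group.IsNilpotent (Model w₀) :=
      Subgroup.isNilpotent_of_ker_le_center (proj w₀) hker
    have hle : Group.nilpotencyClass (Model w₀) ≤ 2 := by
      refine (Group.nilpotencyClass_le_of_ker_le_center (proj w₀) hker).trans ?_
      have := CommGroup.nilpotencyClass_le_one (G := Multiplicative (Fin n → ZMod p))
      omega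
    have hgt : ¬ Group.nilpotencyClass (Model w₀) ≤ 1 := by
      rw [Group.IsNilpotent.nilpotencyClass_le_one_iff]
      intro hcomm
      have h0 : (Pi.single 0 1 : Fin n → ZMod p) = 0 := by
        refine (mem_center_iff (w₀ := w₀) hp3 hn ⟨Pi.single 0 1, 0⟩).1 ?_
        rw [Subgroup.mem_center_iff]
        intro g
        exact hcomm.is_comm.comm _ _
      have := congrFun h0 0
      simp at this
    omega
  · ext x
    rw [mem_frattini_iff hp3, mem_center_iff hp3 hn]

end Model

end Model

/-! ### Identification of the presented groups with the models. -/

section Presentation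

/-- `ι → ZMod p` is the free abelian group of exponent `p` on the finite set `ι`. -/
theorem exists_hom_of_pow_eq_one {ι A : Type*} [Fintype ι] [DecidableEq ι] [CommGroup A] (p : ℕ)
    (a : ι → A) (ha : ∀ i, a i ^ p = 1) :
    ∃ f : Multiplicative (ι → ZMod p) →* A, ∀ i, a i ∈ f.range := by
  let l : ι → (ZMod p →+ Additive A) := fun i =>
    ZMod.lift p ⟨zmultiplesHom (Additive A) (Additive.ofMul (a i)), by
      rw [zmultiplesHom_apply, natCast_zsmul, ← ofMul_pow, ha, ofMul_one]⟩
  let g : (ι → ZMod p) →+ Additive A :=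
    ∑ i, (l i).comp (Pi.evalAddMonoidHom (fun _ : ι => ZMod p) i)
  have hl : ∀ i, l i 1 = Additive.ofMul (a i) := fun i => by
    have := ZMod.lift_coe p (⟨zmultiplesHom (Additive A) (Additive.ofMul (a i)), by
      rw [zmultiplesHom_apply, natCast_zsmul, ← ofMul_pow, ha, ofMul_one]⟩ :
        { f : ℤ →+ Additive A // f p = 0 }) 1
    rw [Int.cast_one] at this
    refine this.trans ?_
    simp
  refine ⟨AddMonoidHom.toMultiplicativeLeft g, fun i => ⟨Multiplicative.ofAdd (Pi.single i 1), ?_⟩⟩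
  change (g (Pi.single i 1)).toMul = a i
  have h1 : g (Pi.single i 1) = Additive.ofMul (a i) := by
    rw [AddMonoidHom.finsetSum_apply, Finset.sum_eq_single i]
    · simp [hl]
    · intro j _ hj
      simp [Pi.single_eq_of_ne hj]
    · simp
  rw [h1]
  rfl

theorem mul_comm_of_closure_eq_top {G : Type*} [Group G] {S : Set G} (hS : Subgroup.closure S = ⊤)
    {z : G} (h : ∀ s ∈ S, s * z = z * s) (g : G) : g * z = z * g := by
  have h1 : Subgroup.closure S ≤ Subgroup.centralizer {z} := by
    rw [Subgroup.closure_le]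
    intro s hs
    rw [SetLike.mem_coe, Subgroup.mem_centralizer_singleton_iff]
    exact h s hs
  have h2 : g ∈ Subgroup.centralizer {z} := h1 (by rw [hS]; trivial)
  exact Subgroup.mem_centralizer_singleton_iff.1 h2

variable {p n : ℕ} [hp : Fact p.Prime] [NeZero n]

/-- The commutators of the generators span a central subgroup `C` that is an image of `F_p^{pairs}`.
Modulo `C` the group is abelian; since `w` is a product of commutators, all generators have order
dividing `p` there, so the quotient is an image of `F_p^n`. -/
theorem finite_and_card_presentedGroup_le (w : FreeGroup (Fin n))
    (hw : w ∈ commutator (FreeGroup (Fin n))) :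
    Finite (PresentedGroup (relators n p w)) ∧ Nat.card (PresentedGroup (relators n p w)) ≤
      p ^ (n + Fintype.card {q : Fin n × Fin n // q.1 < q.2}) := by
  set G := PresentedGroup (relators n p w)
  let x : Fin n → G := PresentedGroup.of
  have hx : Subgroup.closure (Set.range x) = ⊤ := PresentedGroup.closure_range_of _
  have hrel : ∀ r ∈ relators n p w, PresentedGroup.mk (relators n p w) r = 1 := fun r hr =>
    PresentedGroup.one_of_mem hr
  have hof : ∀ i, PresentedGroup.mk (relators n p w) (FreeGroup.of i) = x i := fun _ => rfl
  have hcen : ∀ i j, pComm (x i) (x j) ∈ Subgroup.center G := by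
    intro i j
    rw [Subgroup.mem_center_iff]
    refine mul_comm_of_closure_eq_top hx ?_
    rintro _ ⟨k, rfl⟩
    have h1 := hrel _ (Or.inl (Or.inl ⟨i, j, k, rfl⟩))
    rw [map_pComm, map_pComm, hof, hof, hof] at h1
    have h2 := mul_eq_mul_pComm (pComm (x i) (x j)) (x k)
    rw [h1, mul_one] at h2
    exact h2.symm
  have hpow : ∀ i, i ≠ 0 → x i ^ p = 1 := by
    intro i hi
    have h1 := hrel _ (Or.inl (Or.inr ⟨i, hi, rfl⟩))
    rwa [map_pow, hof] at h1
  have hpow0 : x 0 ^ p = PresentedGroup.mk (relators n p w) w := by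
    have h1 := hrel _ (Or.inr rfl)
    rwa [map_mul, map_pow, map_inv, hof, mul_inv_eq_one] at h1
  -- Here `i < j` gives `j ≠ 0`, so `x j ^ p = 1` and `[x i, x j] ^ p = [x i, x j ^ p] = 1`; the
  -- power of `x 0` is never needed.
  have hcp : ∀ i j : Fin n, i < j → pComm (x i) (x j) ^ p = 1 := by
    intro i j hij
    have h1 : ∀ k : ℕ, x i * x j ^ k = x j ^ k * x i * pComm (x i) (x j) ^ k := by
      intro k
      induction k with
      | zero => simp
      | succ k ih =>
        have hz := Subgroup.mem_center_iff.1 (pow_mem (hcen i j) k)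
        rw [pow_succ, ← mul_assoc, ih, mul_assoc _ _ (x j), ← hz, ← mul_assoc, mul_assoc _ (x i),
          mul_eq_mul_pComm (x i), pow_succ', ← mul_assoc, ← mul_assoc, ← mul_assoc]
    have h2 := h1 p
    have hj : j ≠ 0 := by rintro rfl; exact absurd hij (Fin.not_lt_zero i)
    rw [hpow j hj, mul_one, one_mul] at h2
    exact left_eq_mul.1 h2
  let _ : CommGroup (Subgroup.center G) :=
    { mul_comm := fun a b => Subtype.ext (Subgroup.mem_center_iff.1 b.2 a) }
  obtain ⟨f, hf⟩ := exists_hom_of_pow_eq_one (ι := {q : Fin n × Fin n // q.1 < q.2})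
    (A := Subgroup.center G) p (fun q => ⟨pComm (x q.1.1) (x q.1.2), hcen _ _⟩)
    (fun q => Subtype.ext (hcp _ _ q.2))
  let C : Subgroup G := ((Subgroup.center G).subtype.comp f).range
  have hCz : ∀ c ∈ C, ∀ g, g * c = c * g := by
    rintro _ ⟨d, rfl⟩
    exact Subgroup.mem_center_iff.1 (f d).2
  have hCn : C.Normal := ⟨fun c hc g => by rwa [hCz c hc, mul_inv_cancel_right]⟩
  have hClt : ∀ i j, i < j → pComm (x i) (x j) ∈ C := by
    intro i j hij
    obtain ⟨d, hd⟩ := hf ⟨(i, j), hij⟩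
    exact ⟨d, congrArg Subtype.val hd⟩
  have hC : ∀ i j, pComm (x i) (x j) ∈ C := by
    intro i j
    rcases lt_trichotomy i j with hij | rfl | hij
    · exact hClt i j hij
    · have : pComm (x i) (x i) = 1 := by simp [pComm]
      rw [this]
      exact one_mem C
    · have : pComm (x i) (x j) = (pComm (x j) (x i))⁻¹ := by simp only [pComm]; group
      rw [this]
      exact inv_mem (hClt j i hij)
  let q : G →* G ⧸ C := QuotientGroup.mk' C
  have hq : Subgroup.closure (Set.range (q ∘ x)) = ⊤ := by
    rw [Set.range_comp, ← MonoidHom.map_closure, hx,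
      Subgroup.map_top_of_surjective _ (QuotientGroup.mk'_surjective C)]
  have hcomm : ∀ a b : G ⧸ C, a * b = b * a := by
    have h1 : ∀ i a, a * q (x i) = q (x i) * a := by
      intro i
      refine mul_comm_of_closure_eq_top hq ?_
      rintro _ ⟨j, rfl⟩
      have h2 : q (pComm (x j) (x i)) = 1 := (QuotientGroup.eq_one_iff _).2 (hC j i)
      rw [Function.comp_apply, mul_eq_mul_pComm, ← map_pComm, h2, mul_one]
    intro a b
    refine mul_comm_of_closure_eq_top hq ?_ a
    rintro _ ⟨i, rfl⟩
    exact (h1 i b).symm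
  let _ : CommGroup (G ⧸ C) := { mul_comm := hcomm }
  have hqp : ∀ i, q (x i) ^ p = 1 := by
    intro i
    rw [← map_pow]
    by_cases hi : i = 0
    · rw [hi, hpow0]
      have : commutator (FreeGroup (Fin n)) ≤ (q.comp (PresentedGroup.mk (relators n p w))).ker :=
        Abelianization.commutator_subset_ker _
      exact this hw
    · rw [hpow i hi, map_one]
  obtain ⟨g, hg⟩ := exists_hom_of_pow_eq_one p (fun i => q (x i)) hqp
  have hgs : g.range = ⊤ := by
    rw [eq_top_iff, ← hq, Subgroup.closure_le]
    rintro _ ⟨i, rfl⟩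
    exact hg i
  let F : Multiplicative (Fin n → ZMod p) ×
      Multiplicative ({q : Fin n × Fin n // q.1 < q.2} → ZMod p) → G :=
    fun y => (g y.1).out * (f y.2 : G)
  have hF : Function.Surjective F := by
    intro a
    obtain ⟨v, hv⟩ : q a ∈ g.range := by rw [hgs]; trivial
    have h1 : (g v).out⁻¹ * a ∈ C := by
      rw [← QuotientGroup.eq, QuotientGroup.out_eq', hv]
      rfl
    obtain ⟨d, hd⟩ := h1
    refine ⟨(v, d), ?_⟩
    change (g v).out * ((Subgroup.center G).subtype.comp f) d = a
    rw [hd, mul_inv_cancel_left]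
  have : Finite (Multiplicative (Fin n → ZMod p)) := Finite.of_equiv _ Multiplicative.ofAdd
  have : Finite (Multiplicative ({q : Fin n × Fin n // q.1 < q.2} → ZMod p)) :=
    Finite.of_equiv _ Multiplicative.ofAdd
  refine ⟨Finite.of_surjective F hF, (Nat.card_le_card_of_surjective F hF).trans_eq ?_⟩
  rw [Nat.card_prod, Nat.card_congr Multiplicative.toAdd, Nat.card_congr Multiplicative.toAdd,
    Nat.card_fun, Nat.card_fun, Nat.card_zmod, Nat.card_eq_fintype_card, Fintype.card_fin,
    Nat.card_eq_fintype_card, pow_add]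

namespace Model

/-- The standard generators. -/
def gen (w₀ : skew p n) (i : Fin n) : Model w₀ := ⟨Pi.single i 1, 0⟩

theorem pComm_gen (hp3 : 3 ≤ p) (w₀ : skew p n) (i j : Fin n) :
    pComm (gen w₀ i) (gen w₀ j) = ⟨0, wedge (Pi.single i 1) (Pi.single j 1)⟩ :=
  pComm_eq hp3 _ _

theorem eq_top_of_gen_mem (hp3 : 3 ≤ p) {w₀ : skew p n} (S : Subgroup (Model w₀))
    (h : ∀ i, gen w₀ i ∈ S) : S = ⊤ := by
  have hW : ∀ X, (⟨0, X⟩ : Model w₀) ∈ S := by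
    refine mk_zero_mem hp3 S fun i j => ?_
    rw [← pComm_gen hp3 w₀ i j]
    exact mul_mem (mul_mem (mul_mem (inv_mem (h i)) (inv_mem (h j))) (h i)) (h j)
  let T : AddSubgroup (Fin n → ZMod p) := Subgroup.toAddSubgroup' (S.map (proj w₀))
  have hT : ∀ v, v ∈ T := by
    intro v
    rw [pi_eq_sum_univ' v]
    refine sum_mem fun i _ => ZMod.smul_mem ?_ _
    exact ⟨gen w₀ i, h i, rfl⟩
  rw [eq_top_iff]
  rintro ⟨v, X⟩ _
  obtain ⟨⟨u, Y⟩, hy, hv⟩ := hT v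
  obtain rfl : u = v := hv
  have h1 : (⟨u, X⟩ : Model w₀) = ⟨u, Y⟩ * ⟨0, X - Y⟩ := by
    rw [mk_mul_mk_zero, add_sub_cancel]
  rw [h1]
  exact mul_mem hy (hW _)

/-- The standard generators satisfy the relations and generate the model; the order bound makes the
resulting surjection injective. -/
theorem nonempty_presentedGroup_mulEquiv (hp3 : 3 ≤ p) (w₀ : skew p n) (w : FreeGroup (Fin n))
    (hw : w ∈ commutator (FreeGroup (Fin n)))
    (hw₀ : FreeGroup.lift (gen w₀) w = ⟨0, w₀⟩) :
    Nonempty (PresentedGroup (relators n p w) ≃* Model w₀) := by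
  have hrel : ∀ r ∈ relators n p w, FreeGroup.lift (gen w₀) r = 1 := by
    rintro r ((⟨i, j, k, rfl⟩ | ⟨i, hi, rfl⟩) | rfl)
    · rw [map_pComm, map_pComm, pComm_eq hp3, pComm_eq hp3, map_zero]
      rfl
    · rw [map_pow, FreeGroup.lift_apply_of, pow_p]
      have : (gen w₀ i).v 0 = 0 := Pi.single_eq_of_ne (M := fun _ => ZMod p) hi.symm 1
      rw [this, zero_smul]
      rfl
    · rw [map_mul, map_inv, map_pow, hw₀, FreeGroup.lift_apply_of, pow_p]
      have : (gen w₀ 0).v 0 = 1 := Pi.single_eq_same (M := fun _ : Fin n => ZMod p) 0 1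
      rw [this, one_smul, mul_inv_cancel]
  let φ : PresentedGroup (relators n p w) →* Model w₀ := PresentedGroup.toGroup hrel
  have hφ : Function.Surjective φ := by
    rw [← MonoidHom.range_eq_top]
    exact eq_top_of_gen_mem hp3 _ fun i => ⟨PresentedGroup.of i, PresentedGroup.toGroup.of hrel⟩
  obtain ⟨hfin, hcard⟩ := finite_and_card_presentedGroup_le (p := p) w hw
  rw [← card_eq (w₀ := w₀) hp3] at hcard
  exact ⟨MulEquiv.ofBijective φ (hφ.bijective_of_nat_card_le hcard)⟩

end Model

open commutatorElement in
theorem pComm_mem_commutator {G : Type*} [Group G] (x y : G) : pComm x y ∈ commutator G := by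
  have : pComm x y = ⁅x⁻¹, y⁻¹⁆ := by simp [pComm, commutatorElement_def]
  rw [this]
  exact Subgroup.commutator_mem_commutator (Subgroup.mem_top _) (Subgroup.mem_top _)

end Presentation

/-! ### Automorphisms of the model and reduction of `T` to bilinear maps. -/

section Automorphisms

variable {p n : ℕ} [hp : Fact p.Prime] [NeZero n]

/-- The matrices induced by automorphisms of `Model w₀` on the vector component. -/
structure AutMatrix (w₀ : skew p n) (A : Matrix (Fin n) (Fin n) (ZMod p)) : Prop where
  isUnit : IsUnit A
  row : ∀ j, j ≠ 0 → A 0 j = 0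
  congruence_eq : congruence A w₀ = A 0 0 • w₀

theorem AutMatrix.mulVec_zero {w₀ : skew p n} {A : Matrix (Fin n) (Fin n) (ZMod p)}
    (h : AutMatrix w₀ A) (v : Fin n → ZMod p) : A.mulVec v 0 = A 0 0 * v 0 := by
  rw [Matrix.mulVec, dotProduct, Finset.sum_eq_single 0]
  · intro j _ hj
    rw [h.row j hj, zero_mul]
  · simp

namespace Model

variable {w₀ : skew p n}

/-- The automorphism induced by a matrix. -/
noncomputable def autOf (A : Matrix (Fin n) (Fin n) (ZMod p)) (h : AutMatrix w₀ A) :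
    MulAut (Model w₀) where
  toFun x := ⟨A.mulVec x.v, congruence A x.w⟩
  invFun x := ⟨A⁻¹.mulVec x.v, congruence A⁻¹ x.w⟩
  left_inv x := by
    have hA : A⁻¹ * A = 1 := Matrix.nonsing_inv_mul _ ((Matrix.isUnit_iff_isUnit_det A).1 h.isUnit)
    refine Model.ext ?_ ?_
    · simp only [Matrix.mulVec_mulVec, hA, Matrix.one_mulVec]
    · simp only [← congruence_mul, hA, congruence_one]
  right_inv x := by
    have hA : A * A⁻¹ = 1 := Matrix.mul_nonsing_inv _ ((Matrix.isUnit_iff_isUnit_det A).1 h.isUnit)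
    refine Model.ext ?_ ?_
    · simp only [Matrix.mulVec_mulVec, hA, Matrix.one_mulVec]
    · simp only [← congruence_mul, hA, congruence_one]
  -- The Witt term is scaled by `A 0 0` through its argument, and `w₀` is scaled by the same factor
  -- under congruence, so the two sides match.
  map_mul' x y := by
    refine Model.ext ?_ ?_
    · simp only [mul_v, Matrix.mulVec_add]
    · simp only [mul_w, map_add, map_smul, congruence_wedge, h.mulVec_zero, wittSum_mul,
        h.congruence_eq]
      module

theorem autOf_apply (A : Matrix (Fin n) (Fin n) (ZMod p)) (h : AutMatrix w₀ A) (x : Model w₀) :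
    autOf A h x = ⟨A.mulVec x.v, congruence A x.w⟩ := rfl

/-- The central automorphism `x ↦ x * h x`. -/
def centralAut (h : (Fin n → ZMod p) →ₗ[ZMod p] skew p n) : MulAut (Model w₀) where
  toFun x := ⟨x.v, x.w + h x.v⟩
  invFun x := ⟨x.v, x.w - h x.v⟩
  left_inv x := by simp
  right_inv x := by simp
  map_mul' x y := by
    refine Model.ext ?_ ?_
    · simp only [mul_v]
    · simp only [mul_v, mul_w, map_add]
      module

theorem centralAut_apply (h : (Fin n → ZMod p) →ₗ[ZMod p] skew p n) (x : Model w₀) :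
    centralAut h x = ⟨x.v, x.w + h x.v⟩ := rfl

section mat

variable (hp3 : 3 ≤ p)
include hp3

theorem mulAut_mk_zero_v (a : MulAut (Model w₀)) (X : skew p n) : (a ⟨0, X⟩).v = 0 := by
  rw [← mem_commutator_iff hp3]
  have h1 : (⟨0, X⟩ : Model w₀) ∈ commutator (Model w₀) := (mem_commutator_iff hp3 _).2 rfl
  have h2 := Subgroup.characteristic_iff_comap_eq.1
    (inferInstance : (commutator (Model w₀)).Characteristic) a
  rw [← h2] at h1
  exact h1

theorem exists_matrix (a : MulAut (Model w₀)) :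
    ∃ A : Matrix (Fin n) (Fin n) (ZMod p), ∀ x, (a x).v = A.mulVec x.v := by
  have h1 : ∀ v X, (a ⟨v, X⟩).v = (a ⟨v, 0⟩).v := fun v X => by
    rw [show (⟨v, X⟩ : Model w₀) = ⟨v, 0⟩ * ⟨0, X⟩ by rw [mk_mul_mk_zero, zero_add], map_mul, mul_v,
      mulAut_mk_zero_v hp3, add_zero]
  let f : (Fin n → ZMod p) →+ (Fin n → ZMod p) := AddMonoidHom.mk' (fun v => (a ⟨v, 0⟩).v)
    fun u v => by
      rw [← mul_v, ← map_mul]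
      exact (h1 (u + v) _).symm
  refine ⟨LinearMap.toMatrix' (f.toZModLinearMap p), ?_⟩
  rintro ⟨v, X⟩
  rw [LinearMap.toMatrix'_mulVec, h1]
  rfl

/-- The matrix of an automorphism on the vector component. -/
noncomputable def mat (a : MulAut (Model w₀)) : Matrix (Fin n) (Fin n) (ZMod p) :=
  (exists_matrix hp3 a).choose

theorem mulAut_v (a : MulAut (Model w₀)) (x : Model w₀) : (a x).v = (mat hp3 a).mulVec x.v :=
  (exists_matrix hp3 a).choose_spec x

theorem mat_eq {a : MulAut (Model w₀)} {A : Matrix (Fin n) (Fin n) (ZMod p)}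
    (h : ∀ x, (a x).v = A.mulVec x.v) : mat hp3 a = A := by
  apply Matrix.toLin'.injective
  refine LinearMap.ext fun v => ?_
  rw [Matrix.toLin'_apply, Matrix.toLin'_apply]
  exact (mulAut_v hp3 a ⟨v, 0⟩).symm.trans (h ⟨v, 0⟩)

theorem mat_mul (a b : MulAut (Model w₀)) : mat hp3 (a * b) = mat hp3 a * mat hp3 b :=
  mat_eq hp3 fun x => by
    rw [MulAut.mul_apply, mulAut_v hp3, mulAut_v hp3, Matrix.mulVec_mulVec]

theorem mat_one : mat hp3 (1 : MulAut (Model w₀)) = 1 :=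
  mat_eq hp3 fun x => by rw [Matrix.one_mulVec]; rfl

/-- It suffices to compare on commutators of generators, where the action is dictated by the action
on vectors. -/
theorem mulAut_mk_zero (a : MulAut (Model w₀)) (X : skew p n) :
    a ⟨0, X⟩ = ⟨0, congruence (mat hp3 a) X⟩ := by
  let S : Subgroup (Multiplicative (skew p n)) :=
    MonoidHom.eqLocus (a.toMonoidHom.comp (incl w₀))
      ((incl w₀).comp (AddMonoidHom.toMultiplicative (congruence (mat hp3 a)).toAddMonoidHom))
  have hS : Subgroup.toAddSubgroup' S = ⊤ := by
    refine skew_addSubgroup_eq_top hp3 _ fun i j => ?_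
    change a ⟨0, wedge (Pi.single i 1) (Pi.single j 1)⟩ =
      ⟨0, congruence (mat hp3 a) (wedge (Pi.single i 1) (Pi.single j 1))⟩
    rw [← pComm_gen hp3 w₀, map_pComm, pComm_eq hp3, mulAut_v hp3, mulAut_v hp3, congruence_wedge]
    rfl
  have : X ∈ Subgroup.toAddSubgroup' S := by rw [hS]; trivial
  exact this

/-- Automorphisms commute with the `p`-th power map `v ↦ v 0 • w₀`; evaluating this at the basis
vectors gives the conditions on the first row and on `w₀`. -/
theorem autMatrix_mat (hw₀ : w₀ ≠ 0) (a : MulAut (Model w₀)) : AutMatrix w₀ (mat hp3 a) := by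
  have key : ∀ v : Fin n → ZMod p,
      v 0 • congruence (mat hp3 a) w₀ = (mat hp3 a).mulVec v 0 • w₀ := by
    intro v
    have h1 := map_pow a (⟨v, 0⟩ : Model w₀) p
    rw [pow_p, pow_p, mulAut_mk_zero hp3, mulAut_v hp3, map_smul] at h1
    exact congrArg Model.w h1
  refine ⟨?_, fun j hj => ?_, ?_⟩
  · refine IsUnit.of_mul_eq_one (mat hp3 a⁻¹) ?_
    rw [← mat_mul, mul_inv_cancel, mat_one]
  · have h1 := key (Pi.single j 1)
    rw [Pi.single_eq_of_ne hj.symm, zero_smul, Matrix.mulVec_single_one] at h1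
    exact (smul_eq_zero.1 h1.symm).resolve_right hw₀
  · have h1 := key (Pi.single 0 1)
    rw [Pi.single_eq_same, one_smul, Matrix.mulVec_single_one] at h1
    exact h1

end mat

end Model

/-- The only equivariant homomorphism from the vectors to the matrices induced by automorphisms is
trivial. -/
def Rigid (w₀ : skew p n) : Prop :=
  ∀ M : (Fin n → ZMod p) → Matrix (Fin n) (Fin n) (ZMod p), (∀ u v, M (u + v) = M u * M v) →
    (∀ A, AutMatrix w₀ A → ∀ v, M (A.mulVec v) * A = A * M v) →
    (∀ v, AutMatrix w₀ (M v)) → ∀ v, M v = 1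

/-- Equivariance of a bilinear map under the matrices induced by automorphisms. -/
def Equivariant (w₀ : skew p n)
    (δ : (Fin n → ZMod p) →ₗ[ZMod p] (Fin n → ZMod p) →ₗ[ZMod p] skew p n) : Prop :=
  ∀ A, AutMatrix w₀ A → ∀ u v, δ (A.mulVec u) (A.mulVec v) = congruence A (δ u v)

/-- The perturbed commutator map spans the skew-symmetric matrices. -/
def Nondegenerate (δ : (Fin n → ZMod p) →ₗ[ZMod p] (Fin n → ZMod p) →ₗ[ZMod p] skew p n) : Prop :=
  ∀ χ : skew p n →ₗ[ZMod p] ZMod p, (∀ u v, χ (wedge u v + δ u v - δ v u) = 0) → χ = 0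

namespace Model

variable {w₀ : skew p n}

/-- Once `γ` induces the identity on vectors, it also fixes all `⟨0, X⟩`, because those are governed
by the same matrix. Hence `γ y` is a central automorphism, given by an additive map, and these
automorphisms compose by addition. -/
theorem exists_bilinear_of_gamma (hp3 : 3 ≤ p) (hw₀ : w₀ ≠ 0) (hr : Rigid w₀)
    (γ : Model w₀ →* MulAut (Model w₀))
    (hγ : ∀ (a : MulAut (Model w₀)) (y : Model w₀), γ (a y) = a * γ y * a⁻¹) :
    ∃ δ : (Fin n → ZMod p) →ₗ[ZMod p] (Fin n → ZMod p) →ₗ[ZMod p] skew p n,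
      (∀ x y, γ y x = ⟨x.v, x.w + δ x.v y.v⟩) ∧ Equivariant w₀ δ := by
  have hγ' : ∀ (a : MulAut (Model w₀)) (x y : Model w₀), γ (a y) (a x) = a (γ y x) := by
    intro a x y
    rw [hγ]
    simp
  have hmk : ∀ v X, (⟨v, X⟩ : Model w₀) = ⟨v, 0⟩ * ⟨0, X⟩ := fun v X => by
    rw [mk_mul_mk_zero, zero_add]
  have hmatconj : ∀ (a : MulAut (Model w₀)) y,
      mat hp3 (γ (a y)) * mat hp3 a = mat hp3 a * mat hp3 (γ y) := by
    intro a y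
    rw [← mat_mul, hγ, ← mat_mul, inv_mul_cancel_right]
  -- A central automorphism moves `gen w₀ 0` by `⟨0, X⟩` but induces the identity matrix, so
  -- equivariance shows that this factor does not change the matrix of `γ`.
  have hcentral : ∀ X, mat hp3 (γ ⟨0, X⟩) = 1 := by
    intro X
    let h : (Fin n → ZMod p) →ₗ[ZMod p] skew p n :=
      (LinearMap.toSpanSingleton (ZMod p) (skew p n) X).comp (LinearMap.proj 0)
    have h1 := hmatconj (centralAut h) (gen w₀ 0)
    have h2 : mat hp3 (centralAut h : MulAut (Model w₀)) = 1 := mat_eq hp3 fun x => by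
      rw [Matrix.one_mulVec]; rfl
    have h3 : centralAut h (gen w₀ 0) = gen w₀ 0 * ⟨0, X⟩ := by
      rw [centralAut_apply, gen, mk_mul_mk_zero]
      simp [h]
    rw [h2, mul_one, one_mul, h3, map_mul, mat_mul] at h1
    have h4 := (autMatrix_mat hp3 hw₀ (γ (gen w₀ 0))).isUnit
    exact h4.mul_left_cancel (h1.trans (mul_one _).symm)
  have hmat0 : ∀ v, mat hp3 (γ ⟨v, 0⟩) = 1 := by
    refine hr (fun v => mat hp3 (γ ⟨v, 0⟩)) (fun u v => ?_) (fun A hA v => ?_)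
      fun v => autMatrix_mat hp3 hw₀ _
    · rw [← mat_mul, ← map_mul]
      change _ = mat hp3 (γ ⟨u + v, _⟩)
      rw [hmk (u + v) (_ + _), map_mul, mat_mul, hcentral, mul_one]
    · have h1 := hmatconj (autOf A hA) ⟨v, 0⟩
      have h2 : mat hp3 (autOf A hA) = A := mat_eq hp3 fun x => rfl
      rwa [h2, autOf_apply, map_zero] at h1
  have hmat : ∀ x, mat hp3 (γ x) = 1 := by
    rintro ⟨v, X⟩
    rw [hmk, map_mul, mat_mul, hmat0, hcentral, one_mul]
  let D : Model w₀ → (Fin n → ZMod p) → skew p n := fun y v => (γ y ⟨v, 0⟩).w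
  have hD0 : ∀ y v, γ y ⟨v, 0⟩ = ⟨v, D y v⟩ := fun y v => by
    refine Model.ext ?_ rfl
    rw [mulAut_v hp3, hmat, Matrix.one_mulVec]
  have hD : ∀ y v X, γ y ⟨v, X⟩ = ⟨v, X + D y v⟩ := fun y v X => by
    rw [hmk, map_mul, hD0, mulAut_mk_zero hp3, hmat, congruence_one, mk_mul_mk_zero, add_comm]
  have hDadd : ∀ y u v, D y (u + v) = D y u + D y v := by
    intro y u v
    have h1 := congrArg Model.w (map_mul (γ y) ⟨u, 0⟩ ⟨v, 0⟩)
    rw [hD0, hD0, show (⟨u, 0⟩ * ⟨v, 0⟩ : Model w₀) = ⟨u + v, _⟩ from rfl, hD] at h1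
    simp only [mul_w] at h1
    have h2 : ∀ a b c d : skew p n, 0 + 0 + a + b + c = d + a + b → c = d := fun a b c d h => by
      rw [zero_add, zero_add, add_comm _ c, add_assoc d a b] at h
      exact add_right_cancel h
    exact h2 _ _ _ _ h1
  have hDmul : ∀ x y v, D (x * y) v = D x v + D y v := by
    intro x y v
    have h1 : γ (x * y) ⟨v, 0⟩ = γ x (γ y ⟨v, 0⟩) := by rw [map_mul]; rfl
    rw [hD0, hD0, hD] at h1
    exact (congrArg Model.w h1).trans (add_comm _ _)
  -- The automorphisms `γ y` commute with each other, so `γ` kills commutators and factors through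
  -- the vectors.
  have hγ0 : ∀ X, γ ⟨0, X⟩ = 1 := by
    intro X
    refine MonoidHom.mem_ker.1 (mk_zero_mem hp3 γ.ker (fun i j => ?_) X)
    rw [← pComm_gen hp3 w₀, MonoidHom.mem_ker, map_pComm]
    have h1 : γ (gen w₀ i) * γ (gen w₀ j) = γ (gen w₀ j) * γ (gen w₀ i) := by
      ext1 ⟨v, X⟩
      rw [MulAut.mul_apply, MulAut.mul_apply, hD, hD, hD, hD, add_right_comm]
    rw [mul_eq_mul_pComm] at h1
    exact mul_eq_left.1 h1
  have hDw : ∀ v X u, D ⟨v, X⟩ u = D ⟨v, 0⟩ u := by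
    intro v X u
    change (γ _ _).w = (γ _ _).w
    rw [hmk v X, map_mul, hγ0, mul_one]
  have hDadd' : ∀ u v w, D ⟨u + v, 0⟩ w = D ⟨u, 0⟩ w + D ⟨v, 0⟩ w := by
    intro u v w
    rw [← hDmul, ← hDw (u + v)]
    rfl
  let f : (Fin n → ZMod p) → (Fin n → ZMod p) →+ skew p n := fun v =>
    AddMonoidHom.mk' (D ⟨v, 0⟩) (hDadd _)
  let g : (Fin n → ZMod p) → (Fin n → ZMod p) →+ skew p n := fun u =>
    AddMonoidHom.mk' (fun v => D ⟨v, 0⟩ u) fun v v' => hDadd' v v' u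
  refine ⟨LinearMap.mk₂ (ZMod p) (fun u v => D ⟨v, 0⟩ u) (fun u u' v => hDadd _ u u')
    (fun c u v => ZMod.map_smul (f v) c u) (fun u v v' => hDadd' v v' u)
    (fun c u v => ZMod.map_smul (g u) c v), ?_, ?_⟩
  · rintro ⟨u, X⟩ ⟨v, Y⟩
    rw [hD, hDw]
    rfl
  · intro A hA u v
    have h1 := hγ' (autOf A hA) ⟨u, 0⟩ ⟨v, 0⟩
    rw [hD0, autOf_apply, autOf_apply, autOf_apply, map_zero, hD0] at h1
    exact congrArg Model.w h1

/-- The map `π` carries the commutators of the transported operation to those of the original one.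
If they lay in a proper subspace, its image under `π` would contain all commutators of generators
and hence every `⟨0, X⟩`, which is too many elements. -/
theorem nondegenerate_of_gamma (hp3 : 3 ≤ p) {π : Equiv.Perm (Model w₀)}
    (γ : Model w₀ →* MulAut (Model w₀)) (hπ : ∀ x y, π (γ y x * y) = π x * π y)
    (δ : (Fin n → ZMod p) →ₗ[ZMod p] (Fin n → ZMod p) →ₗ[ZMod p] skew p n)
    (hδ : ∀ x y, γ y x = ⟨x.v, x.w + δ x.v y.v⟩) : Nondegenerate δ := by
  intro χ hχ
  have h0 : ∀ x X, π (x * ⟨0, X⟩) = π x * π ⟨0, X⟩ := by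
    intro x X
    rw [← hπ, hδ, map_zero, add_zero]
  let f : Multiplicative (skew p n) →* Model w₀ := MonoidHom.mk' (fun X => π ⟨0, X.toAdd⟩)
    fun X Y => by
      rw [← h0, mk_mul_mk_zero]
      rfl
  let K : Subgroup (Multiplicative (skew p n)) :=
    AddSubgroup.toSubgroup (LinearMap.ker χ).toAddSubgroup
  have hK : ∀ X, χ X.toAdd = 0 → f X ∈ K.map f := fun X hX => ⟨X, hX, rfl⟩
  have hle : ∀ X, (⟨0, X⟩ : Model w₀) ∈ K.map f := by
    refine mk_zero_mem hp3 _ fun i j => ?_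
    rw [← pComm_gen hp3]
    obtain ⟨x, hx⟩ := π.surjective (gen w₀ i)
    obtain ⟨y, hy⟩ := π.surjective (gen w₀ j)
    set c := wedge x.v y.v + δ x.v y.v - δ y.v x.v with hc
    -- Thus `c` is the commutator of `x` and `y` for the transported operation.
    have h1 : γ y x * y = γ x y * x * ⟨0, c⟩ := by
      rw [hδ, hδ]
      refine Model.ext ?_ ?_
      · simp only [mul_v, add_zero, add_comm]
      · simp only [mul_v, mul_w, map_zero, Pi.zero_apply, wittSum_zero_right, hc,
          wedge_swap y.v x.v, wittSum_comm (y.v 0)]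
        have h2 : (2⁻¹ : ZMod p) • wedge x.v y.v + (2⁻¹ : ZMod p) • wedge x.v y.v
            = wedge x.v y.v := by
          rw [← add_smul, ← two_mul, mul_inv_cancel₀ (two_ne_zero_zmod hp3), one_smul]
        nth_rewrite 3 [← h2]
        module
    have h2 : π x * π y = π y * π x * π ⟨0, c⟩ := by
      rw [← hπ, ← hπ, h1, h0]
    rw [mul_eq_mul_pComm] at h2
    rw [← hx, ← hy, mul_left_cancel h2]
    exact hK (Multiplicative.ofAdd c) (hχ _ _)
  have hinj : Function.Injective f := fun X Y h =>
    congrArg Model.w (π.injective h)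
  let F : skew p n → K := fun X => ⟨(hle X).choose, (hle X).choose_spec.1⟩
  have hF : Function.Injective F := by
    intro X Y h
    have h1 : f (F X : Multiplicative (skew p n)) = ⟨0, X⟩ := (hle X).choose_spec.2
    have h2 : f (F Y : Multiplicative (skew p n)) = ⟨0, Y⟩ := (hle Y).choose_spec.2
    rw [h, h2] at h1
    exact congrArg Model.w h1.symm
  have : Finite (Multiplicative (skew p n)) := Finite.of_equiv _ Multiplicative.ofAdd
  have htop : K = ⊤ := Subgroup.eq_top_of_le_card _ (by
    rw [Nat.card_congr Multiplicative.toAdd]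
    exact Nat.card_le_card_of_injective F hF)
  refine LinearMap.ext fun X => ?_
  have : Multiplicative.ofAdd X ∈ K := by rw [htop]; trivial
  exact this

/-- The computation of `T` from a family of operators `φ` on the skew-symmetric matrices realized
by matrices `θ`. -/
theorem nonempty_TGroup_mulEquiv (hp3 : 3 ≤ p) (hw₀ : w₀ ≠ 0) (hr : Rigid w₀)
    {Q : Type*} [CommGroup Q] (θ : Q →* Matrix (Fin n) (Fin n) (ZMod p))
    (φ : Q →* Module.End (ZMod p) (skew p n))
    (hθ : ∀ q v, (θ q).mulVec v 0 = v 0)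
    (hθφ : ∀ q r X, φ q (congruence (θ r) X) = congruence (θ r) (φ q X))
    (hφ : ∀ q A, AutMatrix w₀ A → ∀ X, φ q (congruence A X) = congruence A (φ q X))
    (hφw₀ : ∀ q, congruence (θ q) w₀ = φ q w₀)
    (hinj : ∀ q, φ q = 1 → q = 1)
    (hsurj : ∀ δ, Equivariant w₀ δ → Nondegenerate δ →
      ∃ q, ∀ u v, δ u v = (2⁻¹ : ZMod p) • (φ q (wedge u v) - wedge u v)) :
    Nonempty (TGroup (Model w₀) ≃* Q) := by
  have hφinv : ∀ q X, φ q⁻¹ (φ q X) = X := fun q X => by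
    rw [← Module.End.mul_apply, ← map_mul, inv_mul_cancel, map_one, Module.End.one_apply]
  -- The inverse `φ q⁻¹` converts the transported commutator `φ q (u ∧ v)` back into `u ∧ v`. It
  -- would also rescale the Witt term; applying the matrix `θ q`, which moves `w₀` to `φ q w₀` and
  -- keeps the coordinate `v 0`, compensates for this.
  let f : Q → Model w₀ → Model w₀ := fun q x =>
    ⟨(θ q).mulVec x.v, φ q⁻¹ (congruence (θ q) x.w)⟩
  have hf1 : ∀ x, f 1 x = x := fun x => by
    refine Model.ext ?_ ?_
    · simp [f]
    · simp [f, congruence_one]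
  have hfmul : ∀ a b x, f (a * b) x = f a (f b x) := fun a b x => by
    refine Model.ext ?_ ?_
    · simp [f]
    · simp only [f, map_mul, congruence_mul, mul_inv, Module.End.mul_apply, hθφ]
  let F : Q → Equiv.Perm (Model w₀) := fun q =>
    ⟨f q, f q⁻¹, fun x => by rw [← hfmul, inv_mul_cancel, hf1],
      fun x => by rw [← hfmul, mul_inv_cancel, hf1]⟩
  have hF : ∀ q x, F q x = ⟨(θ q).mulVec x.v, φ q⁻¹ (congruence (θ q) x.w)⟩ := fun _ _ => rfl
  let δ : Q → (Fin n → ZMod p) →ₗ[ZMod p] (Fin n → ZMod p) →ₗ[ZMod p] skew p n := fun q =>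
    (2⁻¹ : ZMod p) • (wedge.compr₂ (φ q) - wedge)
  have hδ : ∀ q u v, δ q u v = (2⁻¹ : ZMod p) • (φ q (wedge u v) - wedge u v) := fun _ _ _ => rfl
  have hop : ∀ q (x y : Model w₀), F q (⟨x.v, x.w + δ q x.v y.v⟩ * y) = F q x * F q y := by
    intro q x y
    rw [hF, hF, hF]
    refine Model.ext ?_ ?_
    · simp only [mul_v, Matrix.mulVec_add]
    · simp only [mul_w, hθ, hδ, map_add, map_smul, map_sub, hφw₀, hφinv, ← congruence_wedge]
      rw [← hθφ q, hφinv]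
      module
  refine _root_.nonempty_TGroup_mulEquiv F (fun a b => Equiv.ext fun x => hfmul a b x)
    (fun q => ?_) (fun q hq => ?_) fun π hπ h1 => ?_
  · refine mem_NHol_of_gamma (fun y => centralAut ((δ q).flip y.v)) (hop q) fun a x y => ?_
    have h2 : ∀ x y : Model w₀, centralAut ((δ q).flip y.v) x = x * ⟨0, δ q x.v y.v⟩ := by
      rintro ⟨u, X⟩ ⟨v, Y⟩
      rw [mk_mul_mk_zero]
      rfl
    rw [h2, h2, map_mul, mulAut_mk_zero hp3, mulAut_v hp3, mulAut_v hp3, hδ, hδ, map_smul, map_sub,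
      ← congruence_wedge, hφ q _ (autMatrix_mat hp3 hw₀ a)]
  · have h0 : F q 1 = 1 := by
      rw [hF]
      refine Model.ext ?_ ?_
      · simp [one_v]
      · simp [one_w]
    obtain ⟨a, ha⟩ := exists_mulAut_of_mem_Hol_of_map_one hq h0
    have ha' : ∀ x y, F q (x * y) = F q x * F q y := fun x y => by
      rw [← ha]
      exact map_mul a x y
    have h2 : ∀ u v, φ q (wedge u v) = wedge u v := by
      intro u v
      have h3 := hop q ⟨u, 0⟩ ⟨v, 0⟩
      rw [← ha', (F q).apply_eq_iff_eq] at h3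
      have h4 : δ q u v = 0 := by simpa using congrArg Model.w (mul_right_cancel h3)
      rw [hδ, smul_eq_zero] at h4
      exact sub_eq_zero.1 (h4.resolve_left (inv_ne_zero (two_ne_zero_zmod hp3)))
    refine hinj q (LinearMap.ext fun X => ?_)
    rw [skew_eq_sum hp3 X]
    simp only [map_sum, map_smul, h2, Module.End.one_apply]
  · obtain ⟨γ, hγ, heq⟩ := exists_gamma_of_mem_NHol hπ h1
    obtain ⟨ε, hε, hequiv⟩ := exists_bilinear_of_gamma hp3 hw₀ hr γ heq
    obtain ⟨q, hq⟩ := hsurj ε hequiv (nondegenerate_of_gamma hp3 γ hγ ε hε)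
    refine ⟨q, mul_inv_mem_Hol_of_gamma (fun y x => γ y x) hγ fun x y => ?_⟩
    rw [hε, ← hop, hδ, hq]

end Model

end Automorphisms

/-! ### Criteria for rigidity. -/

section RigidityCriteria

variable {p n : ℕ} [hp : Fact p.Prime] [NeZero n] {w₀ : skew p n}

theorem AutMatrix.apply_zero_ne_zero {A : Matrix (Fin n) (Fin n) (ZMod p)} (h : AutMatrix w₀ A) :
    A 0 0 ≠ 0 := by
  intro h0
  have hA : A * A⁻¹ = 1 := Matrix.mul_nonsing_inv _ ((Matrix.isUnit_iff_isUnit_det A).1 h.isUnit)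
  have h1 := h.mulVec_zero (A⁻¹.mulVec (Pi.single 0 1))
  rw [Matrix.mulVec_mulVec, hA, Matrix.one_mulVec, h0, zero_mul, Pi.single_eq_same] at h1
  exact one_ne_zero h1

omit [NeZero n] in
-- Every vector is killed by `p`, while `c ^ p = c` in `ZMod p`.
theorem eq_one_of_map_add {χ : (Fin n → ZMod p) → ZMod p} (hχ : ∀ u v, χ (u + v) = χ u * χ v)
    (h0 : χ 0 = 1) (v : Fin n → ZMod p) : χ v = 1 := by
  have h1 : ∀ k : ℕ, χ (k • v) = χ v ^ k := by
    intro k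
    induction k with
    | zero => rw [zero_smul, h0, pow_zero]
    | succ k ih => rw [succ_nsmul, hχ, ih, pow_succ]
  have h2 := h1 p
  rw [ZMod.pow_card, ← Nat.cast_smul_eq_nsmul (ZMod p), ZMod.natCast_self, zero_smul, h0] at h2
  exact h2.symm

/-- The properties of the value `m` at `v` of an equivariant homomorphism which are used to show
that it is trivial. -/
structure EquivariantAt (w₀ : skew p n) (v : Fin n → ZMod p)
    (m : Matrix (Fin n) (Fin n) (ZMod p)) : Prop where
  aut : AutMatrix w₀ m
  char : ∀ χ : Matrix (Fin n) (Fin n) (ZMod p) → ZMod p, χ 1 = 1 →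
    (∀ A B, AutMatrix w₀ A → AutMatrix w₀ B → χ (A * B) = χ A * χ B) → χ m = 1
  fix : ∀ A, AutMatrix w₀ A → A.mulVec v = v → m * A = A * m
  neg : ∀ A, AutMatrix w₀ A → A.mulVec v = -v → m * A * m = A
  dbl : ∀ A, AutMatrix w₀ A → A.mulVec v = v + v → m * m * A = A * m

/-- The first row vanishes off the diagonal, so `A ↦ A 0 0` is multiplicative. -/
theorem EquivariantAt.apply_zero {v : Fin n → ZMod p} {m : Matrix (Fin n) (Fin n) (ZMod p)}
    (h : EquivariantAt w₀ v m) : m 0 0 = 1 := by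
  refine h.char (fun A => A 0 0) (Matrix.one_apply_eq _) fun A B hA _ => ?_
  rw [Matrix.mul_apply, Finset.sum_eq_single 0]
  · intro j _ hj
    rw [hA.row j hj, zero_mul]
  · simp

/-- The constraints at `v` hold for the value at any multiple of `v`. Hence both `m`, the value at a
basis vector, and its square root `s`, the value at half that vector, satisfy them. The square root
is useful because a sign condition often leaves only `s = ±1` on a block. -/
theorem rigid_of_forall_equivariantAt (hp3 : 3 ≤ p)
    (h : ∀ i s m, m = s * s → EquivariantAt w₀ (Pi.single i 1) s →
      EquivariantAt w₀ (Pi.single i 1) m → m = 1) : Rigid w₀ := by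
  intro M hadd heq haut
  have h0 : M 0 = 1 := by
    have h1 := hadd 0 0
    rw [add_zero] at h1
    exact (haut 0).isUnit.mul_left_cancel (h1.symm.trans (mul_one _).symm)
  have hneg : ∀ v, M (-v) * M v = 1 := fun v => by rw [← hadd, neg_add_cancel, h0]
  have hat : ∀ (c : ZMod p) v, EquivariantAt w₀ v (M (c • v)) := by
    intro c v
    refine ⟨haut _, fun χ hχ1 hχ => ?_, fun A hA hv => ?_, fun A hA hv => ?_, fun A hA hv => ?_⟩
    · exact eq_one_of_map_add (χ := fun v => χ (M v))
        (fun u v => by rw [hadd, hχ _ _ (haut u) (haut v)]) (by rw [h0, hχ1]) _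
    · rw [← heq A hA, Matrix.mulVec_smul, hv]
    · rw [mul_assoc, ← heq A hA, Matrix.mulVec_smul, hv, smul_neg, ← mul_assoc, ← hadd,
        add_neg_cancel, h0, one_mul]
    · rw [← heq A hA, Matrix.mulVec_smul, hv, smul_add, hadd]
  have hbasis : ∀ i, M (Pi.single i 1) = 1 := by
    intro i
    have h1 : M ((2⁻¹ : ZMod p) • Pi.single i 1) * M ((2⁻¹ : ZMod p) • Pi.single i 1) =
        M ((1 : ZMod p) • Pi.single i 1) := by
      rw [← hadd, ← add_smul, ← two_mul, mul_inv_cancel₀ (two_ne_zero_zmod hp3)]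
    have h2 := hat 1 (Pi.single i 1)
    rw [← h1] at h2
    rw [← one_smul (ZMod p) (Pi.single i 1), ← h1]
    exact h i _ _ rfl (hat _ _) h2
  let S : AddSubgroup (Fin n → ZMod p) :=
    { carrier := {v | M v = 1}
      add_mem' := fun {u v} hu hv => by
        change M (u + v) = 1
        rw [hadd, show M u = 1 from hu, show M v = 1 from hv, mul_one]
      zero_mem' := h0
      neg_mem' := fun {v} hv => by
        have := hneg v
        rwa [show M v = 1 from hv, mul_one] at this }
  intro v
  have : v ∈ S := by
    rw [pi_eq_sum_univ' v]
    exact sum_mem fun i _ => ZMod.smul_mem (hbasis i) _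
  exact this

end RigidityCriteria

/-! ### Basis bivectors and small enumerations. -/

section Matrices

variable (p : ℕ) {n : ℕ} [hp : Fact p.Prime]

/-- The exterior product of two standard basis vectors. -/
def basisWedge (i j : Fin n) : skew p n := wedge (Pi.single i 1) (Pi.single j 1)

variable {p}

theorem basisWedge_apply (i j k l : Fin n) : (basisWedge p i j).1 k l =
    (if k = i then 1 else 0) * (if l = j then 1 else 0) -
      (if k = j then 1 else 0) * (if l = i then 1 else 0) := by
  rw [basisWedge, wedge_apply, Pi.single_apply, Pi.single_apply, Pi.single_apply, Pi.single_apply]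

theorem congruence_basisWedge_apply (A : Matrix (Fin n) (Fin n) (ZMod p)) (i j k l : Fin n) :
    (congruence A (basisWedge p i j)).1 k l = A k i * A l j - A k j * A l i := by
  rw [basisWedge, congruence_wedge, wedge_apply, Matrix.mulVec_single_one,
    Matrix.mulVec_single_one]
  rfl

theorem basisWedge_ne_zero {i j : Fin n} (hij : i ≠ j) : basisWedge p i j ≠ 0 := by
  intro h
  have h1 : (basisWedge p i j).1 i j = 0 := by rw [h]; rfl
  rw [basisWedge_apply] at h1
  simp [hij] at h1

end Matrices

section Enumeration

theorem forall_fin_three {P : Fin 3 → Prop} : (∀ i, P i) ↔ P 0 ∧ P 1 ∧ P 2 := by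
  simp [Fin.forall_fin_succ]

theorem forall_fin_four {P : Fin 4 → Prop} : (∀ i, P i) ↔ P 0 ∧ P 1 ∧ P 2 ∧ P 3 := by
  simp [Fin.forall_fin_succ]

theorem three_ne_zero_zmod {p : ℕ} [Fact p.Prime] (hp5 : 5 ≤ p) : (3 : ZMod p) ≠ 0 := by
  have h : ((3 : ℕ) : ZMod p) ≠ 0 := by
    rw [Ne, ZMod.natCast_eq_zero_iff]
    exact fun h => by have := Nat.le_of_dvd (by norm_num) h; omega
  exact_mod_cast h

end Enumeration

/-! ### Rigidity for three generators. -/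

section RankThree

variable {p : ℕ} [hp : Fact p.Prime]

theorem autMatrix_three_zero_one {x a b z : ZMod p} (hx : x ≠ 0) (hz : z ≠ 0) :
    AutMatrix (basisWedge p (0 : Fin 3) 1) !![x, 0, 0; a, 1, b; 0, 0, z] := by
  refine ⟨?_, fun j hj => ?_, ?_⟩
  · rw [Matrix.isUnit_iff_isUnit_det, isUnit_iff_ne_zero, Matrix.det_fin_three]
    simp [hx, hz]
  · fin_cases j <;> simp at hj ⊢
  · ext k l
    rw [congruence_basisWedge_apply, Submodule.coe_smul, Matrix.smul_apply, basisWedge_apply]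
    fin_cases k <;> fin_cases l <;> simp

theorem AutMatrix.entries_three_zero_one {A : Matrix (Fin 3) (Fin 3) (ZMod p)}
    (h : AutMatrix (basisWedge p (0 : Fin 3) 1) A) :
    A 0 1 = 0 ∧ A 0 2 = 0 ∧ A 1 1 = 1 ∧ A 2 0 = 0 ∧ A 2 1 = 0 := by
  have h1 := h.row 1 (by decide)
  have h2 := h.row 2 (by decide)
  have h0 := h.apply_zero_ne_zero
  have key := fun k l => congrFun (congrFun (congrArg Subtype.val h.congruence_eq) k) l
  simp only [congruence_basisWedge_apply, Submodule.coe_smul, Matrix.smul_apply,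
    basisWedge_apply, smul_eq_mul] at key
  have k1 := key 0 1
  have k2 := key 0 2
  have k3 := key 1 2
  simp at k1 k2 k3
  grind

/-- The diagonal entries are characters or constants, so only `m 1 0` and `m 1 2` remain. Doubling a
basis vector by a diagonal matrix gives relations such as `4 * a = a`, which is where `3 ≠ 0`, hence
`p ≥ 5`, enters; sign matrices suffice for the middle vector. -/
theorem rigid_three_zero_one (hp5 : 5 ≤ p) : Rigid (basisWedge p (0 : Fin 3) 1) := by
  have h2 : (2 : ZMod p) ≠ 0 := two_ne_zero_zmod (by omega)
  have h3 := three_ne_zero_zmod hp5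
  have h1 : (-1 : ZMod p) ≠ 0 := neg_ne_zero.2 one_ne_zero
  refine rigid_of_forall_equivariantAt (by omega) fun i _ m hsm _ hm => ?_
  clear hsm
  obtain ⟨e1, e2, e3, e4, e5⟩ := hm.aut.entries_three_zero_one
  have e0 := hm.apply_zero
  have e6 : m 2 2 = 1 := by
    refine hm.char (fun A => A 2 2) (Matrix.one_apply_eq _) fun A B hA hB => ?_
    obtain ⟨-, -, -, h4, h5⟩ := hA.entries_three_zero_one
    simp [Matrix.mul_apply, Fin.sum_univ_three, h4, h5]
  have h12 : m 1 2 = 0 ∧ m 1 0 = 0 := by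
    fin_cases i
    · have k1 := hm.dbl _ (autMatrix_three_zero_one (a := 0) (b := 0) h2 one_ne_zero)
        (by simp [funext_iff, forall_fin_three, one_add_one_eq_two])
      simp only [← Matrix.ext_iff, forall_fin_three, Matrix.mul_apply, Fin.sum_univ_three] at k1
      simp [*] at k1
      grind
    · have k1 := hm.fix _ (autMatrix_three_zero_one (a := 0) (b := 0) h1 one_ne_zero)
        (by simp [funext_iff, forall_fin_three])
      have k2 := hm.fix _ (autMatrix_three_zero_one (a := 0) (b := 0) one_ne_zero h1)
        (by simp [funext_iff, forall_fin_three])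
      simp only [← Matrix.ext_iff, forall_fin_three, Matrix.mul_apply, Fin.sum_univ_three] at k1 k2
      simp [*] at k1 k2
      grind
    · have k1 := hm.dbl _ (autMatrix_three_zero_one (a := 0) (b := 0) one_ne_zero h2)
        (by simp [funext_iff, forall_fin_three, one_add_one_eq_two])
      simp only [← Matrix.ext_iff, forall_fin_three, Matrix.mul_apply, Fin.sum_univ_three] at k1
      simp [*] at k1
      grind
  rw [← Matrix.ext_iff]
  simp [forall_fin_three, *]

theorem autMatrix_three_one_two {x a b c d e f : ZMod p} (hx : x = c * f - d * e) (hx0 : x ≠ 0) :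
    AutMatrix (basisWedge p (1 : Fin 3) 2) !![x, 0, 0; a, c, d; b, e, f] := by
  refine ⟨?_, fun j hj => ?_, ?_⟩
  · rw [Matrix.isUnit_iff_isUnit_det, isUnit_iff_ne_zero, Matrix.det_fin_three]
    simp
    grind
  · fin_cases j <;> simp at hj ⊢
  · ext k l
    rw [congruence_basisWedge_apply, Submodule.coe_smul, Matrix.smul_apply, basisWedge_apply]
    fin_cases k <;> fin_cases l <;> simp <;> grind

theorem AutMatrix.entries_three_one_two {A : Matrix (Fin 3) (Fin 3) (ZMod p)}
    (h : AutMatrix (basisWedge p (1 : Fin 3) 2) A) :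
    A 0 1 = 0 ∧ A 0 2 = 0 ∧ A 1 1 * A 2 2 - A 1 2 * A 2 1 = A 0 0 := by
  refine ⟨h.row 1 (by decide), h.row 2 (by decide), ?_⟩
  have key := fun k l => congrFun (congrFun (congrArg Subtype.val h.congruence_eq) k) l
  simp only [congruence_basisWedge_apply, Submodule.coe_smul, Matrix.smul_apply,
    basisWedge_apply, smul_eq_mul] at key
  simpa using key 1 2

/-- The lower `2 × 2` block `S` of `s` has determinant `s 0 0 = 1`. At `e₀` it commutes with both
transvections, so it is scalar; at the other basis vectors the sign matrix gives `S * S = 1`. In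
either case `S = ±1`, so `m = s * s` has trivial block, and the remaining entries fall to sign
matrices and transvections. -/
theorem rigid_three_one_two (hp3 : 3 ≤ p) : Rigid (basisWedge p (1 : Fin 3) 2) := by
  have h2 : (2 : ZMod p) ≠ 0 := two_ne_zero_zmod hp3
  refine rigid_of_forall_equivariantAt hp3 fun i s m hsm hs hm => ?_
  obtain ⟨s1, s2, s3⟩ := hs.aut.entries_three_one_two
  have s0 := hs.apply_zero
  obtain ⟨e1, e2, e3⟩ := hm.aut.entries_three_one_two
  have e0 := hm.apply_zero
  have hz : AutMatrix (basisWedge p (1 : Fin 3) 2) !![1, 0, 0; 0, -1, 0; 0, 0, -1] :=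
    autMatrix_three_one_two (by ring) one_ne_zero
  have hy : AutMatrix (basisWedge p (1 : Fin 3) 2) !![-1, 0, 0; 0, -1, 0; 0, 0, 1] :=
    autMatrix_three_one_two (by ring) (neg_ne_zero.2 one_ne_zero)
  have hx : AutMatrix (basisWedge p (1 : Fin 3) 2) !![-1, 0, 0; 0, 1, 0; 0, 0, -1] :=
    autMatrix_three_one_two (by ring) (neg_ne_zero.2 one_ne_zero)
  have hu : AutMatrix (basisWedge p (1 : Fin 3) 2) !![1, 0, 0; 0, 1, 1; 0, 0, 1] :=
    autMatrix_three_one_two (by ring) one_ne_zero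
  have hl : AutMatrix (basisWedge p (1 : Fin 3) 2) !![1, 0, 0; 0, 1, 0; 0, 1, 1] :=
    autMatrix_three_one_two (by ring) one_ne_zero
  simp only [← Matrix.ext_iff, forall_fin_three, Matrix.mul_apply, Fin.sum_univ_three] at hsm ⊢
  simp [e0, e1, e2, s0, s1, s2] at hsm ⊢
  fin_cases i
  · have k1 := hs.fix _ hz
      (by simp [funext_iff, forall_fin_three])
    have k2 := hs.fix _ hu
      (by simp [funext_iff, forall_fin_three])
    have k3 := hs.fix _ hl
      (by simp [funext_iff, forall_fin_three])
    simp only [← Matrix.ext_iff, forall_fin_three, Matrix.mul_apply, Fin.sum_univ_three] at k1 k2 k3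
    simp [s0, s1, s2] at k1 k2 k3
    grind
  · have k1 := hs.neg _ hz
      (by simp [funext_iff, forall_fin_three])
    have k2 := hm.neg _ hy
      (by simp [funext_iff, forall_fin_three])
    have k3 := hm.fix _ hu
      (by simp [funext_iff, forall_fin_three])
    simp only [← Matrix.ext_iff, forall_fin_three, Matrix.mul_apply, Fin.sum_univ_three] at k1 k2 k3
    simp [s0, s1, s2, e0, e1, e2] at k1 k2 k3
    grind
  · have k1 := hs.neg _ hz
      (by simp [funext_iff, forall_fin_three])
    have k2 := hm.neg _ hx
      (by simp [funext_iff, forall_fin_three])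
    have k3 := hm.fix _ hl
      (by simp [funext_iff, forall_fin_three])
    simp only [← Matrix.ext_iff, forall_fin_three, Matrix.mul_apply, Fin.sum_univ_three] at k1 k2 k3
    simp [s0, s1, s2, e0, e1, e2] at k1 k2 k3
    grind

end RankThree

/-! ### Rigidity for four generators. -/

section RankFour

variable {p : ℕ} [hp : Fact p.Prime]

theorem autMatrix_four_zero_one {x a b c d e f g : ZMod p} (hx : x ≠ 0) (hg : d * g - e * f ≠ 0) :
    AutMatrix (basisWedge p (0 : Fin 4) 1)
      !![x, 0, 0, 0; a, 1, b, c; 0, 0, d, e; 0, 0, f, g] := by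
  refine ⟨?_, fun j hj => ?_, ?_⟩
  · rw [Matrix.isUnit_iff_isUnit_det, isUnit_iff_ne_zero]
    simp [Matrix.det_succ_row_zero, Fin.sum_univ_succ, Fin.succAbove]
    grind
  · fin_cases j <;> simp at hj ⊢
  · ext k l
    simp only [congruence_basisWedge_apply, Submodule.coe_smul, Matrix.smul_apply,
      basisWedge_apply]
    fin_cases k <;> fin_cases l <;> simp

theorem AutMatrix.entries_four_zero_one {A : Matrix (Fin 4) (Fin 4) (ZMod p)}
    (h : AutMatrix (basisWedge p (0 : Fin 4) 1) A) :
    A 0 1 = 0 ∧ A 0 2 = 0 ∧ A 0 3 = 0 ∧ A 1 1 = 1 ∧ A 2 0 = 0 ∧ A 2 1 = 0 ∧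
      A 3 0 = 0 ∧ A 3 1 = 0 := by
  have h1 := h.row 1 (by decide)
  have h2 := h.row 2 (by decide)
  have h3 := h.row 3 (by decide)
  have h0 := h.apply_zero_ne_zero
  have key := fun k l => congrFun (congrFun (congrArg Subtype.val h.congruence_eq) k) l
  simp only [congruence_basisWedge_apply, Submodule.coe_smul, Matrix.smul_apply,
    basisWedge_apply, smul_eq_mul] at key
  have k1 := key 0 1
  have k2 := key 0 2
  have k3 := key 0 3
  have k4 := key 1 2
  have k5 := key 1 3
  have k6 := key 2 3
  simp at k1 k2 k3 k4 k5 k6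
  grind

theorem autMatrix_four_two_three {x y a b c a' b' d e f g : ZMod p}
    (hx : x = d * g - e * f) (hx0 : x ≠ 0) (hy : y ≠ 0) :
    AutMatrix (basisWedge p (2 : Fin 4) 3)
      !![x, 0, 0, 0; a, y, 0, 0; b, a', d, e; c, b', f, g] := by
  refine ⟨?_, fun j hj => ?_, ?_⟩
  · rw [Matrix.isUnit_iff_isUnit_det, isUnit_iff_ne_zero]
    simp [Matrix.det_succ_row_zero, Fin.sum_univ_succ, Fin.succAbove]
    grind
  · fin_cases j <;> simp at hj ⊢
  · ext k l
    simp only [congruence_basisWedge_apply, Submodule.coe_smul, Matrix.smul_apply,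
      basisWedge_apply]
    fin_cases k <;> fin_cases l <;> simp <;> grind

theorem AutMatrix.entries_four_two_three {A : Matrix (Fin 4) (Fin 4) (ZMod p)}
    (h : AutMatrix (basisWedge p (2 : Fin 4) 3) A) :
    A 0 1 = 0 ∧ A 0 2 = 0 ∧ A 0 3 = 0 ∧ A 1 2 = 0 ∧ A 1 3 = 0 ∧
      A 2 2 * A 3 3 - A 2 3 * A 3 2 = A 0 0 := by
  have h1 := h.row 1 (by decide)
  have h2 := h.row 2 (by decide)
  have h3 := h.row 3 (by decide)
  have h0 := h.apply_zero_ne_zero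
  have key := fun k l => congrFun (congrFun (congrArg Subtype.val h.congruence_eq) k) l
  simp only [congruence_basisWedge_apply, Submodule.coe_smul, Matrix.smul_apply,
    basisWedge_apply, smul_eq_mul] at key
  have k1 := key 0 1
  have k2 := key 0 2
  have k3 := key 0 3
  have k4 := key 1 2
  have k5 := key 1 3
  have k6 := key 2 3
  simp at k1 k2 k3 k4 k5 k6
  grind

/-- The values of `u` and `v` are forced by the vanishing of the entries `(1, 2)` and `(1, 3)` of `A
w₀ Aᵀ`. -/
theorem autMatrix_four_symplectic {x a b c u v d e f g : ZMod p}
    (hx : x = d * g - e * f) (hx0 : x ≠ 0)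
    (hu : u = b * e - c * d) (hv : v = b * g - c * f) :
    AutMatrix (basisWedge p (0 : Fin 4) 1 + basisWedge p 2 3)
      !![x, 0, 0, 0; a, 1, b, c; u, 0, d, e; v, 0, f, g] := by
  refine ⟨?_, fun j hj => ?_, ?_⟩
  · rw [Matrix.isUnit_iff_isUnit_det, isUnit_iff_ne_zero]
    simp [Matrix.det_succ_row_zero, Fin.sum_univ_succ, Fin.succAbove]
    grind
  · fin_cases j <;> simp at hj ⊢
  · ext k l
    simp only [congruence_basisWedge_apply, Submodule.coe_smul, Matrix.smul_apply,
      basisWedge_apply, Submodule.coe_add, Matrix.add_apply, map_add]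
    fin_cases k <;> fin_cases l <;> simp <;> grind

theorem AutMatrix.entries_four_symplectic {A : Matrix (Fin 4) (Fin 4) (ZMod p)}
    (h : AutMatrix (basisWedge p (0 : Fin 4) 1 + basisWedge p 2 3) A) :
    A 0 1 = 0 ∧ A 0 2 = 0 ∧ A 0 3 = 0 ∧ A 1 1 = 1 ∧ A 2 1 = 0 ∧ A 3 1 = 0 ∧
      A 2 2 * A 3 3 - A 2 3 * A 3 2 = A 0 0 := by
  have h1 := h.row 1 (by decide)
  have h2 := h.row 2 (by decide)
  have h3 := h.row 3 (by decide)
  have h0 := h.apply_zero_ne_zero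
  have key := fun k l => congrFun (congrFun (congrArg Subtype.val h.congruence_eq) k) l
  simp only [congruence_basisWedge_apply, Submodule.coe_smul, Matrix.smul_apply,
    basisWedge_apply, smul_eq_mul, Submodule.coe_add, Matrix.add_apply, map_add] at key
  have k1 := key 0 1
  have k2 := key 0 2
  have k3 := key 0 3
  have k4 := key 1 2
  have k5 := key 1 3
  have k6 := key 2 3
  simp at k1 k2 k3 k4 k5 k6
  grind

/-- The lower block of `s` is `±1`, by commutation with transvections or by a sign matrix as in rank
three. Its determinant is `1` because it is a character of the automorphism matrices. The rest of
`m` is killed by signs and by doublings, the latter using `3 ≠ 0`. -/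
theorem rigid_four_zero_one (hp5 : 5 ≤ p) :
    Rigid (basisWedge p (0 : Fin 4) 1) := by
  have hp3 : 3 ≤ p := by omega
  have h3 := three_ne_zero_zmod hp5
  have h2 : (2 : ZMod p) ≠ 0 := two_ne_zero_zmod hp3
  have h1 : (-1 : ZMod p) ≠ 0 := neg_ne_zero.2 one_ne_zero
  refine rigid_of_forall_equivariantAt hp3 fun i s m hsm hs hm => ?_
  obtain ⟨s1, s2, s3, s4, s5, s6, s7, s8⟩ := hs.aut.entries_four_zero_one
  obtain ⟨e1, e2, e3, e4, e5, e6, e7, e8⟩ := hm.aut.entries_four_zero_one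
  have s0 := hs.apply_zero
  have e0 := hm.apply_zero
  have s9 : s 2 2 * s 3 3 - s 2 3 * s 3 2 = 1 := by
    refine hs.char (fun A => A 2 2 * A 3 3 - A 2 3 * A 3 2) (by simp) fun A B hA hB => ?_
    obtain ⟨-, -, -, -, h20, h21, h30, h31⟩ := hA.entries_four_zero_one
    simp [Matrix.mul_apply, Fin.sum_univ_four, h20, h21, h30, h31]
    ring
  have hz : AutMatrix (basisWedge p (0 : Fin 4) 1)
      !![1, 0, 0, 0; 0, 1, 0, 0; 0, 0, -1, 0; 0, 0, 0, -1] :=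
    autMatrix_four_zero_one (by simp [*]) (by simp [*])
  have hu : AutMatrix (basisWedge p (0 : Fin 4) 1)
      !![1, 0, 0, 0; 0, 1, 0, 0; 0, 0, 1, 1; 0, 0, 0, 1] :=
    autMatrix_four_zero_one (by simp [*]) (by simp [*])
  have hl : AutMatrix (basisWedge p (0 : Fin 4) 1)
      !![1, 0, 0, 0; 0, 1, 0, 0; 0, 0, 1, 0; 0, 0, 1, 1] :=
    autMatrix_four_zero_one (by simp [*]) (by simp [*])
  have hd : AutMatrix (basisWedge p (0 : Fin 4) 1)
      !![2, 0, 0, 0; 0, 1, 0, 0; 0, 0, 1, 0; 0, 0, 0, 1] :=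
    autMatrix_four_zero_one (by simp [*]) (by simp [*])
  have hx : AutMatrix (basisWedge p (0 : Fin 4) 1)
      !![-1, 0, 0, 0; 0, 1, 0, 0; 0, 0, 1, 0; 0, 0, 0, 1] :=
    autMatrix_four_zero_one (by simp [*]) (by simp [*])
  have hw : AutMatrix (basisWedge p (0 : Fin 4) 1)
      !![1, 0, 0, 0; 0, 1, 0, 0; 0, 0, 1, 0; 0, 0, 0, -1] :=
    autMatrix_four_zero_one (by simp [*]) (by simp [*])
  have hq : AutMatrix (basisWedge p (0 : Fin 4) 1)
      !![1, 0, 0, 0; 0, 1, 0, 0; 0, 0, 2, 0; 0, 0, 0, 2] :=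
    autMatrix_four_zero_one (by simp [*]) (by simp [*])
  have hy : AutMatrix (basisWedge p (0 : Fin 4) 1)
      !![1, 0, 0, 0; 0, 1, 0, 0; 0, 0, -1, 0; 0, 0, 0, 1] :=
    autMatrix_four_zero_one (by simp [*]) (by simp [*])
  simp only [← Matrix.ext_iff, forall_fin_four, Matrix.mul_apply, Fin.sum_univ_four] at hsm ⊢
  simp [e0, e1, e2, e3, e4, e5, e6, e7, e8, s0, s1, s2, s3, s4, s5, s6, s7, s8] at hsm ⊢
  fin_cases i
  · have k0 := hs.fix _ hz (by simp [funext_iff, forall_fin_four])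
    have k1 := hs.fix _ hu (by simp [funext_iff, forall_fin_four])
    have k2 := hs.fix _ hl (by simp [funext_iff, forall_fin_four])
    have k3 := hm.dbl _ hd (by simp [funext_iff, forall_fin_four, one_add_one_eq_two])
    simp only [← Matrix.ext_iff, forall_fin_four, Matrix.mul_apply, Fin.sum_univ_four]
      at k0 k1 k2 k3
    simp [e0, e1, e2, e3, e4, e5, e6, e7, e8, s0, s1, s2, s3, s4, s5, s6, s7, s8] at k0 k1 k2 k3
    clear hz hu hl hd hx hw hq hy hs hm
    grind
  · have k0 := hs.fix _ hz (by simp [funext_iff, forall_fin_four])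
    have k1 := hs.fix _ hu (by simp [funext_iff, forall_fin_four])
    have k2 := hs.fix _ hl (by simp [funext_iff, forall_fin_four])
    have k3 := hm.fix _ hx (by simp [funext_iff, forall_fin_four])
    simp only [← Matrix.ext_iff, forall_fin_four, Matrix.mul_apply, Fin.sum_univ_four]
      at k0 k1 k2 k3
    simp [e0, e1, e2, e3, e4, e5, e6, e7, e8, s0, s1, s2, s3, s4, s5, s6, s7, s8] at k0 k1 k2 k3
    clear hz hu hl hd hx hw hq hy hs hm
    grind
  · have k0 := hs.neg _ hz (by simp [funext_iff, forall_fin_four])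
    have k1 := hm.fix _ hw (by simp [funext_iff, forall_fin_four])
    have k2 := hm.dbl _ hq (by simp [funext_iff, forall_fin_four, one_add_one_eq_two])
    simp only [← Matrix.ext_iff, forall_fin_four, Matrix.mul_apply, Fin.sum_univ_four] at k0 k1 k2
    simp [e0, e1, e2, e3, e4, e5, e6, e7, e8, s0, s1, s2, s3, s4, s5, s6, s7, s8] at k0 k1 k2
    clear hz hu hl hd hx hw hq hy hs hm
    grind
  · have k0 := hs.neg _ hz (by simp [funext_iff, forall_fin_four])
    have k1 := hm.fix _ hy (by simp [funext_iff, forall_fin_four])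
    have k2 := hm.dbl _ hq (by simp [funext_iff, forall_fin_four, one_add_one_eq_two])
    simp only [← Matrix.ext_iff, forall_fin_four, Matrix.mul_apply, Fin.sum_univ_four] at k0 k1 k2
    simp [e0, e1, e2, e3, e4, e5, e6, e7, e8, s0, s1, s2, s3, s4, s5, s6, s7, s8] at k0 k1 k2
    clear hz hu hl hd hx hw hq hy hs hm
    grind

/-- The same block argument applies, with determinant `s 0 0 = 1`; the entry `A 1 1` is an
additional character. Sign matrices and transvections suffice, so `p = 3` is allowed. -/
theorem rigid_four_two_three (hp3 : 3 ≤ p) :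
    Rigid (basisWedge p (2 : Fin 4) 3) := by
  have h2 : (2 : ZMod p) ≠ 0 := two_ne_zero_zmod hp3
  have h1 : (-1 : ZMod p) ≠ 0 := neg_ne_zero.2 one_ne_zero
  refine rigid_of_forall_equivariantAt hp3 fun i s m hsm hs hm => ?_
  obtain ⟨s1, s2, s3, s4, s5, s6⟩ := hs.aut.entries_four_two_three
  obtain ⟨e1, e2, e3, e4, e5, e6⟩ := hm.aut.entries_four_two_three
  have s0 := hs.apply_zero
  have e0 := hm.apply_zero
  have s7 : s 1 1 = 1 := by
    refine hs.char (fun A => A 1 1) (Matrix.one_apply_eq _) fun A B hA hB => ?_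
    obtain ⟨-, -, -, h12, h13, -⟩ := hA.entries_four_two_three
    obtain ⟨h01, -⟩ := hB.entries_four_two_three
    simp [Matrix.mul_apply, Fin.sum_univ_four, h12, h13, h01]
  have e7 : m 1 1 = 1 := by
    refine hm.char (fun A => A 1 1) (Matrix.one_apply_eq _) fun A B hA hB => ?_
    obtain ⟨-, -, -, h12, h13, -⟩ := hA.entries_four_two_three
    obtain ⟨h01, -⟩ := hB.entries_four_two_three
    simp [Matrix.mul_apply, Fin.sum_univ_four, h12, h13, h01]
  have hz : AutMatrix (basisWedge p (2 : Fin 4) 3)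
      !![1, 0, 0, 0; 0, 1, 0, 0; 0, 0, -1, 0; 0, 0, 0, -1] :=
    autMatrix_four_two_three (by ring) (by simp [*]) (by simp)
  have hu : AutMatrix (basisWedge p (2 : Fin 4) 3)
      !![1, 0, 0, 0; 0, 1, 0, 0; 0, 0, 1, 1; 0, 0, 0, 1] :=
    autMatrix_four_two_three (by ring) (by simp [*]) (by simp)
  have hl : AutMatrix (basisWedge p (2 : Fin 4) 3)
      !![1, 0, 0, 0; 0, 1, 0, 0; 0, 0, 1, 0; 0, 0, 1, 1] :=
    autMatrix_four_two_three (by ring) (by simp [*]) (by simp)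
  have hv : AutMatrix (basisWedge p (2 : Fin 4) 3)
      !![1, 0, 0, 0; 0, -1, 0, 0; 0, 0, 1, 0; 0, 0, 0, 1] :=
    autMatrix_four_two_three (by ring) (by simp [*]) (by simp)
  have ht : AutMatrix (basisWedge p (2 : Fin 4) 3)
      !![-1, 0, 0, 0; 0, 1, 0, 0; 0, 0, -1, 0; 0, 0, 0, 1] :=
    autMatrix_four_two_three (by ring) (by simp [*]) (by simp)
  have ht2 : AutMatrix (basisWedge p (2 : Fin 4) 3)
      !![-1, 0, 0, 0; 0, 1, 0, 0; 0, 0, 1, 0; 0, 0, 0, -1] :=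
    autMatrix_four_two_three (by ring) (by simp [*]) (by simp)
  simp only [← Matrix.ext_iff, forall_fin_four, Matrix.mul_apply, Fin.sum_univ_four] at hsm ⊢
  simp [s0, s1, s2, s3, s4, s5, s7] at hsm ⊢
  fin_cases i
  · have k0 := hs.fix _ hz (by simp [funext_iff, forall_fin_four])
    have k1 := hs.fix _ hu (by simp [funext_iff, forall_fin_four])
    have k2 := hs.fix _ hl (by simp [funext_iff, forall_fin_four])
    have k3 := hs.fix _ hv (by simp [funext_iff, forall_fin_four])
    simp only [← Matrix.ext_iff, forall_fin_four, Matrix.mul_apply, Fin.sum_univ_four]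
      at k0 k1 k2 k3
    simp [s0, s1, s2, s3, s4, s5, s7] at k0 k1 k2 k3
    clear hz hu hl hv ht ht2 hs hm
    grind
  · have k0 := hs.fix _ hz (by simp [funext_iff, forall_fin_four])
    have k1 := hs.fix _ hu (by simp [funext_iff, forall_fin_four])
    have k2 := hs.fix _ hl (by simp [funext_iff, forall_fin_four])
    have k3 := hm.fix _ ht (by simp [funext_iff, forall_fin_four])
    simp only [← Matrix.ext_iff, forall_fin_four, Matrix.mul_apply, Fin.sum_univ_four]
      at k0 k1 k2 k3
    simp [e0, e1, e2, e3, e4, e5, e7, s0, s1, s2, s3, s4, s5, s7] at k0 k1 k2 k3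
    clear hz hu hl hv ht ht2 hs hm
    grind
  · have k0 := hs.neg _ hz (by simp [funext_iff, forall_fin_four])
    have k1 := hm.fix _ hv (by simp [funext_iff, forall_fin_four])
    have k2 := hm.neg _ ht (by simp [funext_iff, forall_fin_four])
    have k3 := hm.fix _ hu (by simp [funext_iff, forall_fin_four])
    simp only [← Matrix.ext_iff, forall_fin_four, Matrix.mul_apply, Fin.sum_univ_four]
      at k0 k1 k2 k3
    simp [e0, e1, e2, e3, e4, e5, e7, s0, s1, s2, s3, s4, s5, s7] at k0 k1 k2 k3
    clear hz hu hl hv ht ht2 hs hm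
    grind
  · have k0 := hs.neg _ hz (by simp [funext_iff, forall_fin_four])
    have k1 := hm.fix _ hv (by simp [funext_iff, forall_fin_four])
    have k2 := hm.neg _ ht2 (by simp [funext_iff, forall_fin_four])
    have k3 := hm.fix _ hl (by simp [funext_iff, forall_fin_four])
    simp only [← Matrix.ext_iff, forall_fin_four, Matrix.mul_apply, Fin.sum_univ_four]
      at k0 k1 k2 k3
    simp [e0, e1, e2, e3, e4, e5, e7, s0, s1, s2, s3, s4, s5, s7] at k0 k1 k2 k3
    clear hz hu hl hv ht ht2 hs hm
    grind

/-- Again the lower block of `s` is `±1`, its determinant being `s 0 0 = 1`. Only `m 1 0` at `e₀`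
needs a doubling, and with it `3 ≠ 0`. -/
theorem rigid_four_symplectic (hp5 : 5 ≤ p) :
    Rigid (basisWedge p (0 : Fin 4) 1 + basisWedge p 2 3) := by
  have hp3 : 3 ≤ p := by omega
  have h3 := three_ne_zero_zmod hp5
  have h2 : (2 : ZMod p) ≠ 0 := two_ne_zero_zmod hp3
  have h1 : (-1 : ZMod p) ≠ 0 := neg_ne_zero.2 one_ne_zero
  refine rigid_of_forall_equivariantAt hp3 fun i s m hsm hs hm => ?_
  obtain ⟨s1, s2, s3, s4, s5, s6, s7⟩ := hs.aut.entries_four_symplectic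
  obtain ⟨e1, e2, e3, e4, e5, e6, e7⟩ := hm.aut.entries_four_symplectic
  have s0 := hs.apply_zero
  have e0 := hm.apply_zero
  have hz : AutMatrix (basisWedge p (0 : Fin 4) 1 + basisWedge p 2 3)
      !![1, 0, 0, 0; 0, 1, 0, 0; 0, 0, -1, 0; 0, 0, 0, -1] :=
    autMatrix_four_symplectic (by ring) (by simp [*]) (by ring) (by ring)
  have hu : AutMatrix (basisWedge p (0 : Fin 4) 1 + basisWedge p 2 3)
      !![1, 0, 0, 0; 0, 1, 0, 0; 0, 0, 1, 1; 0, 0, 0, 1] :=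
    autMatrix_four_symplectic (by ring) (by simp [*]) (by ring) (by ring)
  have hl : AutMatrix (basisWedge p (0 : Fin 4) 1 + basisWedge p 2 3)
      !![1, 0, 0, 0; 0, 1, 0, 0; 0, 0, 1, 0; 0, 0, 1, 1] :=
    autMatrix_four_symplectic (by ring) (by simp [*]) (by ring) (by ring)
  have hdd : AutMatrix (basisWedge p (0 : Fin 4) 1 + basisWedge p 2 3)
      !![2, 0, 0, 0; 0, 1, 0, 0; 0, 0, 2, 0; 0, 0, 0, 1] :=
    autMatrix_four_symplectic (by ring) (by simp [*]) (by ring) (by ring)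
  have ht : AutMatrix (basisWedge p (0 : Fin 4) 1 + basisWedge p 2 3)
      !![-1, 0, 0, 0; 0, 1, 0, 0; 0, 0, -1, 0; 0, 0, 0, 1] :=
    autMatrix_four_symplectic (by ring) (by simp [*]) (by ring) (by ring)
  have ht2 : AutMatrix (basisWedge p (0 : Fin 4) 1 + basisWedge p 2 3)
      !![-1, 0, 0, 0; 0, 1, 0, 0; 0, 0, 1, 0; 0, 0, 0, -1] :=
    autMatrix_four_symplectic (by ring) (by simp [*]) (by ring) (by ring)
  simp only [← Matrix.ext_iff, forall_fin_four, Matrix.mul_apply, Fin.sum_univ_four] at hsm ⊢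
  simp [e0, e1, e2, e3, e4, e5, e6, s0, s1, s2, s3, s4, s5, s6] at hsm ⊢
  fin_cases i
  · have k0 := hs.fix _ hz (by simp [funext_iff, forall_fin_four])
    have k1 := hs.fix _ hu (by simp [funext_iff, forall_fin_four])
    have k2 := hs.fix _ hl (by simp [funext_iff, forall_fin_four])
    have k3 := hm.dbl _ hdd (by simp [funext_iff, forall_fin_four, one_add_one_eq_two])
    simp only [← Matrix.ext_iff, forall_fin_four, Matrix.mul_apply, Fin.sum_univ_four]
      at k0 k1 k2 k3
    simp [e0, e1, e2, e3, e4, e5, e6, s0, s1, s2, s3, s4, s5, s6] at k0 k1 k2 k3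
    clear hz hu hl hdd ht ht2 hs hm
    grind
  · have k0 := hs.fix _ hz (by simp [funext_iff, forall_fin_four])
    have k1 := hs.fix _ hu (by simp [funext_iff, forall_fin_four])
    have k2 := hs.fix _ hl (by simp [funext_iff, forall_fin_four])
    have k3 := hm.fix _ ht (by simp [funext_iff, forall_fin_four])
    simp only [← Matrix.ext_iff, forall_fin_four, Matrix.mul_apply, Fin.sum_univ_four]
      at k0 k1 k2 k3
    simp [e0, e1, e2, e3, e4, e5, e6, s0, s1, s2, s3, s4, s5, s6] at k0 k1 k2 k3
    clear hz hu hl hdd ht ht2 hs hm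
    grind
  · have k0 := hs.neg _ hz (by simp [funext_iff, forall_fin_four])
    have k1 := hm.neg _ ht (by simp [funext_iff, forall_fin_four])
    have k2 := hm.fix _ hu (by simp [funext_iff, forall_fin_four])
    simp only [← Matrix.ext_iff, forall_fin_four, Matrix.mul_apply, Fin.sum_univ_four] at k0 k1 k2
    simp [e0, e1, e2, e3, e4, e5, e6, s0, s1, s2, s3, s4, s5, s6] at k0 k1 k2
    clear hz hu hl hdd ht ht2 hs hm
    grind
  · have k0 := hs.neg _ hz (by simp [funext_iff, forall_fin_four])
    have k1 := hm.neg _ ht2 (by simp [funext_iff, forall_fin_four])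
    have k2 := hm.fix _ hl (by simp [funext_iff, forall_fin_four])
    simp only [← Matrix.ext_iff, forall_fin_four, Matrix.mul_apply, Fin.sum_univ_four] at k0 k1 k2
    simp [e0, e1, e2, e3, e4, e5, e6, s0, s1, s2, s3, s4, s5, s6] at k0 k1 k2
    clear hz hu hl hdd ht ht2 hs hm
    grind

end RankFour

/-! ### Equivariant bilinear maps that are multiples of the exterior product. -/

section Solutions

variable {p n : ℕ} [hp : Fact p.Prime] [NeZero n] {w₀ : skew p n}

omit [NeZero n] in
theorem eq_of_basisWedge
    {δ ε : (Fin n → ZMod p) →ₗ[ZMod p] (Fin n → ZMod p) →ₗ[ZMod p] skew p n}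
    (h : ∀ i j, δ (Pi.single i 1) (Pi.single j 1) = ε (Pi.single i 1) (Pi.single j 1)) :
    δ = ε := by
  refine LinearMap.pi_ext' fun i => LinearMap.ext_ring (LinearMap.pi_ext' fun j =>
    LinearMap.ext_ring ?_)
  exact h i j

omit hp [NeZero n] in
theorem skew_apply_self [Fact p.Prime] (hp3 : 3 ≤ p) (X : skew p n) (i : Fin n) : X.1 i i = 0 := by
  have h : (2 : ZMod p) * X.1 i i = 0 := by linear_combination skew_apply X i i
  exact (mul_eq_zero.1 h).resolve_left (two_ne_zero_zmod hp3)

omit [NeZero n] in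
theorem eq_smul_basisWedge (hp3 : 3 ≤ p) {X : skew p n} {i j : Fin n}
    (h : ∀ k l, k ≠ l → ¬ ((k = i ∧ l = j) ∨ (k = j ∧ l = i)) → X.1 k l = 0) :
    X = X.1 i j • basisWedge p i j := by
  ext k l
  rw [Submodule.coe_smul, Matrix.smul_apply, basisWedge_apply, smul_eq_mul]
  by_cases hkl : k = l
  · subst hkl
    rw [skew_apply_self hp3]
    ring
  by_cases h1 : k = i ∧ l = j
  · obtain ⟨rfl, rfl⟩ := h1
    simp [hkl]
  by_cases h2 : k = j ∧ l = i
  · obtain ⟨rfl, rfl⟩ := h2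
    simp [hkl, skew_apply X l k]
  rw [h k l hkl (not_or.2 ⟨h1, h2⟩)]
  have h3 : ((if k = i then 1 else 0) * (if l = j then 1 else 0) : ZMod p) = 0 := by
    by_cases hki : k = i
    · rw [if_neg fun hl => h1 ⟨hki, hl⟩, mul_zero]
    · rw [if_neg hki, zero_mul]
  have h4 : ((if k = j then 1 else 0) * (if l = i then 1 else 0) : ZMod p) = 0 := by
    by_cases hkj : k = j
    · rw [if_neg fun hl => h2 ⟨hkj, hl⟩, mul_zero]
    · rw [if_neg hkj, zero_mul]
  rw [h3, h4, sub_zero, mul_zero]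

omit [NeZero n] in
theorem diagonal_mulVec_single_one (t : Fin n → ZMod p) (i : Fin n) :
    (Matrix.diagonal t).mulVec (Pi.single i 1) = t i • Pi.single i 1 := by
  rw [Matrix.diagonal_mulVec_single, mul_one, ← Pi.single_smul, smul_eq_mul, mul_one]

omit [NeZero n] in
theorem congruence_diagonal_basisWedge (t : Fin n → ZMod p) (i j : Fin n) :
    congruence (Matrix.diagonal t) (basisWedge p i j) = (t i * t j) • basisWedge p i j := by
  rw [basisWedge, congruence_wedge, diagonal_mulVec_single_one, diagonal_mulVec_single_one,
    map_smul, map_smul, LinearMap.smul_apply, smul_smul, mul_comm]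

omit [NeZero n] in
theorem congruence_diagonal_apply (t : Fin n → ZMod p) (X : skew p n) (k l : Fin n) :
    (congruence (Matrix.diagonal t) X).1 k l = t k * t l * X.1 k l := by
  rw [coe_congruence, Matrix.diagonal_transpose, Matrix.mul_diagonal, Matrix.diagonal_mul]
  ring

/-- Values of an equivariant bilinear map only involve weights matching under the diagonal
matrices. -/
theorem Equivariant.apply_eq_zero
    {δ : (Fin n → ZMod p) →ₗ[ZMod p] (Fin n → ZMod p) →ₗ[ZMod p] skew p n}
    (hδ : Equivariant w₀ δ) {t : Fin n → ZMod p} (ht : AutMatrix w₀ (Matrix.diagonal t))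
    {i j k l : Fin n} (h : t i * t j ≠ t k * t l) :
    (δ (Pi.single i 1) (Pi.single j 1)).1 k l = 0 := by
  have h1 := congrFun (congrFun (congrArg Subtype.val
    (hδ _ ht (Pi.single i 1) (Pi.single j 1))) k) l
  rw [diagonal_mulVec_single_one, diagonal_mulVec_single_one, map_smul, map_smul,
    LinearMap.smul_apply, congruence_diagonal_apply,
    Submodule.coe_smul, Submodule.coe_smul, Matrix.smul_apply, Matrix.smul_apply, smul_eq_mul,
    smul_eq_mul] at h1
  have h3 : (t i * t j - t k * t l) * (δ (Pi.single i 1) (Pi.single j 1)).1 k l = 0 := by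
    linear_combination h1
  exact (mul_eq_zero.1 h3).resolve_left (sub_ne_zero.2 h)

/-- If enough diagonal sign matrices and transvections are induced by automorphisms, then an
equivariant bilinear map is a multiple of the exterior product. -/
theorem Equivariant.exists_eq_smul_wedge (hp3 : 3 ≤ p) (hn : 3 ≤ n)
    {δ : (Fin n → ZMod p) →ₗ[ZMod p] (Fin n → ZMod p) →ₗ[ZMod p] skew p n}
    (hδ : Equivariant w₀ δ) {N : ℕ} (T : Fin N → Fin n → ℤ)
    (hT : ∀ a, AutMatrix w₀ (Matrix.diagonal fun i => (T a i : ZMod p)))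
    (hT1 : ∀ a i, T a i * T a i = 1)
    (hsep : ∀ i j k l, k ≠ l → ¬ ((k = i ∧ l = j) ∨ (k = j ∧ l = i)) →
      ∃ a, T a i * T a j * (T a k * T a l) = -1)
    (c : Fin n) (hc : ∀ i, i ≠ c → AutMatrix w₀ (Matrix.transvection c i 1)) :
    ∃ m : ZMod p, ∀ u v, δ u v = m • wedge u v := by
  have h2 := two_ne_zero_zmod hp3
  set D : Fin n → Fin n → skew p n := fun i j => δ (Pi.single i 1) (Pi.single j 1) with hDdef
  set f : Fin n → Fin n → ZMod p := fun i j => (D i j).1 i j with hfdef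
  -- A sign matrix with opposite signs on `e_i ∧ e_j` and `e_k ∧ e_l` excludes the latter from
  -- `δ(e_i, e_j)`.
  have hzero : ∀ i j k l, k ≠ l → ¬ ((k = i ∧ l = j) ∨ (k = j ∧ l = i)) → (D i j).1 k l = 0 := by
    intro i j k l hkl hij
    obtain ⟨a, ha⟩ := hsep i j k l hkl hij
    refine hδ.apply_eq_zero (hT a) fun h => ?_
    have ha' := congrArg (Int.cast : ℤ → ZMod p) ha
    have hk := congrArg (Int.cast : ℤ → ZMod p) (hT1 a k)
    have hl := congrArg (Int.cast : ℤ → ZMod p) (hT1 a l)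
    push_cast at ha' hk hl
    rw [h] at ha'
    refine h2 ?_
    linear_combination ha' - (T a l * T a l : ZMod p) * hk - hl
  have hD : ∀ i j, D i j = f i j • basisWedge p i j := fun i j =>
    eq_smul_basisWedge hp3 (hzero i j)
  have hDii : ∀ i, D i i = 0 := fun i => by
    rw [hD, basisWedge, wedge_self, smul_zero]
  have hti : ∀ i, (Matrix.transvection c i (1 : ZMod p)).mulVec (Pi.single i 1) =
      Pi.single i 1 + Pi.single c 1 := fun i => by
    rw [Matrix.transvection, Matrix.add_mulVec, Matrix.one_mulVec, Matrix.single_mulVec]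
    ext k
    simp [Function.update_apply, Pi.single_apply]
  have htj : ∀ i j, j ≠ i → (Matrix.transvection c i (1 : ZMod p)).mulVec (Pi.single j 1) =
      Pi.single j 1 := fun i j hj => by
    rw [Matrix.transvection, Matrix.add_mulVec, Matrix.one_mulVec, Matrix.single_mulVec]
    ext k
    simp [hj.symm]
  -- The transvection sends `e_i` to `e_i + e_c`. Applying it to pairs of basis vectors links all
  -- coefficients `f i j` to those with index `c`, and so to each other.
  have hsymm : ∀ i, i ≠ c → f i c = f c i := by
    intro i hi
    have h1 := hδ _ (hc i hi) (Pi.single i 1) (Pi.single i 1)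
    rw [hti, map_add, map_add, LinearMap.add_apply, LinearMap.add_apply] at h1
    change D i i + D c i + (D i c + D c c) = congruence _ (D i i) at h1
    rw [hDii, hDii, map_zero, zero_add, add_zero, hD, hD] at h1
    have h3 := congrFun (congrFun (congrArg Subtype.val h1) i) c
    simp [basisWedge_apply, hi, hi.symm] at h3
    linear_combination h3
  have hleft : ∀ i j, i ≠ c → j ≠ c → i ≠ j → f c j = f i j := by
    intro i j hi hj hij
    have h1 := hδ _ (hc i hi) (Pi.single i 1) (Pi.single j 1)
    rw [hti, htj i j hij.symm, map_add, LinearMap.add_apply] at h1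
    change D i j + D c j = congruence _ (D i j) at h1
    rw [hD, hD, map_smul, basisWedge, congruence_wedge, hti, htj i j hij.symm, map_add,
      LinearMap.add_apply] at h1
    change _ • basisWedge p i j + _ • basisWedge p c j =
      _ • (basisWedge p i j + basisWedge p c j) at h1
    have h3 := congrFun (congrFun (congrArg Subtype.val h1) c) j
    simpa [basisWedge_apply, hi, hi.symm, hj, hj.symm, hij, hij.symm] using h3
  have hright : ∀ i j, i ≠ c → j ≠ c → i ≠ j → f j c = f j i := by
    intro i j hi hj hij
    have h1 := hδ _ (hc i hi) (Pi.single j 1) (Pi.single i 1)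
    rw [hti, htj i j hij.symm, map_add] at h1
    change D j i + D j c = congruence _ (D j i) at h1
    rw [hD, hD, map_smul, basisWedge, congruence_wedge, hti, htj i j hij.symm, map_add] at h1
    change _ • basisWedge p j i + _ • basisWedge p j c =
      _ • (basisWedge p j i + basisWedge p j c) at h1
    have h3 := congrFun (congrFun (congrArg Subtype.val h1) j) c
    simpa [basisWedge_apply, hi, hi.symm, hj, hj.symm, hij, hij.symm] using h3
  have hcc : ∀ i j, i ≠ c → j ≠ c → f c i = f c j := by
    intro i j hi hj
    by_cases hij : i = j
    · rw [hij]
    · rw [← hsymm i hi, hright j i hj hi (Ne.symm hij), ← hleft i j hi hj hij]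
  have : Nontrivial (Fin n) := Fin.nontrivial_iff_two_le.2 (by omega)
  obtain ⟨r, hr⟩ := exists_ne c
  refine ⟨f c r, fun u v => ?_⟩
  suffices h : δ = f c r • wedge by rw [h]; rfl
  refine eq_of_basisWedge fun i j => ?_
  change D i j = f c r • basisWedge p i j
  by_cases hij : i = j
  · rw [hij, hDii, basisWedge, wedge_self, smul_zero]
  rw [hD]
  congr 1
  by_cases hi : i = c
  · rw [hi, hcc j r (fun h => hij (hi.trans h.symm)) hr]
  by_cases hj : j = c
  · rw [hj, hsymm i hi, hcc i r hi hr]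
  rw [← hleft i j hi hj hij, hcc j r hj hr]

/-- The computation of `T` when all equivariant bilinear maps are multiples of the exterior
product. -/
theorem Model.nonempty_TGroup_mulEquiv_units (hp3 : 3 ≤ p) (hn : 2 ≤ n) (hw₀ : w₀ ≠ 0)
    (hr : Rigid w₀) (r : Fin n) (hr0 : r ≠ 0)
    (hdiag : ∀ d : (ZMod p)ˣ,
      congruence (Matrix.diagonal (Function.update 1 r (d : ZMod p))) w₀ = (d : ZMod p) • w₀)
    (hsol : ∀ δ, Equivariant w₀ δ → ∃ m : ZMod p, ∀ u v, δ u v = m • wedge u v) :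
    Nonempty (TGroup (Model w₀) ≃* (ZMod p)ˣ) := by
  have h2 := two_ne_zero_zmod hp3
  have : Nontrivial (Fin n) := Fin.nontrivial_iff_two_le.2 hn
  let θ : (ZMod p)ˣ →* Matrix (Fin n) (Fin n) (ZMod p) :=
    { toFun := fun d => Matrix.diagonal (Function.update 1 r (d : ZMod p))
      map_one' := by
        rw [Units.val_one, ← Matrix.diagonal_one]
        exact congrArg Matrix.diagonal (Function.update_eq_self r (1 : Fin n → ZMod p))
      map_mul' := fun a b => by
        rw [Matrix.diagonal_mul_diagonal]
        congr 1
        ext i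
        by_cases hi : i = r
        · subst hi; simp
        · simp [hi] }
  let φ : (ZMod p)ˣ →* Module.End (ZMod p) (skew p n) :=
    { toFun := fun d => (d : ZMod p) • 1
      map_one' := by simp
      map_mul' := fun a b => by rw [smul_mul_smul_comm, one_mul, Units.val_mul] }
  have hφ : ∀ d X, φ d X = (d : ZMod p) • X := fun _ _ => rfl
  refine Model.nonempty_TGroup_mulEquiv hp3 hw₀ hr θ φ (fun q v => ?_) (fun q s X => ?_)
    (fun q A _ X => ?_) (fun q => hdiag q) (fun q hq => ?_) fun δ hδ hnd => ?_
  · change (Matrix.diagonal _).mulVec v 0 = _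
    rw [Matrix.mulVec_diagonal, Function.update_of_ne hr0.symm, Pi.one_apply, one_mul]
  · rw [hφ, hφ, map_smul]
  · rw [hφ, hφ, map_smul]
  · have h3 := hφ q w₀
    rw [hq, Module.End.one_apply] at h3
    have h4 : ((q : ZMod p) - 1) • w₀ = 0 := by
      calc ((q : ZMod p) - 1) • w₀ = (q : ZMod p) • w₀ - w₀ := by module
        _ = 0 := by rw [← h3, sub_self]
    exact Units.ext (sub_eq_zero.1 ((smul_eq_zero.1 h4).resolve_right hw₀))
  · obtain ⟨m, hm⟩ := hsol δ hδ
    -- The transported commutator is `(1 + 2 * m) • wedge u v`; if it vanished, any nonzero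
    -- functional would contradict nondegeneracy.
    have h3 : 1 + 2 * m ≠ 0 := by
      intro h0
      obtain ⟨j, hj⟩ := exists_ne r
      let χ : skew p n →ₗ[ZMod p] ZMod p :=
        { toFun := fun X => X.1 r j
          map_add' := fun _ _ => rfl
          map_smul' := fun _ _ => rfl }
      have hχ : χ = 0 := by
        refine hnd χ fun u v => ?_
        have h4 : wedge u v + δ u v - δ v u = 0 := by
          rw [hm, hm, wedge_swap v u, smul_neg, sub_neg_eq_add]
          calc wedge u v + m • wedge u v + m • wedge u v = (1 + 2 * m) • wedge u v := by module
            _ = 0 := by rw [h0, zero_smul]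
        rw [h4, map_zero]
      have h5 : χ (basisWedge p r j) = 0 := by rw [hχ]; rfl
      have h6 : χ (basisWedge p r j) = 1 := by
        change (basisWedge p r j).1 r j = 1
        simp [basisWedge_apply, hj]
      exact one_ne_zero (h6.symm.trans h5)
    refine ⟨Units.mk0 _ h3, fun u v => ?_⟩
    rw [hφ, hm, Units.val_mk0, add_smul, one_smul, add_sub_cancel_left, smul_smul,
      inv_mul_cancel_left₀ h2]

end Solutions

/-! ### The four cases with a decomposable bivector. -/

section Cases

variable {p : ℕ} [hp : Fact p.Prime]

theorem Model.nonempty_TGroup_mulEquiv_three_zero_one (hp5 : 5 ≤ p) :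
    Nonempty (TGroup (Model (basisWedge p (0 : Fin 3) 1)) ≃* (ZMod p)ˣ) := by
  have hp3 : 3 ≤ p := by omega
  refine Model.nonempty_TGroup_mulEquiv_units hp3 (by norm_num) (basisWedge_ne_zero (by decide))
    (rigid_three_zero_one hp5) 1 (by decide) (fun d => ?_) fun δ hδ => ?_
  · rw [congruence_diagonal_basisWedge]
    simp
  -- The sign vectors must come from automorphisms and separate distinct pairs of indices. Index `1`
  -- serves as pivot because row `1` of an automorphism matrix has free off-diagonal entries.
  refine hδ.exists_eq_smul_wedge hp3 le_rfl ![![-1, 1, 1], ![1, 1, -1]] (Fin.forall_fin_two.2 ?_)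
    (by decide) (by decide) 1 (forall_fin_three.2 ?_)
  · constructor
    · convert autMatrix_three_zero_one (p := p) (x := -1) (a := 0) (b := 0) (z := 1) (by simp)
        (by simp) using 1
      ext k l
      fin_cases k <;> fin_cases l <;> simp
    · convert autMatrix_three_zero_one (p := p) (x := 1) (a := 0) (b := 0) (z := -1) (by simp)
        (by simp) using 1
      ext k l
      fin_cases k <;> fin_cases l <;> simp
  · refine ⟨fun _ => ?_, fun h => absurd rfl h, fun _ => ?_⟩
    · convert autMatrix_three_zero_one (p := p) (x := 1) (a := 1) (b := 0) (z := 1) (by simp)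
        (by simp) using 1
      ext k l
      fin_cases k <;> fin_cases l <;> simp [Matrix.transvection]
    · convert autMatrix_three_zero_one (p := p) (x := 1) (a := 0) (b := 1) (z := 1) (by simp)
        (by simp) using 1
      ext k l
      fin_cases k <;> fin_cases l <;> simp [Matrix.transvection]

theorem Model.nonempty_TGroup_mulEquiv_three_one_two (hp3 : 3 ≤ p) :
    Nonempty (TGroup (Model (basisWedge p (1 : Fin 3) 2)) ≃* (ZMod p)ˣ) := by
  refine Model.nonempty_TGroup_mulEquiv_units hp3 (by norm_num) (basisWedge_ne_zero (by decide))
    (rigid_three_one_two hp3) 1 (by decide) (fun d => ?_) fun δ hδ => ?_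
  · rw [congruence_diagonal_basisWedge]
    simp
  refine hδ.exists_eq_smul_wedge hp3 le_rfl ![![1, -1, -1], ![-1, -1, 1]] (Fin.forall_fin_two.2 ?_)
    (by decide) (by decide) 1 (forall_fin_three.2 ?_)
  · constructor
    · convert autMatrix_three_one_two (p := p) (x := 1) (a := 0) (b := 0) (c := -1) (d := 0)
        (e := 0) (f := -1) (by simp) (by simp) using 1
      ext k l
      fin_cases k <;> fin_cases l <;> simp
    · convert autMatrix_three_one_two (p := p) (x := -1) (a := 0) (b := 0) (c := -1) (d := 0)
        (e := 0) (f := 1) (by simp) (by simp) using 1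
      ext k l
      fin_cases k <;> fin_cases l <;> simp
  · refine ⟨fun _ => ?_, fun h => absurd rfl h, fun _ => ?_⟩
    · convert autMatrix_three_one_two (p := p) (x := 1) (a := 1) (b := 0) (c := 1) (d := 0)
        (e := 0) (f := 1) (by simp) (by simp) using 1
      ext k l
      fin_cases k <;> fin_cases l <;> simp [Matrix.transvection]
    · convert autMatrix_three_one_two (p := p) (x := 1) (a := 0) (b := 0) (c := 1) (d := 1)
        (e := 0) (f := 1) (by simp) (by simp) using 1
      ext k l
      fin_cases k <;> fin_cases l <;> simp [Matrix.transvection]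

theorem Model.nonempty_TGroup_mulEquiv_four_zero_one (hp5 : 5 ≤ p) :
    Nonempty (TGroup (Model (basisWedge p (0 : Fin 4) 1)) ≃* (ZMod p)ˣ) := by
  have hp3 : 3 ≤ p := by omega
  refine Model.nonempty_TGroup_mulEquiv_units hp3 (by norm_num) (basisWedge_ne_zero (by decide))
    (rigid_four_zero_one hp5) 1 (by decide) (fun d => ?_) fun δ hδ => ?_
  · rw [congruence_diagonal_basisWedge]
    simp
  refine hδ.exists_eq_smul_wedge hp3 (by norm_num)
    ![![-1, 1, 1, 1], ![1, 1, -1, 1], ![1, 1, 1, -1]] (forall_fin_three.2 ?_)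
    (by decide) (by decide) 1 (forall_fin_four.2 ?_)
  · refine ⟨?_, ?_, ?_⟩
    · convert autMatrix_four_zero_one (p := p) (x := -1) (a := 0) (b := 0) (c := 0) (d := 1)
        (e := 0) (f := 0) (g := 1) (by simp) (by simp) using 1
      ext k l
      fin_cases k <;> fin_cases l <;> simp
    · convert autMatrix_four_zero_one (p := p) (x := 1) (a := 0) (b := 0) (c := 0) (d := -1)
        (e := 0) (f := 0) (g := 1) (by simp) (by simp) using 1
      ext k l
      fin_cases k <;> fin_cases l <;> simp
    · convert autMatrix_four_zero_one (p := p) (x := 1) (a := 0) (b := 0) (c := 0) (d := 1)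
        (e := 0) (f := 0) (g := -1) (by simp) (by simp) using 1
      ext k l
      fin_cases k <;> fin_cases l <;> simp
  · refine ⟨fun _ => ?_, fun h => absurd rfl h, fun _ => ?_, fun _ => ?_⟩
    · convert autMatrix_four_zero_one (p := p) (x := 1) (a := 1) (b := 0) (c := 0) (d := 1)
        (e := 0) (f := 0) (g := 1) (by simp) (by simp) using 1
      ext k l
      fin_cases k <;> fin_cases l <;> simp [Matrix.transvection]
    · convert autMatrix_four_zero_one (p := p) (x := 1) (a := 0) (b := 1) (c := 0) (d := 1)
        (e := 0) (f := 0) (g := 1) (by simp) (by simp) using 1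
      ext k l
      fin_cases k <;> fin_cases l <;> simp [Matrix.transvection]
    · convert autMatrix_four_zero_one (p := p) (x := 1) (a := 0) (b := 0) (c := 1) (d := 1)
        (e := 0) (f := 0) (g := 1) (by simp) (by simp) using 1
      ext k l
      fin_cases k <;> fin_cases l <;> simp [Matrix.transvection]

theorem Model.nonempty_TGroup_mulEquiv_four_two_three (hp3 : 3 ≤ p) :
    Nonempty (TGroup (Model (basisWedge p (2 : Fin 4) 3)) ≃* (ZMod p)ˣ) := by
  refine Model.nonempty_TGroup_mulEquiv_units hp3 (by norm_num) (basisWedge_ne_zero (by decide))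
    (rigid_four_two_three hp3) 2 (by decide) (fun d => ?_) fun δ hδ => ?_
  · rw [congruence_diagonal_basisWedge]
    simp
  refine hδ.exists_eq_smul_wedge hp3 (by norm_num)
    ![![1, -1, 1, 1], ![1, 1, -1, -1], ![-1, 1, -1, 1]] (forall_fin_three.2 ?_)
    (by decide) (by decide) 2 (forall_fin_four.2 ?_)
  · refine ⟨?_, ?_, ?_⟩
    · convert autMatrix_four_two_three (p := p) (x := 1) (y := -1) (a := 0) (b := 0) (c := 0)
        (a' := 0) (b' := 0) (d := 1) (e := 0) (f := 0) (g := 1) (by simp) (by simp) (by simp)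
        using 1
      ext k l
      fin_cases k <;> fin_cases l <;> simp
    · convert autMatrix_four_two_three (p := p) (x := 1) (y := 1) (a := 0) (b := 0) (c := 0)
        (a' := 0) (b' := 0) (d := -1) (e := 0) (f := 0) (g := -1) (by simp) (by simp) (by simp)
        using 1
      ext k l
      fin_cases k <;> fin_cases l <;> simp
    · convert autMatrix_four_two_three (p := p) (x := -1) (y := 1) (a := 0) (b := 0) (c := 0)
        (a' := 0) (b' := 0) (d := -1) (e := 0) (f := 0) (g := 1) (by simp) (by simp) (by simp)
        using 1
      ext k l
      fin_cases k <;> fin_cases l <;> simp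
  · refine ⟨fun _ => ?_, fun _ => ?_, fun h => absurd rfl h, fun _ => ?_⟩
    · convert autMatrix_four_two_three (p := p) (x := 1) (y := 1) (a := 0) (b := 1) (c := 0)
        (a' := 0) (b' := 0) (d := 1) (e := 0) (f := 0) (g := 1) (by simp) (by simp) (by simp)
        using 1
      ext k l
      fin_cases k <;> fin_cases l <;> simp [Matrix.transvection]
    · convert autMatrix_four_two_three (p := p) (x := 1) (y := 1) (a := 0) (b := 0) (c := 0)
        (a' := 1) (b' := 0) (d := 1) (e := 0) (f := 0) (g := 1) (by simp) (by simp) (by simp)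
        using 1
      ext k l
      fin_cases k <;> fin_cases l <;> simp [Matrix.transvection]
    · convert autMatrix_four_two_three (p := p) (x := 1) (y := 1) (a := 0) (b := 0) (c := 0)
        (a' := 0) (b' := 0) (d := 1) (e := 1) (f := 0) (g := 1) (by simp) (by simp) (by simp)
        using 1
      ext k l
      fin_cases k <;> fin_cases l <;> simp [Matrix.transvection]

end Cases

/-! ### The symplectic bivector. -/

section Symplectic

variable {p : ℕ} [hp : Fact p.Prime]

/-- The contraction of a skew-symmetric matrix with the standard symplectic form. -/
def contraction (p : ℕ) : skew p 4 →ₗ[ZMod p] ZMod p where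
  toFun X := X.1 0 1 + X.1 2 3
  map_add' X Y := by
    rw [Submodule.coe_add, Matrix.add_apply, Matrix.add_apply]
    ring
  map_smul' c X := by
    rw [Submodule.coe_smul, Matrix.smul_apply, Matrix.smul_apply, smul_eq_mul, smul_eq_mul,
      RingHom.id_apply, smul_eq_mul]
    ring

theorem contraction_apply (X : skew p 4) : contraction p X = X.1 0 1 + X.1 2 3 := rfl

theorem contraction_symplectic :
    contraction p (basisWedge p 0 1 + basisWedge p 2 3) = 2 := by
  simp [contraction_apply, basisWedge_apply]
  norm_num

/-- With `J` the matrix of `w₀`, the contraction is `-½ tr(J X)`. Since `J² = -1`, the relation `A J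
Aᵀ = A 0 0 • J` also yields `Aᵀ J A = A 0 0 • J`, whence the scaling. The proof verifies this on
entries. -/
theorem contraction_congruence (hp3 : 3 ≤ p) {A : Matrix (Fin 4) (Fin 4) (ZMod p)}
    (h : AutMatrix (basisWedge p 0 1 + basisWedge p 2 3) A) (X : skew p 4) :
    contraction p (congruence A X) = A 0 0 * contraction p X := by
  obtain ⟨h01, h02, h03, h11, h21, h31, hdet⟩ := h.entries_four_symplectic
  have key := fun k l => congrFun (congrFun (congrArg Subtype.val h.congruence_eq) k) l
  simp only [congruence_basisWedge_apply, Submodule.coe_smul, Matrix.smul_apply,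
    basisWedge_apply, smul_eq_mul, Submodule.coe_add, Matrix.add_apply, map_add] at key
  have k2 := key 1 2
  have k3 := key 1 3
  simp [h11, h21, h31] at k2 k3
  have e2 : A 2 0 = A 1 2 * A 2 3 - A 1 3 * A 2 2 := by linear_combination -k2
  have e3 : A 3 0 = A 1 2 * A 3 3 - A 1 3 * A 3 2 := by linear_combination -k3
  have hs := skew_apply_self hp3 X
  have hX := skew_apply X
  rw [contraction_apply, contraction_apply, coe_congruence]
  simp only [Matrix.mul_apply, Fin.sum_univ_four, Matrix.transpose_apply, h01, h02, h03, h11, h21,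
    h31, hs, hX 0 1, hX 0 2, hX 0 3, hX 1 2, hX 1 3, hX 2 3, e2, e3, ← hdet]
  ring

theorem contraction_congruence_diagonal (e : ZMod p) (X : skew p 4) :
    contraction p (congruence (Matrix.diagonal ![1, e, 1, e]) X) = e * contraction p X := by
  rw [contraction_apply, contraction_apply, congruence_diagonal_apply, congruence_diagonal_apply]
  simp
  ring

theorem congruence_diagonal_symplectic (e : ZMod p) :
    congruence (Matrix.diagonal ![1, e, 1, e]) (basisWedge p 0 1 + basisWedge p 2 3) =
      e • (basisWedge p 0 1 + basisWedge p 2 3) := by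
  rw [map_add, congruence_diagonal_basisWedge, congruence_diagonal_basisWedge]
  simp

/-- The endomorphism acting as `e` on the symplectic bivector and as `d` on the kernel of the
contraction. -/
noncomputable def symplecticEnd (hp3 : 3 ≤ p) :
    (ZMod p)ˣ × (ZMod p)ˣ →* Module.End (ZMod p) (skew p 4) where
  toFun q := (q.1 : ZMod p) • 1 + (((q.2 : ZMod p) - q.1) * 2⁻¹) •
    (contraction p).smulRight (basisWedge p 0 1 + basisWedge p 2 3)
  map_one' := by simp
  map_mul' a b := by
    have h2 : (2 : ZMod p) * 2⁻¹ = 1 := mul_inv_cancel₀ (two_ne_zero_zmod hp3)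
    have hw := contraction_symplectic (p := p)
    refine LinearMap.ext fun X => ?_
    simp only [Module.End.mul_apply, LinearMap.add_apply, LinearMap.smul_apply,
      Module.End.one_apply, LinearMap.smulRight_apply, Prod.fst_mul, Prod.snd_mul, Units.val_mul]
    generalize basisWedge p (0 : Fin 4) 1 + basisWedge p 2 3 = w at hw ⊢
    simp only [map_add, map_smul, smul_eq_mul, hw]
    match_scalars
    · ring
    · linear_combination
        -((a.2 : ZMod p) - a.1) * (b.2 - b.1) * 2⁻¹ * contraction p X * h2

theorem symplecticEnd_apply (hp3 : 3 ≤ p) (q : (ZMod p)ˣ × (ZMod p)ˣ) (X : skew p 4) :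
    symplecticEnd hp3 q X = (q.1 : ZMod p) • X + (((q.2 : ZMod p) - q.1) * 2⁻¹) •
      contraction p X • (basisWedge p 0 1 + basisWedge p 2 3) := rfl

theorem symplecticEnd_comm (hp3 : 3 ≤ p) (q : (ZMod p)ˣ × (ZMod p)ˣ) {s : ZMod p}
    {f : skew p 4 →ₗ[ZMod p] skew p 4} (hf : ∀ X, contraction p (f X) = s * contraction p X)
    (hs : f (basisWedge p 0 1 + basisWedge p 2 3) = s • (basisWedge p 0 1 + basisWedge p 2 3))
    (X : skew p 4) : symplecticEnd hp3 q (f X) = f (symplecticEnd hp3 q X) := by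
  rw [symplecticEnd_apply, symplecticEnd_apply, hf, map_add, map_smul, map_smul, map_smul, hs]
  module

/-- Diagonal automorphisms satisfy `t 0 * t 1 = t 2 * t 3`, so `e₀ ∧ e₁` and `e₂ ∧ e₃` cannot be
separated; all other distinct pairs can. The bound `5` keeps the weight difference nonzero modulo
every `p ≥ 5`. -/
theorem forall_exists_separating_symplectic : ∀ i j k l : Fin 4, k ≠ l →
    ¬ ((k = i ∧ l = j) ∨ (k = j ∧ l = i)) →
    ¬ ((i = 0 ∧ j = 1 ∨ i = 1 ∧ j = 0 ∨ i = 2 ∧ j = 3 ∨ i = 3 ∧ j = 2) ∧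
      (k = 0 ∧ l = 1 ∨ k = 1 ∧ l = 0 ∨ k = 2 ∧ l = 3 ∨ k = 3 ∧ l = 2)) →
    ∃ t ∈ ([![1, 1, -1, -1], ![-1, 1, -1, 1], ![2, 1, 2, 1], ![2, 1, 1, 2]] :
      List (Fin 4 → ℤ)), t i * t j - t k * t l ≠ 0 ∧ (t i * t j - t k * t l).natAbs < 5 := by
  decide

theorem autMatrix_diagonal_symplectic (hp3 : 3 ≤ p) {t : Fin 4 → ℤ}
    (ht : t ∈ ([![1, 1, -1, -1], ![-1, 1, -1, 1], ![2, 1, 2, 1], ![2, 1, 1, 2]] :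
      List (Fin 4 → ℤ))) :
    AutMatrix (basisWedge p 0 1 + basisWedge p 2 3)
      (Matrix.diagonal fun i => (t i : ZMod p)) := by
  have h2 := two_ne_zero_zmod hp3
  simp only [List.mem_cons, List.not_mem_nil, or_false] at ht
  obtain rfl | rfl | rfl | rfl := ht
  · convert autMatrix_four_symplectic (p := p) (x := 1) (a := 0) (b := 0) (c := 0) (u := 0)
      (v := 0) (d := -1) (e := 0) (f := 0) (g := -1) (by simp) (by simp) (by simp) (by simp) using 1
    ext k l
    fin_cases k <;> fin_cases l <;> simp
  · convert autMatrix_four_symplectic (p := p) (x := -1) (a := 0) (b := 0) (c := 0) (u := 0)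
      (v := 0) (d := -1) (e := 0) (f := 0) (g := 1) (by simp) (by simp) (by simp) (by simp) using 1
    ext k l
    fin_cases k <;> fin_cases l <;> simp
  · convert autMatrix_four_symplectic (p := p) (x := 2) (a := 0) (b := 0) (c := 0) (u := 0)
      (v := 0) (d := 2) (e := 0) (f := 0) (g := 1) (by simp) h2 (by simp) (by simp) using 1
    ext k l
    fin_cases k <;> fin_cases l <;> simp
  · convert autMatrix_four_symplectic (p := p) (x := 2) (a := 0) (b := 0) (c := 0) (u := 0)
      (v := 0) (d := 1) (e := 0) (f := 0) (g := 2) (by simp) h2 (by simp) (by simp) using 1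
    ext k l
    fin_cases k <;> fin_cases l <;> simp

theorem intCast_ne_zero_of_natAbs_lt {z : ℤ} (hz : z ≠ 0) (h : z.natAbs < p) :
    (z : ZMod p) ≠ 0 := by
  rw [Ne, ZMod.intCast_zmod_eq_zero_iff_dvd]
  exact fun hd => hz (Int.eq_zero_of_dvd_of_natAbs_lt_natAbs hd (by simpa using h))

/-- Each value of an equivariant map on the standard basis is supported on basis bivectors of the
same weight. -/
theorem Equivariant.apply_symplectic (hp5 : 5 ≤ p)
    {δ : (Fin 4 → ZMod p) →ₗ[ZMod p] (Fin 4 → ZMod p) →ₗ[ZMod p] skew p 4}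
    (hδ : Equivariant (basisWedge p 0 1 + basisWedge p 2 3) δ) :
    (∀ i j, ¬ (i = 0 ∧ j = 1 ∨ i = 1 ∧ j = 0 ∨ i = 2 ∧ j = 3 ∨ i = 3 ∧ j = 2) →
      ∃ f : ZMod p, δ (Pi.single i 1) (Pi.single j 1) = f • basisWedge p i j) ∧
    ∃ f g : ZMod p, δ (Pi.single 0 1) (Pi.single 1 1) =
      f • basisWedge p 0 1 + g • basisWedge p 2 3 := by
  have hp3 : 3 ≤ p := by omega
  set D : Fin 4 → Fin 4 → skew p 4 := fun i j => δ (Pi.single i 1) (Pi.single j 1) with hDdef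
  have hzero : ∀ i j k l, k ≠ l → ¬ ((k = i ∧ l = j) ∨ (k = j ∧ l = i)) →
      ¬ ((i = 0 ∧ j = 1 ∨ i = 1 ∧ j = 0 ∨ i = 2 ∧ j = 3 ∨ i = 3 ∧ j = 2) ∧
        (k = 0 ∧ l = 1 ∨ k = 1 ∧ l = 0 ∨ k = 2 ∧ l = 3 ∨ k = 3 ∧ l = 2)) → (D i j).1 k l = 0 := by
    intro i j k l hkl h1 h2
    obtain ⟨t, ht, ht0, ht5⟩ := forall_exists_separating_symplectic i j k l hkl h1 h2
    refine hδ.apply_eq_zero (autMatrix_diagonal_symplectic hp3 ht) fun h => ?_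
    refine intCast_ne_zero_of_natAbs_lt ht0 (ht5.trans_le hp5) ?_
    push_cast
    exact sub_eq_zero.2 h
  refine ⟨fun i j hij => ⟨(D i j).1 i j, eq_smul_basisWedge hp3 fun k l hkl h =>
    hzero i j k l hkl h fun h => hij h.1⟩, (D 0 1).1 0 1, (D 0 1).1 2 3, ?_⟩
  change D 0 1 = _
  have h1 := hzero 0 1 0 2 (by decide) (by decide) (by decide)
  have h2 := hzero 0 1 0 3 (by decide) (by decide) (by decide)
  have h3 := hzero 0 1 1 2 (by decide) (by decide) (by decide)
  have h4 := hzero 0 1 1 3 (by decide) (by decide) (by decide)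
  have hX := skew_apply (D 0 1)
  have hs := skew_apply_self hp3 (D 0 1)
  ext k l
  rw [Submodule.coe_add, Matrix.add_apply, Submodule.coe_smul, Matrix.smul_apply,
    Submodule.coe_smul, Matrix.smul_apply, basisWedge_apply, basisWedge_apply]
  fin_cases k <;> fin_cases l <;>
    simp [hs, h1, h2, h3, h4, hX 0 1, hX 0 2, hX 0 3, hX 1 2, hX 1 3, hX 2 3]

set_option maxHeartbeats 800000 in
theorem Equivariant.exists_eq_smul_wedge_add (hp5 : 5 ≤ p)
    {δ : (Fin 4 → ZMod p) →ₗ[ZMod p] (Fin 4 → ZMod p) →ₗ[ZMod p] skew p 4}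
    (hδ : Equivariant (basisWedge p 0 1 + basisWedge p 2 3) δ) :
    ∃ c m : ZMod p, ∀ u v, δ u v = c • wedge u v +
      (m * contraction p (wedge u v)) • (basisWedge p 0 1 + basisWedge p 2 3) := by
  set D : Fin 4 → Fin 4 → skew p 4 := fun i j => δ (Pi.single i 1) (Pi.single j 1) with hDdef
  obtain ⟨hD, f, g, h01⟩ : (∀ i j, ¬ (i = 0 ∧ j = 1 ∨ i = 1 ∧ j = 0 ∨ i = 2 ∧ j = 3 ∨
      i = 3 ∧ j = 2) → ∃ f : ZMod p, D i j = f • basisWedge p i j) ∧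
      ∃ f g : ZMod p, D 0 1 = f • basisWedge p 0 1 + g • basisWedge p 2 3 := hδ.apply_symplectic hp5
  have hDii : ∀ i, D i i = 0 := fun i => by
    obtain ⟨f, hf⟩ := hD i i (by revert i; decide)
    rw [hf, basisWedge, wedge_self, smul_zero]
  have key : ∀ A, AutMatrix (basisWedge p 0 1 + basisWedge p 2 3) A → ∀ i j,
      δ (A.mulVec (Pi.single i 1)) (A.mulVec (Pi.single j 1)) = congruence A (D i j) :=
    fun A hA i j => hδ A hA _ _
  -- Three unipotent automorphisms: `τ` sends `e₀` to `e₀ + e₁`, `ρ` sends `e₂` to `e₂ + e₃`, and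
  -- `σ` sends `e₀` to `e₀ + e₂` and `e₃` to `e₃ - e₁`. They relate all the coefficients left free
  -- by the weights; only `f02` and `g` remain independent.
  have htau := autMatrix_four_symplectic (p := p) (x := 1) (a := 1) (b := 0) (c := 0) (u := 0)
    (v := 0) (d := 1) (e := 0) (f := 0) (g := 1) (by simp) (by simp) (by simp) (by simp)
  have hrho := autMatrix_four_symplectic (p := p) (x := 1) (a := 0) (b := 0) (c := 0) (u := 0)
    (v := 0) (d := 1) (e := 0) (f := 1) (g := 1) (by simp) (by simp) (by simp) (by simp)
  have hsigma := autMatrix_four_symplectic (p := p) (x := 1) (a := 0) (b := 0) (c := -1) (u := 1)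
    (v := 0) (d := 1) (e := 0) (f := 0) (g := 1) (by simp) (by simp) (by simp) (by simp)
  set τ : Matrix (Fin 4) (Fin 4) (ZMod p) :=
    !![1, 0, 0, 0; 1, 1, 0, 0; 0, 0, 1, 0; 0, 0, 0, 1] with hτ
  set ρ : Matrix (Fin 4) (Fin 4) (ZMod p) :=
    !![1, 0, 0, 0; 0, 1, 0, 0; 0, 0, 1, 0; 0, 0, 1, 1] with hρ
  set σ : Matrix (Fin 4) (Fin 4) (ZMod p) :=
    !![1, 0, 0, 0; 0, 1, 0, -1; 1, 0, 1, 0; 0, 0, 0, 1] with hσ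
  have hτ0 : τ.mulVec (Pi.single 0 1) = Pi.single 0 1 + Pi.single 1 1 := by
    ext k; fin_cases k <;> simp [hτ]
  have hτ2 : τ.mulVec (Pi.single 2 1) = Pi.single 2 1 := by
    ext k; fin_cases k <;> simp [hτ]
  have hτ3 : τ.mulVec (Pi.single 3 1) = Pi.single 3 1 := by
    ext k; fin_cases k <;> simp [hτ]
  have hρ0 : ρ.mulVec (Pi.single 0 1) = Pi.single 0 1 := by
    ext k; fin_cases k <;> simp [hρ]
  have hρ2 : ρ.mulVec (Pi.single 2 1) = Pi.single 2 1 + Pi.single 3 1 := by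
    ext k; fin_cases k <;> simp [hρ]
  have hσ0 : σ.mulVec (Pi.single 0 1) = Pi.single 0 1 + Pi.single 2 1 := by
    ext k; fin_cases k <;> simp [hσ]
  have hσ1 : σ.mulVec (Pi.single 1 1) = Pi.single 1 1 := by
    ext k; fin_cases k <;> simp [hσ]
  have hσ3 : σ.mulVec (Pi.single 3 1) = Pi.single 3 1 - Pi.single 1 1 := by
    ext k; fin_cases k <;> simp [hσ]
  have t00 := key τ htau 0 0
  have t02 := key τ htau 0 2
  have t20 := key τ htau 2 0
  have t03 := key τ htau 0 3
  have t30 := key τ htau 3 0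
  have r22 := key ρ hrho 2 2
  have r02 := key ρ hrho 0 2
  have r20 := key ρ hrho 2 0
  have s00 := key σ hsigma 0 0
  have s01 := key σ hsigma 0 1
  have s03 := key σ hsigma 0 3
  simp only [hτ0, hτ2, hτ3, hρ0, hρ2, hσ0, hσ1, hσ3, map_add, map_sub, LinearMap.add_apply]
    at t00 t02 t20 t03 t30 r22 r02 r20 s00 s01 s03
  have hfold : ∀ i j, δ (Pi.single i 1) (Pi.single j 1) = D i j := fun _ _ => rfl
  simp only [hfold, hDii, map_zero, zero_add, add_zero]
    at t00 t02 t20 t03 t30 r22 r02 r20 s00 s01 s03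
  obtain ⟨f02, h02⟩ := hD 0 2 (by decide)
  obtain ⟨f20, h20⟩ := hD 2 0 (by decide)
  obtain ⟨f03, h03⟩ := hD 0 3 (by decide)
  obtain ⟨f30, h30⟩ := hD 3 0 (by decide)
  obtain ⟨f12, h12⟩ := hD 1 2 (by decide)
  obtain ⟨f21, h21⟩ := hD 2 1 (by decide)
  obtain ⟨f13, h13⟩ := hD 1 3 (by decide)
  obtain ⟨f31, h31⟩ := hD 3 1 (by decide)
  simp only [h01, h02, h20, h03, h30, h12, h21, h13, h31, map_smul, map_add]
    at t02 t20 t03 t30 r02 r20 s00 s01 s03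
  replace t02 := congrFun (congrFun (congrArg Subtype.val t02) 1) 2
  replace t20 := congrFun (congrFun (congrArg Subtype.val t20) 1) 2
  replace t03 := congrFun (congrFun (congrArg Subtype.val t03) 1) 3
  replace t30 := congrFun (congrFun (congrArg Subtype.val t30) 1) 3
  replace r02 := congrFun (congrFun (congrArg Subtype.val r02) 0) 3
  replace r20 := congrFun (congrFun (congrArg Subtype.val r20) 0) 3
  replace s00 := congrFun (congrFun (congrArg Subtype.val s00) 0) 2
  replace s01 := congrFun (congrFun (congrArg Subtype.val s01) 1) 2
  simp [congruence_basisWedge_apply, basisWedge_apply, hτ, hρ, hσ]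
    at t02 t20 t03 t30 r02 r20 s00 s01
  obtain rfl : f02 = f20 := by linear_combination s00
  obtain rfl : f02 = f12 := by linear_combination -t02
  obtain rfl : f02 = f21 := by linear_combination -t20
  obtain rfl : f02 = f03 := by linear_combination -r02
  obtain rfl : f02 = f30 := by linear_combination -r20
  obtain rfl : f02 = f13 := by linear_combination -t03
  obtain rfl : f02 = f31 := by linear_combination -t30
  obtain rfl : f02 + g = f := by linear_combination -s01
  have h10 : D 1 0 = -D 0 1 := by rw [← sub_eq_zero, ← t00]; abel
  have h32 : D 3 2 = -D 2 3 := by rw [← sub_eq_zero, ← r22]; abel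
  -- The equation from `σ` on `(e₀, e₃)` expresses `D 2 3` through values already known.
  have h23 : D 2 3 = (f02 + g) • basisWedge p 2 3 + g • basisWedge p 0 1 := by
    have hcs : congruence σ (basisWedge p 0 3) = basisWedge p 0 3 - basisWedge p 0 1 +
        (basisWedge p 2 3 - basisWedge p 2 1) := by
      rw [basisWedge, congruence_wedge, hσ0, hσ3, map_add, LinearMap.add_apply, map_sub, map_sub]
      rfl
    calc D 2 3 = f02 • basisWedge p 0 3 + D 2 3 - ((f02 + g) • basisWedge p 0 1 +
            g • basisWedge p 2 3 + f02 • basisWedge p 2 1) - f02 • basisWedge p 0 3 +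
          ((f02 + g) • basisWedge p 0 1 + g • basisWedge p 2 3 + f02 • basisWedge p 2 1) := by abel
      _ = _ := by
        rw [s03, hcs]
        module
  refine ⟨f02, g, fun u v => ?_⟩
  suffices h : δ = f02 • wedge + wedge.compr₂ (g • (contraction p).smulRight
      (basisWedge p 0 1 + basisWedge p 2 3)) by
    rw [h]
    simp [smul_smul]
  have hc : ∀ i j : Fin 4, contraction p (basisWedge p i j) = (basisWedge p i j).1 0 1 +
    (basisWedge p i j).1 2 3 := fun _ _ => rfl
  have hs : ∀ i j : Fin 4, basisWedge p i j = -basisWedge p j i := fun _ _ => wedge_swap _ _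
  have hii : ∀ i : Fin 4, basisWedge p i i = 0 := fun _ => wedge_self _
  refine eq_of_basisWedge fun i j => ?_
  change D i j = f02 • basisWedge p i j + g • contraction p (basisWedge p i j) •
    (basisWedge p 0 1 + basisWedge p 2 3)
  rw [hc, basisWedge_apply, basisWedge_apply]
  fin_cases i <;> fin_cases j <;> dsimp only [Fin.zero_eta, Fin.mk_one, Fin.reduceFinMk] <;>
    simp only [hDii, hii, h01, h10, h23, h32, h02, h20, h03, h30, h12, h21, h13, h31] <;>
    simp [hs 1 0, hs 3 2] <;> module

/-- The diagonal matrices multiplying the symplectic bivector by a scalar. -/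
def symplecticDiagonal : (ZMod p)ˣ × (ZMod p)ˣ →* Matrix (Fin 4) (Fin 4) (ZMod p) where
  toFun q := Matrix.diagonal ![1, (q.2 : ZMod p), 1, (q.2 : ZMod p)]
  map_one' := by
    ext k l
    fin_cases k <;> fin_cases l <;> simp
  map_mul' a b := by
    rw [Matrix.diagonal_mul_diagonal]
    congr 1
    ext k
    fin_cases k <;> simp

theorem eq_one_of_symplecticEnd_eq_one (hp3 : 3 ≤ p) {q : (ZMod p)ˣ × (ZMod p)ˣ}
    (hq : symplecticEnd hp3 q = 1) : q = 1 := by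
  have h2 := two_ne_zero_zmod hp3
  have hw := contraction_symplectic (p := p)
  have h3 := symplecticEnd_apply hp3 q (basisWedge p 0 2)
  have h4 := symplecticEnd_apply hp3 q (basisWedge p 0 1 + basisWedge p 2 3)
  rw [hq, Module.End.one_apply] at h3 h4
  generalize basisWedge p (0 : Fin 4) 1 + basisWedge p 2 3 = w at hw h4
  have h5 := congrArg (contraction p) h4
  have h6 := congrFun (congrFun (congrArg Subtype.val h3) 0) 2
  simp [basisWedge_apply] at h6
  rw [map_add, map_smul, map_smul, map_smul, hw, smul_eq_mul, smul_eq_mul, smul_eq_mul] at h5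
  have h7 : (2 : ZMod p) * 2⁻¹ = 1 := mul_inv_cancel₀ h2
  refine Prod.ext (Units.ext h6.symm) (Units.ext (mul_left_cancel₀ h2 ?_))
  rw [Prod.snd_one, Units.val_one]
  linear_combination -h5 + 2 * (q.1 - q.2 : ZMod p) * h7

/-- The transported commutator is an operator applied to `u ∧ v`, with eigenvalue `1 + 2 * c` on the
kernel of the contraction and `1 + 2 * c + 4 * m` on `w₀`. Nondegeneracy says that both are units,
and they are the two parameters. -/
theorem Equivariant.exists_symplecticEnd (hp5 : 5 ≤ p) (hp3 : 3 ≤ p)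
    {δ : (Fin 4 → ZMod p) →ₗ[ZMod p] (Fin 4 → ZMod p) →ₗ[ZMod p] skew p 4}
    (hδ : Equivariant (basisWedge p 0 1 + basisWedge p 2 3) δ) (hnd : Nondegenerate δ) :
    ∃ q, ∀ u v, δ u v = (2⁻¹ : ZMod p) • (symplecticEnd hp3 q (wedge u v) - wedge u v) := by
  have h2 := two_ne_zero_zmod hp3
  have hw := contraction_symplectic (p := p)
  obtain ⟨c, m, hcm⟩ := hδ.exists_eq_smul_wedge_add hp5
  have hsub : ∀ u v, wedge u v + δ u v - δ v u = (1 + 2 * c) • wedge u v +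
      (2 * m * contraction p (wedge u v)) • (basisWedge p 0 1 + basisWedge p 2 3) := by
    intro u v
    rw [hcm, hcm, wedge_swap v u, map_neg]
    module
  have hd : 1 + 2 * c ≠ 0 := by
    intro h0
    -- This coordinate vanishes on `w₀`, so it annihilates the operator when `1 + 2 * c = 0`.
    let χ : skew p 4 →ₗ[ZMod p] ZMod p :=
      { toFun := fun X => X.1 0 2
        map_add' := fun _ _ => rfl
        map_smul' := fun _ _ => rfl }
    have hχ : χ = 0 := by
      refine hnd χ fun u v => ?_
      rw [hsub, h0, zero_smul, zero_add, map_smul]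
      change _ * (basisWedge p (0 : Fin 4) 1 + basisWedge p 2 3).1 0 2 = 0
      simp [basisWedge_apply]
    have h5 : χ (basisWedge p 0 2) = 0 := by rw [hχ]; rfl
    have h6 : χ (basisWedge p 0 2) = 1 := by
      change (basisWedge p 0 2).1 0 2 = 1
      simp [basisWedge_apply]
    exact one_ne_zero (h6.symm.trans h5)
  have he : 1 + 2 * c + 4 * m ≠ 0 := by
    intro h0
    -- The contraction of `w₀` is `2`, so contracting the transported commutator multiplies
    -- `contraction p (wedge u v)` by `1 + 2 * c + 4 * m`.
    have hχ : contraction p = 0 := by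
      refine hnd _ fun u v => ?_
      rw [hsub, map_add, map_smul, map_smul, hw, smul_eq_mul, smul_eq_mul]
      linear_combination contraction p (wedge u v) * h0
    rw [hχ, LinearMap.zero_apply] at hw
    exact h2 hw.symm
  refine ⟨(Units.mk0 _ hd, Units.mk0 _ he), fun u v => ?_⟩
  have h3 : (2 : ZMod p) * 2⁻¹ = 1 := mul_inv_cancel₀ h2
  rw [symplecticEnd_apply, hcm]
  simp only [Units.val_mk0]
  generalize basisWedge p (0 : Fin 4) 1 + basisWedge p 2 3 = w
  match_scalars
  · linear_combination -c * h3
  · linear_combination -m * contraction p (wedge u v) * (1 + 2 * 2⁻¹) * h3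

theorem symplecticDiagonal_apply (q : (ZMod p)ˣ × (ZMod p)ˣ) :
    symplecticDiagonal q = Matrix.diagonal ![1, (q.2 : ZMod p), 1, (q.2 : ZMod p)] := rfl

theorem symplecticEnd_congruence_symplecticDiagonal (hp3 : 3 ≤ p) (q r : (ZMod p)ˣ × (ZMod p)ˣ)
    (X : skew p 4) : symplecticEnd hp3 q (congruence (symplecticDiagonal r) X) =
      congruence (symplecticDiagonal r) (symplecticEnd hp3 q X) := by
  rw [symplecticDiagonal_apply]
  have h1 := contraction_congruence_diagonal (r.2 : ZMod p)
  have h2 := congruence_diagonal_symplectic (r.2 : ZMod p)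
  generalize congruence (Matrix.diagonal ![1, (r.2 : ZMod p), 1, (r.2 : ZMod p)]) = f at h1 h2 ⊢
  exact symplecticEnd_comm hp3 q h1 h2 X

theorem congruence_symplecticDiagonal (hp3 : 3 ≤ p) (q : (ZMod p)ˣ × (ZMod p)ˣ) :
    congruence (symplecticDiagonal q) (basisWedge p 0 1 + basisWedge p 2 3) =
      symplecticEnd hp3 q (basisWedge p 0 1 + basisWedge p 2 3) := by
  rw [symplecticDiagonal_apply, congruence_diagonal_symplectic, symplecticEnd_apply,
    contraction_symplectic, smul_smul, mul_assoc, inv_mul_cancel₀ (two_ne_zero_zmod hp3)]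
  module

theorem Model.nonempty_TGroup_mulEquiv_symplectic (hp5 : 5 ≤ p) :
    Nonempty (TGroup (Model (basisWedge p (0 : Fin 4) 1 + basisWedge p 2 3)) ≃*
      (ZMod p)ˣ × (ZMod p)ˣ) := by
  have hp3 : 3 ≤ p := by omega
  have hw₀ : basisWedge p (0 : Fin 4) 1 + basisWedge p 2 3 ≠ 0 := fun h =>
    two_ne_zero_zmod hp3 <| by rw [← contraction_symplectic, h, map_zero]
  refine Model.nonempty_TGroup_mulEquiv hp3 hw₀ (rigid_four_symplectic hp5) symplecticDiagonal
    (symplecticEnd hp3) (fun q v => ?_) (symplecticEnd_congruence_symplecticDiagonal hp3)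
    (fun q A hA => symplecticEnd_comm hp3 q (contraction_congruence hp3 hA) hA.congruence_eq)
    (congruence_symplecticDiagonal hp3) (fun q => eq_one_of_symplecticEnd_eq_one hp3)
    fun δ hδ hnd => hδ.exists_symplecticEnd hp5 hp3 hnd
  rw [symplecticDiagonal_apply, Matrix.mulVec_diagonal]
  simp

end Symplectic

/-! ### Assembly of the theorem. -/

section Main

/-- Properties of a group given by generators and relations are read off from its model. -/
theorem properties_of_model {p n : ℕ} [Fact p.Prime] [NeZero n] (hp3 : 3 ≤ p) (hn : 2 ≤ n)
    {N : ℕ} (hN : n + Fintype.card {q : Fin n × Fin n // q.1 < q.2} = N)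
    {w : FreeGroup (Fin n)} {w₀ : skew p n} (hw : w ∈ commutator (FreeGroup (Fin n)))
    (hw₀ : FreeGroup.lift (Model.gen w₀) w = ⟨0, w₀⟩) {Q : Type*} [Group Q]
    (hQ : Nonempty (TGroup (Model w₀) ≃* Q)) :
    Nat.card (PresentedGroup (relators n p w)) = p ^ N ∧
      IsSpecialOfClassTwo (PresentedGroup (relators n p w)) ∧
      Nonempty (TGroup (PresentedGroup (relators n p w)) ≃* Q) := by
  obtain ⟨e⟩ := Model.nonempty_presentedGroup_mulEquiv hp3 w₀ w hw hw₀
  obtain ⟨t⟩ := nonempty_TGroup_congr e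
  obtain ⟨s⟩ := hQ
  exact ⟨by rw [Nat.card_congr e.toEquiv, Model.card_eq hp3, hN],
    (Model.isSpecialOfClassTwo hp3 hn).congr e, ⟨t.trans s⟩⟩

theorem lift_gen_pComm {p n : ℕ} [Fact p.Prime] [NeZero n] (hp3 : 3 ≤ p) (w₀ : skew p n)
    (i j : Fin n) : FreeGroup.lift (Model.gen w₀) (pComm (FreeGroup.of i) (FreeGroup.of j)) =
      ⟨0, basisWedge p i j⟩ := by
  rw [map_pComm, FreeGroup.lift_apply_of, FreeGroup.lift_apply_of, Model.pComm_gen hp3]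
  rfl

end Main

theorem theorem1 (p : ℕ) (hp : p.Prime) :
    (5 ≤ p → Nat.card (GroupA p) = p ^ 6 ∧ IsSpecialOfClassTwo (GroupA p) ∧
      Nonempty (TGroup (GroupA p) ≃* (ZMod p)ˣ)) ∧
    (3 ≤ p → Nat.card (GroupB p) = p ^ 6 ∧ IsSpecialOfClassTwo (GroupB p) ∧
      Nonempty (TGroup (GroupB p) ≃* (ZMod p)ˣ)) ∧
    (5 ≤ p → Nat.card (GroupC p) = p ^ 10 ∧ IsSpecialOfClassTwo (GroupC p) ∧
      Nonempty (TGroup (GroupC p) ≃* (ZMod p)ˣ)) ∧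
    (3 ≤ p → Nat.card (GroupD p) = p ^ 10 ∧ IsSpecialOfClassTwo (GroupD p) ∧
      Nonempty (TGroup (GroupD p) ≃* (ZMod p)ˣ)) ∧
    (5 ≤ p → Nat.card (GroupE p) = p ^ 10 ∧ IsSpecialOfClassTwo (GroupE p) ∧
      Nonempty (TGroup (GroupE p) ≃* (ZMod p)ˣ × (ZMod p)ˣ)) ∧
    (3 ≤ p → ∀ (H : Type) [Group H] [Finite H], IsPGroup p H → Group.nilpotencyClass H = 2 →
      p - 1 ≤ Nat.card (TGroup H)) := by
  have : Fact p.Prime := ⟨hp⟩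
  have h3 : 3 + Fintype.card {q : Fin 3 × Fin 3 // q.1 < q.2} = 6 := by decide
  have h4 : 4 + Fintype.card {q : Fin 4 × Fin 4 // q.1 < q.2} = 10 := by decide
  refine ⟨fun hp5 => ?_, fun hp3 => ?_, fun hp5 => ?_, fun hp3 => ?_, fun hp5 => ?_,
    fun hp3 H _ _ hH h2 => sub_one_le_card_TGroup hp hp3 hH h2⟩
  · have hp3 : 3 ≤ p := by omega
    exact properties_of_model hp3 (by norm_num) h3 (pComm_mem_commutator _ _)
      (lift_gen_pComm hp3 _ _ _) (Model.nonempty_TGroup_mulEquiv_three_zero_one hp5)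
  · exact properties_of_model hp3 (by norm_num) h3 (pComm_mem_commutator _ _)
      (lift_gen_pComm hp3 _ _ _) (Model.nonempty_TGroup_mulEquiv_three_one_two hp3)
  · have hp3 : 3 ≤ p := by omega
    exact properties_of_model hp3 (by norm_num) h4 (pComm_mem_commutator _ _)
      (lift_gen_pComm hp3 _ _ _) (Model.nonempty_TGroup_mulEquiv_four_zero_one hp5)
  · exact properties_of_model hp3 (by norm_num) h4 (pComm_mem_commutator _ _)
      (lift_gen_pComm hp3 _ _ _) (Model.nonempty_TGroup_mulEquiv_four_two_three hp3)
  · have hp3 : 3 ≤ p := by omega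
    refine properties_of_model hp3 (by norm_num) h4
      (mul_mem (pComm_mem_commutator _ _) (pComm_mem_commutator _ _)) ?_
      (Model.nonempty_TGroup_mulEquiv_symplectic hp5)
    rw [map_mul, lift_gen_pComm hp3, lift_gen_pComm hp3, Model.mk_mul_mk_zero]
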